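/- Let $m\in\mathbb N$ be squarefree, $K=\mathbb Q(\sqrt{-m})\subset\mathbb C$ with ring of integers $\mathcal O_K=\mathbb Z+\mathbb Z\omega$, where $\omega=(m+\sqrt{-m})/2$ if $m\equiv 3 \bmod 4$ and $\omega=m+\sqrt{-m}$ otherwise. Let $J=\begin{pmatrix}0&I\\-I&0\end{pmatrix}$ with $2\times2$ blocks and $\Gamma_2(\mathcal O_K)=\{M\in SL_4(\mathcal O_K):\overline M^{tr}JM=J\}$; write $M=\begin{pmatrix}A&B\\C&D\end{pmatrix}$ with $2\times 2$ blocks and $A=(a_{ij})$, $B=(b_{ij})$, $C=(c_{ij})$, $D=(d_{ij})$. For a symmetric non-degenerate even matrix $T\in\mathbb Z^{k\times k}$ let $SO(T;\mathbb R)=\{U\in SL_k(\mathbb R):U^{tr}TU=T\}$, let $SO_0(T;\mathbb Z)$ be the group of integral matrices in the connected component of the identity of $SO(T;\mathbb R)$, and let $\mathcal D(T;\mathbb Z)=\{U\in SO_0(T;\mathbb Z):U\in I+\mathbb Z^{k\times k}T\}$. For $N\in\mathbb N$ put $U(N)\oplus T=\begin{pmatrix}0&0&N\\0&T&0\\N&0&0\end{pmatrix}$.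 Let $$S_K=\begin{pmatrix}2&2\,\mathrm{Re}\,\omega\\2\,\mathrm{Re}\,\omega&2|\omega|^2\end{pmatrix},\qquad S_0=U(1)\oplus(-S_K),\qquad S_1=U(1)\oplus S_0\in\mathbb Z^{6\times6}.$$ Put $\begin{pmatrix}\alpha&\beta\\\gamma&\delta\end{pmatrix}^\sharp=\begin{pmatrix}\delta&-\beta\\-\gamma&\alpha\end{pmatrix}$, and let $\varphi$ be the coordinate map from the Hermitian complex $2\times2$ matrices to $\mathbb R^4$ with respect to the basis $\begin{pmatrix}1&0\\0&0\end{pmatrix},\begin{pmatrix}0&1\\1&0\end{pmatrix},\begin{pmatrix}0&\omega\\\overline\omega&0\end{pmatrix},\begin{pmatrix}0&0\\0&1\end{pmatrix}$. For $M\in\Gamma_2(\mathcal O_K)$ the determinants of $A,B,C,D$ are real, the matrices $A^\sharp B$, $AC^\sharp$, $BD^\sharp$, $C^\sharp D$ are Hermitian, and $f_M(Z)=AZD^\sharp+BZ^\sharp C^\sharp$ maps Hermitian matrices to Hermitian matrices, so that one can define $$\widetilde M=\begin{pmatrix}\det A&-\varphi(A^\sharp B)^{tr}S_0&-\det B\\-\varphi(AC^\sharp)&\mathcal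 K&\varphi(BD^\sharp)\\-\det C&\varphi(C^\sharp D)^{tr}S_0&\det D\end{pmatrix}\in\mathbb R^{6\times 6},$$ where $\mathcal K$ is the matrix of $f_M$ with respect to the basis above. Congruences modulo $N\in\mathbb N$ between elements or matrices over $\mathcal O_K$ are modulo $N\mathcal O_K$. Then: a) The map $\pm M\mapsto\widetilde M$ is a group isomorphism $\Gamma_2(\mathcal O_K)/\{\pm I\}\to\mathcal D(S_1;\mathbb Z)$. b) For every $N\in\mathbb N$ this isomorphism maps the principal congruence subgroup $$\{M\in\Gamma_2(\mathcal O_K):M\equiv\varepsilon I\bmod N \text{ for some } \varepsilon\in\mathbb Z \text{ with } \varepsilon^2\equiv1\bmod N\}/\{\pm I\}$$ onto $\mathcal D(NS_1;\mathbb Z)$. c) For all $n,N\in\mathbb N$ with $n\mid N$, with $F=\mathrm{diag}(1,1,1,1,n,N)$, one has $F\,\mathcal D(U(N)\oplus U(n)\oplus(-S_K);\mathbb Z)\,F^{-1}\subseteq\mathcal D(S_1;\mathbb Z)$, and the isomorphism of a) maps the subgroup of all $\pm M$, $M\in\Gamma_2(\mathcal O_K)$, satisfying - $a_{11}\equiv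 d_{11}\equiv\overline{a}_{22}\equiv\overline{d}_{22}\equiv\varepsilon\bmod n$ for some $\varepsilon\in\mathcal O_K$ with $\varepsilon\overline\varepsilon\equiv1\bmod n$, - $\det A\equiv\det D\equiv1\bmod N$, - $a_{21}\equiv b_{22}\equiv d_{12}\equiv0\bmod n$, - $c_{11}\equiv0\bmod Nn$ and $c_{12}\equiv c_{21}\equiv c_{22}\equiv0\bmod N$ onto $F\,\mathcal D(U(N)\oplus U(n)\oplus(-S_K);\mathbb Z)\,F^{-1}$. -/

import Mathlib

open Matrix NumberField
open scoped ComplexConjugate MatrixGroups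

namespace HermMod

noncomputable section

/-! ## Orthogonal groups and discriminant kernels -/

section Orthogonal

variable {ι : Type*} [Fintype ι] [DecidableEq ι]

/-- `SO(T; ℝ) = {U ∈ SL(ℝ) : Uᵗ T U = T}`. -/
def specialOrthogonal (T : Matrix ι ι ℤ) : Subgroup (Matrix.SpecialLinearGroup ι ℝ) where
  carrier := {U | (U : Matrix ι ι ℝ)ᵀ * T.map (Int.cast : ℤ → ℝ) * (U : Matrix ι ι ℝ)
    = T.map (Int.cast : ℤ → ℝ)}
  one_mem' := by simp
  mul_mem' := by
    intro U V hU hV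
    simp only [Set.mem_ofPred_eq, Matrix.SpecialLinearGroup.coe_mul, transpose_mul] at *
    calc _ = (V : Matrix ι ι ℝ)ᵀ * ((U : Matrix ι ι ℝ)ᵀ * T.map (Int.cast : ℤ → ℝ) *
              (U : Matrix ι ι ℝ)) * (V : Matrix ι ι ℝ) := by simp only [Matrix.mul_assoc]
      _ = _ := by rw [hU, hV]
  inv_mem' := by
    intro U hU
    simp only [Set.mem_ofPred_eq] at *
    have h1 : (U : Matrix ι ι ℝ) * ((U⁻¹ : Matrix.SpecialLinearGroup ι ℝ) : Matrix ι ι ℝ) = 1 := by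
      rw [← Matrix.SpecialLinearGroup.coe_mul, mul_inv_cancel, Matrix.SpecialLinearGroup.coe_one]
    have h2 : ((U⁻¹ : Matrix.SpecialLinearGroup ι ℝ) : Matrix ι ι ℝ)ᵀ * (U : Matrix ι ι ℝ)ᵀ = 1 := by
      rw [← transpose_mul, h1, transpose_one]
    generalize ((U⁻¹ : Matrix.SpecialLinearGroup ι ℝ) : Matrix ι ι ℝ) = V at *
    calc Vᵀ * T.map (Int.cast : ℤ → ℝ) * V
        = Vᵀ * ((U : Matrix ι ι ℝ)ᵀ * T.map (Int.cast : ℤ → ℝ) * (U : Matrix ι ι ℝ)) * V := by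
          rw [hU]
      _ = (Vᵀ * (U : Matrix ι ι ℝ)ᵀ) * T.map (Int.cast : ℤ → ℝ) *
            ((U : Matrix ι ι ℝ) * V) := by simp only [Matrix.mul_assoc]
      _ = _ := by rw [h1, h2, Matrix.one_mul, Matrix.mul_one]

/-- `SO₀(T; ℝ)`: the connected component of the identity of `SO(T; ℝ)`, as a subgroup of
`SL(ℝ)`. -/
def specialOrthogonal₀ (T : Matrix ι ι ℤ) : Subgroup (Matrix.SpecialLinearGroup ι ℝ) :=
  (Subgroup.connectedComponentOfOne (specialOrthogonal T)).map (specialOrthogonal T).subtype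

/-- `SO₀(T; ℤ)`: the integral matrices in `SO₀(T; ℝ)`. -/
def specialOrthogonal₀Int (T : Matrix ι ι ℤ) : Subgroup (Matrix.SpecialLinearGroup ι ℤ) :=
  (specialOrthogonal₀ T).comap (Matrix.SpecialLinearGroup.map (Int.castRingHom ℝ))

/-- The discriminant kernel `𝒟(T; ℤ) = {U ∈ SO₀(T; ℤ) : U ∈ I + ℤ^{m×m} T}`. -/
def discriminantKernel (T : Matrix ι ι ℤ) : Subgroup (Matrix.SpecialLinearGroup ι ℤ) where
  carrier := {U | U ∈ specialOrthogonal₀Int T ∧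
    ∃ X : Matrix ι ι ℤ, (U : Matrix ι ι ℤ) = 1 + X * T}
  one_mem' := ⟨one_mem _, 0, by simp⟩
  mul_mem' := by
    rintro U V ⟨hU, X, hX⟩ ⟨hV, Y, hY⟩
    refine ⟨mul_mem hU hV, (U : Matrix ι ι ℤ) * Y + X, ?_⟩
    rw [Matrix.SpecialLinearGroup.coe_mul, hY, Matrix.mul_add, Matrix.mul_one, Matrix.add_mul]
    nth_rewrite 1 [hX]
    rw [Matrix.mul_assoc]
    abel
  inv_mem' := by
    rintro U ⟨hU, X, hX⟩
    refine ⟨inv_mem hU, -(((U⁻¹ : Matrix.SpecialLinearGroup ι ℤ) : Matrix ι ι ℤ) * X), ?_⟩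
    have h1 : ((U⁻¹ : Matrix.SpecialLinearGroup ι ℤ) : Matrix ι ι ℤ) * (U : Matrix ι ι ℤ) = 1 := by
      rw [← Matrix.SpecialLinearGroup.coe_mul, inv_mul_cancel, Matrix.SpecialLinearGroup.coe_one]
    generalize ((U⁻¹ : Matrix.SpecialLinearGroup ι ℤ) : Matrix ι ι ℤ) = V at *
    rw [hX, Matrix.mul_add, Matrix.mul_one, ← Matrix.mul_assoc] at h1
    rw [Matrix.neg_mul, ← h1]
    abel

end Orthogonal

/-- The orthogonal sum `U(N) ⊕ T` for `T` of size two. -/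
def hypSum₂ (N : ℤ) (T : Matrix (Fin 2) (Fin 2) ℤ) : Matrix (Fin 4) (Fin 4) ℤ :=
  !![0, 0, 0, N;
     0, T 0 0, T 0 1, 0;
     0, T 1 0, T 1 1, 0;
     N, 0, 0, 0]

/-- The orthogonal sum `U(N) ⊕ T` for `T` of size four. -/
def hypSum₄ (N : ℤ) (T : Matrix (Fin 4) (Fin 4) ℤ) : Matrix (Fin 6) (Fin 6) ℤ :=
  !![0, 0, 0, 0, 0, N;
     0, T 0 0, T 0 1, T 0 2, T 0 3, 0;
     0, T 1 0, T 1 1, T 1 2, T 1 3, 0;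
     0, T 2 0, T 2 1, T 2 2, T 2 3, 0;
     0, T 3 0, T 3 1, T 3 2, T 3 3, 0;
     N, 0, 0, 0, 0, 0]

/-! ## The imaginary-quadratic field -/

/-- The complex number `√(-m)` in the closed upper half-plane. -/
def sqrtNeg (m : ℕ) : ℂ := (Real.sqrt m : ℂ) * Complex.I

/-- The imaginary-quadratic field `K = ℚ(√(-m)) ⊆ ℂ`. -/
abbrev K (m : ℕ) : IntermediateField ℚ ℂ := IntermediateField.adjoin ℚ {sqrtNeg m}

/-- The embedding `𝒪_K → ℂ` of the ring of integers of `K = ℚ(√(-m))`. -/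
def toC (m : ℕ) : 𝓞 (K m) →+* ℂ := algebraMap (𝓞 (K m)) ℂ

/-- `ω_K = (m + √(-m))/2` if `m ≡ 3 mod 4` and `ω_K = m + √(-m)` otherwise. -/
def omega (m : ℕ) : ℂ := if m % 4 = 3 then (m + sqrtNeg m) / 2 else m + sqrtNeg m

/-- The integral matrix `S_K = (2, 2 Re ω_K; 2 Re ω_K, 2 |ω_K|²)`, written out explicitly (see
`SK_map_cast`). The division by `2` is exact. -/
def SK (m : ℕ) : Matrix (Fin 2) (Fin 2) ℤ :=
  if m % 4 = 3 then !![2, m; m, (m * (m + 1)) / 2] else !![2, 2 * m; 2 * m, 2 * (m * (m + 1))]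

theorem sqrtNeg_re (m : ℕ) : (sqrtNeg m).re = 0 := by simp [sqrtNeg]

theorem sqrtNeg_im (m : ℕ) : (sqrtNeg m).im = Real.sqrt m := by simp [sqrtNeg]

theorem SK_map_cast (m : ℕ) :
    (SK m).map (Int.cast : ℤ → ℝ) =
      !![2, 2 * (omega m).re; 2 * (omega m).re, 2 * Complex.normSq (omega m)] := by
  have hs : Real.sqrt m * Real.sqrt m = m := Real.mul_self_sqrt (Nat.cast_nonneg m)
  unfold SK omega
  split_ifs with h
  · have h2 : (2 : ℤ) ∣ (m : ℤ) * (m + 1) := (Int.even_mul_succ_self m).two_dvd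
    have h3 : (((m * (m + 1) / 2 : ℤ)) : ℝ) = (m * (m + 1) : ℝ) / 2 := by
      rw [Int.cast_div h2 (by norm_num)]; push_cast; ring
    have hre : ((m + sqrtNeg m) / 2 : ℂ).re = m / 2 := by
      simp [sqrtNeg_re]
    have him : ((m + sqrtNeg m) / 2 : ℂ).im = Real.sqrt m / 2 := by
      simp [sqrtNeg_im]
    ext i j
    fin_cases i <;> fin_cases j
    · simp
    · simp [hre]; ring
    · simp [hre]; ring
    · simp only [Complex.normSq_apply, hre, him]
      simp [h3]; nlinarith [hs]
  · have hre : ((m + sqrtNeg m) : ℂ).re = m := by simp [sqrtNeg_re]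
    have him : ((m + sqrtNeg m) : ℂ).im = Real.sqrt m := by simp [sqrtNeg_im]
    ext i j
    fin_cases i <;> fin_cases j
    · simp
    · simp [hre]
    · simp [hre]
    · simp only [Complex.normSq_apply, hre, him]
      simp; nlinarith [hs]

/-- `S₀ = U(1) ⊕ (-S_K)`. -/
def S₀ (m : ℕ) : Matrix (Fin 4) (Fin 4) ℤ := hypSum₂ 1 (-SK m)

/-- `S₁ = U(1) ⊕ S₀ = U(1) ⊕ U(1) ⊕ (-S_K)`. -/
def S₁ (m : ℕ) : Matrix (Fin 6) (Fin 6) ℤ := hypSum₄ 1 (S₀ m)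

/-! ## The Hermitian modular group -/

/-- `J = (0, I; -I, 0)`. -/
def J : Matrix (Fin 2 ⊕ Fin 2) (Fin 2 ⊕ Fin 2) ℂ := fromBlocks 0 1 (-1) 0

/-- `SU(2,2; ℂ) = {M ∈ SL₄(ℂ) : M̄ᵗ J M = J}`. -/
def SU22 : Subgroup (Matrix.SpecialLinearGroup (Fin 2 ⊕ Fin 2) ℂ) where
  carrier := {M | (M : Matrix _ _ ℂ)ᴴ * J * (M : Matrix _ _ ℂ) = J}
  one_mem' := by simp
  mul_mem' := by
    intro U V hU hV
    simp only [Set.mem_ofPred_eq, Matrix.SpecialLinearGroup.coe_mul, conjTranspose_mul] at *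
    calc _ = (V : Matrix _ _ ℂ)ᴴ * ((U : Matrix _ _ ℂ)ᴴ * J * (U : Matrix _ _ ℂ)) *
              (V : Matrix _ _ ℂ) := by simp only [Matrix.mul_assoc]
      _ = _ := by rw [hU, hV]
  inv_mem' := by
    intro U hU
    simp only [Set.mem_ofPred_eq] at *
    have h1 : (U : Matrix _ _ ℂ) * ((U⁻¹ : Matrix.SpecialLinearGroup (Fin 2 ⊕ Fin 2) ℂ) :
      Matrix (Fin 2 ⊕ Fin 2) (Fin 2 ⊕ Fin 2) ℂ) = 1 := by
      rw [← Matrix.SpecialLinearGroup.coe_mul, mul_inv_cancel, Matrix.SpecialLinearGroup.coe_one]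
    have h2 : ((U⁻¹ : Matrix.SpecialLinearGroup (Fin 2 ⊕ Fin 2) ℂ) :
      Matrix (Fin 2 ⊕ Fin 2) (Fin 2 ⊕ Fin 2) ℂ)ᴴ * (U : Matrix _ _ ℂ)ᴴ = 1 := by
      rw [← conjTranspose_mul, h1, conjTranspose_one]
    generalize ((U⁻¹ : Matrix.SpecialLinearGroup (Fin 2 ⊕ Fin 2) ℂ) :
      Matrix (Fin 2 ⊕ Fin 2) (Fin 2 ⊕ Fin 2) ℂ) = V at *
    calc Vᴴ * J * V = Vᴴ * ((U : Matrix _ _ ℂ)ᴴ * J * (U : Matrix _ _ ℂ)) * V := by rw [hU]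
      _ = (Vᴴ * (U : Matrix _ _ ℂ)ᴴ) * J * ((U : Matrix _ _ ℂ) * V) := by
          simp only [Matrix.mul_assoc]
      _ = _ := by rw [h1, h2, Matrix.one_mul, Matrix.mul_one]

/-- The Hermitian modular group `Γ₂(𝒪_K) = {M ∈ SL₄(𝒪_K) : M̄ᵗ J M = J}`. -/
def Gam (m : ℕ) : Subgroup (Matrix.SpecialLinearGroup (Fin 2 ⊕ Fin 2) (𝓞 (K m))) :=
  SU22.comap (Matrix.SpecialLinearGroup.map (toC m))

/-- The complex `4 × 4` matrix underlying an element of `Γ₂(𝒪_K)`. -/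
def cmat {m : ℕ} (M : Gam m) : Matrix (Fin 2 ⊕ Fin 2) (Fin 2 ⊕ Fin 2) ℂ :=
  (M.1 : Matrix (Fin 2 ⊕ Fin 2) (Fin 2 ⊕ Fin 2) (𝓞 (K m))).map (toC m)

/-- The block `A` of `M = (A, B; C, D)`. -/
def blkA {m : ℕ} (M : Gam m) : Matrix (Fin 2) (Fin 2) ℂ := (cmat M).toBlocks₁₁
/-- The block `B` of `M = (A, B; C, D)`. -/
def blkB {m : ℕ} (M : Gam m) : Matrix (Fin 2) (Fin 2) ℂ := (cmat M).toBlocks₁₂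
/-- The block `C` of `M = (A, B; C, D)`. -/
def blkC {m : ℕ} (M : Gam m) : Matrix (Fin 2) (Fin 2) ℂ := (cmat M).toBlocks₂₁
/-- The block `D` of `M = (A, B; C, D)`. -/
def blkD {m : ℕ} (M : Gam m) : Matrix (Fin 2) (Fin 2) ℂ := (cmat M).toBlocks₂₂

theorem cmat_eq {m : ℕ} (M : Gam m) :
    cmat M = fromBlocks (blkA M) (blkB M) (blkC M) (blkD M) := (fromBlocks_toBlocks _).symm

theorem cmat_one (m : ℕ) : cmat (1 : Gam m) = 1 := by
  simp [cmat]

theorem cmat_mul {m : ℕ} (M M' : Gam m) : cmat (M * M') = cmat M * cmat M' := by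
  simp [cmat]

theorem cmat_unitary {m : ℕ} (M : Gam m) : (cmat M)ᴴ * J * cmat M = J := M.2

theorem cmat_inv {m : ℕ} (M : Gam m) :
    cmat M⁻¹ = fromBlocks (blkD M)ᴴ (-(blkB M)ᴴ) (-(blkC M)ᴴ) (blkA M)ᴴ := by
  have hJ : J * J = -1 := by
    simp [J, fromBlocks_multiply, ← fromBlocks_one, fromBlocks_neg]
  have h1 : fromBlocks (blkD M)ᴴ (-(blkB M)ᴴ) (-(blkC M)ᴴ) (blkA M)ᴴ = -(J * (cmat M)ᴴ * J) := by
    rw [cmat_eq M, fromBlocks_conjTranspose]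
    simp [J, fromBlocks_multiply, fromBlocks_neg]
  have h2 : -(J * (cmat M)ᴴ * J) * cmat M = 1 := by
    rw [Matrix.neg_mul, Matrix.mul_assoc J, Matrix.mul_assoc J, cmat_unitary, hJ, neg_neg]
  have h3 : cmat M * cmat M⁻¹ = 1 := by rw [← cmat_mul, mul_inv_cancel, cmat_one]
  rw [h1]
  calc cmat M⁻¹ = (-(J * (cmat M)ᴴ * J) * cmat M) * cmat M⁻¹ := by rw [h2, Matrix.one_mul]
    _ = _ := by rw [Matrix.mul_assoc, h3, Matrix.mul_one]

theorem blk_mul {m : ℕ} (M M' : Gam m) :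
    blkA (M * M') = blkA M * blkA M' + blkB M * blkC M' ∧
    blkB (M * M') = blkA M * blkB M' + blkB M * blkD M' ∧
    blkC (M * M') = blkC M * blkA M' + blkD M * blkC M' ∧
    blkD (M * M') = blkC M * blkB M' + blkD M * blkD M' := by
  have h := cmat_mul M M'
  rw [cmat_eq M, cmat_eq M', cmat_eq (M * M'), fromBlocks_multiply, fromBlocks_inj] at h
  exact h

theorem blk_inv {m : ℕ} (M : Gam m) :
    blkA M⁻¹ = (blkD M)ᴴ ∧ blkB M⁻¹ = -(blkB M)ᴴ ∧ blkC M⁻¹ = -(blkC M)ᴴ ∧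
    blkD M⁻¹ = (blkA M)ᴴ := by
  have h := cmat_inv M
  rw [cmat_eq M⁻¹, fromBlocks_inj] at h
  exact h

theorem blk_one (m : ℕ) :
    blkA (1 : Gam m) = 1 ∧ blkB (1 : Gam m) = 0 ∧ blkC (1 : Gam m) = 0 ∧
    blkD (1 : Gam m) = 1 := by
  have h := cmat_one m
  rw [cmat_eq, ← fromBlocks_one, fromBlocks_inj] at h
  exact h

/-- The subgroup `{±I}` of `Γ₂(𝒪_K)`. -/
def pmOne (m : ℕ) : Subgroup (Gam m) where
  carrier := {M | cmat M = 1 ∨ cmat M = -1}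
  one_mem' := Or.inl (cmat_one m)
  mul_mem' := by
    rintro M M' (h | h) (h' | h') <;> simp [cmat_mul, h, h']
  inv_mem' := by
    intro M hM
    have h3 : cmat M * cmat M⁻¹ = 1 := by rw [← cmat_mul, mul_inv_cancel, cmat_one]
    rcases hM with h | h
    · left; simpa [h] using h3
    · right; rw [h, Matrix.neg_mul, Matrix.one_mul] at h3; rw [← h3, neg_neg]

theorem cmat_injective (m : ℕ) : Function.Injective (cmat (m := m)) := by
  intro M M' h
  apply Subtype.ext
  apply Subtype.ext
  ext i j
  have := congrFun (congrFun h i) j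
  simpa [cmat, toC] using this

instance pmOne_normal (m : ℕ) : (pmOne m).Normal where
  conj_mem := by
    intro M hM g
    have h3 : cmat g * cmat g⁻¹ = 1 := by rw [← cmat_mul, mul_inv_cancel, cmat_one]
    rcases hM with h | h
    · left; simp [cmat_mul, h, h3]
    · right; simp [cmat_mul, h, h3]

/-! ## The map `M ↦ M̃` -/

/-- The adjoint `(α, β; γ, δ)♯ = (δ, -β; -γ, α)`. -/
def sharp (X : Matrix (Fin 2) (Fin 2) ℂ) : Matrix (Fin 2) (Fin 2) ℂ :=
  !![X 1 1, -X 0 1; -X 1 0, X 0 0]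

/-- The basis of the real vector space of Hermitian `2 × 2` matrices. -/
def hermBasis (m : ℕ) : Fin 4 → Matrix (Fin 2) (Fin 2) ℂ :=
  ![!![1, 0; 0, 0], !![0, 1; 1, 0], !![0, omega m; conj (omega m), 0], !![0, 0; 0, 1]]

/-- The coordinate map `φ` on Hermitian matrices:
`(α, β + γ ω_K; β + γ ω̄_K, δ) ↦ (α, β, γ, δ)` (see `phi_eq`). -/
def phi (m : ℕ) (H : Matrix (Fin 2) (Fin 2) ℂ) : Fin 4 → ℝ :=
  ![(H 0 0).re, (H 0 1).re - (H 0 1).im / (omega m).im * (omega m).re,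
    (H 0 1).im / (omega m).im, (H 1 1).re]

theorem omega_im_ne_zero {m : ℕ} (hm : m ≠ 0) : (omega m).im ≠ 0 := by
  have hs : Real.sqrt m ≠ 0 := by
    rw [Real.sqrt_ne_zero']; exact_mod_cast Nat.pos_of_ne_zero hm
  unfold omega
  split_ifs
  · simp [sqrtNeg_im, hs]
  · simp [sqrtNeg_im, hs]

/-- `φ` gives the coordinates with respect to the basis. -/
theorem phi_eq {m : ℕ} (hm : m ≠ 0) (v : Fin 4 → ℝ) :
    phi m (∑ i, (v i : ℂ) • hermBasis m i) = v := by
  have h := omega_im_ne_zero hm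
  ext i
  fin_cases i <;> simp [phi, hermBasis, Fin.sum_univ_four, h]

theorem sum_phi {m : ℕ} (hm : m ≠ 0) {H : Matrix (Fin 2) (Fin 2) ℂ} (hH : H.IsHermitian) :
    ∑ i, (phi m H i : ℂ) • hermBasis m i = H := by
  have h := omega_im_ne_zero hm
  have h00 : conj (H 0 0) = H 0 0 := hH.apply 0 0
  have h11 : conj (H 1 1) = H 1 1 := hH.apply 1 1
  have h10 : conj (H 0 1) = H 1 0 := hH.apply 1 0
  rw [Complex.conj_eq_iff_re] at h00 h11
  ext i j
  fin_cases i <;> fin_cases j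
  · simp [phi, hermBasis, Fin.sum_univ_four, h00]
  · apply Complex.ext <;> simp [phi, hermBasis, Fin.sum_univ_four, h]
  · change _ = H 1 0
    rw [← h10]
    apply Complex.ext <;> simp [phi, hermBasis, Fin.sum_univ_four, h]
  · simp [phi, hermBasis, Fin.sum_univ_four, h11]

section Tilde

variable {m : ℕ} (M : Gam m)

/-- The endomorphism `f_M(Z) = A Z D♯ + B Z♯ C♯`. -/
def fM (Z : Matrix (Fin 2) (Fin 2) ℂ) : Matrix (Fin 2) (Fin 2) ℂ :=
  blkA M * Z * sharp (blkD M) + blkB M * sharp Z * sharp (blkC M)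

/-- The vector `a = -φ(A♯ B)`. -/
def veca : Fin 4 → ℝ := -phi m (sharp (blkA M) * blkB M)
/-- The vector `b = -φ(A C♯)`. -/
def vecb : Fin 4 → ℝ := -phi m (blkA M * sharp (blkC M))
/-- The vector `c = φ(B D♯)`. -/
def vecc : Fin 4 → ℝ := phi m (blkB M * sharp (blkD M))
/-- The vector `d = φ(C♯ D)`. -/
def vecd : Fin 4 → ℝ := phi m (sharp (blkC M) * blkD M)

/-- The matrix representing `f_M` with respect to the basis of Hermitian matrices. -/
def matK : Matrix (Fin 4) (Fin 4) ℝ := Matrix.of fun i j => phi m (fM M (hermBasis m j)) i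

/-- `M̃ = (α, aᵗ S₀, β; b, K, c; γ, dᵗ S₀, δ)` with `α = det A`, `β = -det B`, `γ = -det C`,
`δ = det D`. -/
def tilde : Matrix (Fin 6) (Fin 6) ℝ :=
  let S : Matrix (Fin 4) (Fin 4) ℝ := (S₀ m).map (Int.cast : ℤ → ℝ)
  let a : Fin 4 → ℝ := veca M ᵥ* S
  let d : Fin 4 → ℝ := vecd M ᵥ* S
  let b := vecb M
  let c := vecc M
  let k := matK M
  !![(blkA M).det.re, a 0, a 1, a 2, a 3, -(blkB M).det.re;
     b 0, k 0 0, k 0 1, k 0 2, k 0 3, c 0;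
     b 1, k 1 0, k 1 1, k 1 2, k 1 3, c 1;
     b 2, k 2 0, k 2 1, k 2 2, k 2 3, c 2;
     b 3, k 3 0, k 3 1, k 3 2, k 3 3, c 3;
     -(blkC M).det.re, d 0, d 1, d 2, d 3, (blkD M).det.re]

/-- The data entering `M̃` make sense: the four determinants are real, the arguments of `φ` are
Hermitian, and `f_M` maps Hermitian matrices to Hermitian matrices. -/
def TildeWellDefined : Prop :=
  (blkA M).det.im = 0 ∧ (blkB M).det.im = 0 ∧ (blkC M).det.im = 0 ∧ (blkD M).det.im = 0 ∧
  (sharp (blkA M) * blkB M).IsHermitian ∧ (blkA M * sharp (blkC M)).IsHermitian ∧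
  (blkB M * sharp (blkD M)).IsHermitian ∧ (sharp (blkC M) * blkD M).IsHermitian ∧
  ∀ Z : Matrix (Fin 2) (Fin 2) ℂ, Z.IsHermitian → (fM M Z).IsHermitian

end Tilde

/-! ## Congruence subgroups -/

/-- `x ≡ y mod N𝒪_K`. -/
def CongMod (m N : ℕ) (x y : ℂ) : Prop := ∃ z : 𝓞 (K m), x - y = N * toC m z

theorem CongMod.refl {m N : ℕ} (x : ℂ) : CongMod m N x x := ⟨0, by simp⟩

theorem CongMod.add {m N : ℕ} {x y x' y' : ℂ} (h : CongMod m N x y) (h' : CongMod m N x' y') :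
    CongMod m N (x + x') (y + y') := by
  obtain ⟨z, hz⟩ := h
  obtain ⟨z', hz'⟩ := h'
  exact ⟨z + z', by rw [map_add]; linear_combination hz + hz'⟩

theorem CongMod.neg {m N : ℕ} {x y : ℂ} (h : CongMod m N x y) : CongMod m N (-x) (-y) := by
  obtain ⟨z, hz⟩ := h
  exact ⟨-z, by rw [map_neg]; linear_combination -hz⟩

theorem CongMod.trans {m N : ℕ} {x y w : ℂ} (h : CongMod m N x y) (h' : CongMod m N y w) :
    CongMod m N x w := by
  obtain ⟨z, hz⟩ := h
  obtain ⟨z', hz'⟩ := h'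
  exact ⟨z + z', by rw [map_add]; linear_combination hz + hz'⟩

theorem CongMod.mul {m N : ℕ} {x y x' y' : ℂ} (hx : x ∈ (toC m).range) (hy' : y' ∈ (toC m).range)
    (h : CongMod m N x y) (h' : CongMod m N x' y') : CongMod m N (x * x') (y * y') := by
  obtain ⟨z, hz⟩ := h
  obtain ⟨z', hz'⟩ := h'
  obtain ⟨u, rfl⟩ := hx
  obtain ⟨v, rfl⟩ := hy'
  exact ⟨u * z' + z * v, by
    simp only [map_add, map_mul]; linear_combination toC m u * hz' + toC m v * hz⟩

theorem CongMod.mul_left {m N : ℕ} {x y : ℂ} (hx : x ∈ (toC m).range)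
    (h : CongMod m N y 0) : CongMod m N (x * y) 0 := by
  have := CongMod.mul hx (zero_mem _) (CongMod.refl x) h
  simpa using this

theorem CongMod.mul_right {m N : ℕ} {x y : ℂ} (hx : x ∈ (toC m).range)
    (h : CongMod m N y 0) : CongMod m N (y * x) 0 := by
  rw [mul_comm]; exact h.mul_left hx

theorem CongMod.mul_zero {m N n : ℕ} {x y : ℂ} (h : CongMod m N x 0) (h' : CongMod m n y 0) :
    CongMod m (N * n) (x * y) 0 := by
  obtain ⟨z, hz⟩ := h
  obtain ⟨z', hz'⟩ := h'
  refine ⟨z * z', ?_⟩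
  rw [sub_zero] at *
  rw [hz, hz', map_mul]; push_cast; ring

theorem CongMod.of_dvd {m N n : ℕ} (hn : n ∣ N) {x y : ℂ} (h : CongMod m N x y) :
    CongMod m n x y := by
  obtain ⟨k, rfl⟩ := hn
  obtain ⟨z, hz⟩ := h
  exact ⟨k * z, by rw [hz, map_mul, map_natCast]; push_cast; ring⟩

theorem conj_sqrtNeg (m : ℕ) : conj (sqrtNeg m) = -sqrtNeg m := by
  simp [sqrtNeg]

theorem conj_mem_K {m : ℕ} {x : ℂ} (hx : x ∈ K m) : conj x ∈ K m := by
  have h : K m ≤ (K m).comap (Complex.conjAe.toAlgHom.restrictScalars ℚ) := by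
    rw [IntermediateField.adjoin_le_iff, Set.singleton_subset_iff]
    change conj (sqrtNeg m) ∈ K m
    rw [conj_sqrtNeg]
    exact neg_mem (IntermediateField.mem_adjoin_simple_self ℚ _)
  exact h hx

theorem mem_range_toC {m : ℕ} {x : ℂ} : x ∈ (toC m).range ↔ x ∈ K m ∧ IsIntegral ℤ x := by
  constructor
  · rintro ⟨z, rfl⟩
    refine ⟨(z : K m).2, ?_⟩
    exact (RingOfIntegers.isIntegral_coe z).map ((K m).val.restrictScalars ℤ)
  · rintro ⟨h1, h2⟩
    have h3 : IsIntegral ℤ (⟨x, h1⟩ : K m) :=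
      (isIntegral_algHom_iff ((K m).val.restrictScalars ℤ) (K m).val.injective).1 h2
    exact ⟨⟨⟨x, h1⟩, h3⟩, rfl⟩

theorem conj_mem_range {m : ℕ} {x : ℂ} (hx : x ∈ (toC m).range) : conj x ∈ (toC m).range := by
  rw [mem_range_toC] at *
  exact ⟨conj_mem_K hx.1, hx.2.map (Complex.conjAe.toAlgHom.restrictScalars ℤ)⟩

theorem CongMod.conj {m N : ℕ} {x y : ℂ} (h : CongMod m N x y) :
    CongMod m N (conj x) (conj y) := by
  obtain ⟨z, hz⟩ := h
  obtain ⟨w, hw⟩ := conj_mem_range (m := m) ⟨z, rfl⟩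
  exact ⟨w, by rw [← map_sub, hz, map_mul, hw, Complex.conj_natCast]⟩

theorem CongMod.conj_zero {m N : ℕ} {x : ℂ} (h : CongMod m N x 0) :
    CongMod m N ((starRingEnd ℂ) x) 0 := by
  simpa using h.conj

theorem cmat_mem {m : ℕ} (M : Gam m) (i j) : cmat M i j ∈ (toC m).range := ⟨M.1.1 i j, rfl⟩

theorem blk_mem {m : ℕ} (M : Gam m) (i j) :
    blkA M i j ∈ (toC m).range ∧ blkB M i j ∈ (toC m).range ∧ blkC M i j ∈ (toC m).range ∧
    blkD M i j ∈ (toC m).range :=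
  ⟨cmat_mem M _ _, cmat_mem M _ _, cmat_mem M _ _, cmat_mem M _ _⟩

/-- The principal congruence subgroup of level `N𝒪_K`:
`{M ∈ Γ₂(𝒪_K) : M ≡ ε I mod N, ε ∈ ℤ, ε² ≡ 1 mod N}`. -/
def principalSubgroup (m N : ℕ) : Subgroup (Gam m) where
  carrier := {M | ∃ ε : ℤ, ε ^ 2 ≡ 1 [ZMOD N] ∧
    ∀ i j, CongMod m N (cmat M i j) (if i = j then (ε : ℂ) else 0)}
  one_mem' := ⟨1, by simp, fun i j => by
    rw [cmat_one, Matrix.one_apply]; simpa using CongMod.refl _⟩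
  mul_mem' := by
    rintro M M' ⟨ε, hε, h⟩ ⟨ε', hε', h'⟩
    refine ⟨ε * ε', by rw [mul_pow]; exact (hε.mul hε').trans (by simp), fun i j => ?_⟩
    have hr : ∀ e : ℤ, (e : ℂ) ∈ (toC m).range := fun e => ⟨e, by simp⟩
    have key : ∀ k, CongMod m N (cmat M i k * cmat M' k j)
        ((if i = k then (ε : ℂ) else 0) * (if k = j then (ε' : ℂ) else 0)) := fun k =>
      CongMod.mul (cmat_mem M i k) (by split_ifs; exacts [hr _, zero_mem _]) (h i k) (h' k j)
    have hsum : ∀ (s : Finset (Fin 2 ⊕ Fin 2)),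
        CongMod m N (∑ k ∈ s, cmat M i k * cmat M' k j)
        (∑ k ∈ s, (if i = k then (ε : ℂ) else 0) * (if k = j then (ε' : ℂ) else 0)) := by
      intro s
      induction s using Finset.induction_on with
      | empty => simpa using CongMod.refl _
      | insert a s ha ih => rw [Finset.sum_insert ha, Finset.sum_insert ha]; exact (key a).add ih
    have := hsum Finset.univ
    rw [cmat_mul, Matrix.mul_apply]
    convert this using 1
    by_cases hij : i = j <;> simp [hij]
  inv_mem' := by
    rintro M ⟨ε, hε, h⟩
    refine ⟨ε, hε, fun i j => ?_⟩
    have hA : ∀ i j, CongMod m N (blkA M i j) (if i = j then (ε : ℂ) else 0) := fun i j => by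
      simpa using! h (Sum.inl i) (Sum.inl j)
    have hB : ∀ i j, CongMod m N (blkB M i j) 0 := fun i j => by
      simpa using! h (Sum.inl i) (Sum.inr j)
    have hC : ∀ i j, CongMod m N (blkC M i j) 0 := fun i j => by
      simpa using! h (Sum.inr i) (Sum.inl j)
    have hD : ∀ i j, CongMod m N (blkD M i j) (if i = j then (ε : ℂ) else 0) := fun i j => by
      simpa using! h (Sum.inr i) (Sum.inr j)
    have hc : ∀ i j : Fin 2, conj (if j = i then (ε : ℂ) else 0) = if i = j then (ε : ℂ) else 0 := by
      intro i j
      by_cases hij : i = j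
      · simp [hij]
      · simp [hij, Ne.symm hij]
    rw [cmat_inv]
    rcases i with i | i <;> rcases j with j | j
    · simpa [hc] using (hD j i).conj
    · simpa using (hB j i).conj.neg
    · simpa using (hC j i).conj.neg
    · simpa [hc] using (hA j i).conj

/-- The conditions defining the congruence subgroup attached to `n ∣ N`. -/
def mixedCond {m : ℕ} (n N : ℕ) (M : Gam m) : Prop :=
  (∃ ε : 𝓞 (K m), CongMod m n (toC m ε * conj (toC m ε)) 1 ∧
    CongMod m n (blkA M 0 0) (toC m ε) ∧ CongMod m n (blkD M 0 0) (toC m ε) ∧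
    CongMod m n (conj (blkA M 1 1)) (toC m ε) ∧ CongMod m n (conj (blkD M 1 1)) (toC m ε)) ∧
  CongMod m N (blkA M).det 1 ∧ CongMod m N (blkD M).det 1 ∧
  CongMod m n (blkA M 1 0) 0 ∧ CongMod m n (blkB M 1 1) 0 ∧ CongMod m n (blkD M 0 1) 0 ∧
  CongMod m (N * n) (blkC M 0 0) 0 ∧ CongMod m N (blkC M 0 1) 0 ∧
  CongMod m N (blkC M 1 0) 0 ∧ CongMod m N (blkC M 1 1) 0

theorem mixedCond_one (m n N : ℕ) : mixedCond n N (1 : Gam m) := by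
  obtain ⟨hA, hB, hC, hD⟩ := blk_one m
  refine ⟨⟨1, ?_⟩, ?_⟩ <;> simp [hA, hB, hC, hD, CongMod.refl]

theorem mixedCond_inv {m n N : ℕ} {M : Gam m} (h : mixedCond n N M) : mixedCond n N M⁻¹ := by
  obtain ⟨hA, hB, hC, hD⟩ := blk_inv M
  obtain ⟨⟨ε, h0, h1, h2, h3, h4⟩, hdA, hdD, ha, hb, hd, hc1, hc2, hc3, hc4⟩ := h
  obtain ⟨ε', hε'⟩ := conj_mem_range (m := m) ⟨ε, rfl⟩
  refine ⟨⟨ε', ?_, ?_, ?_, ?_, ?_⟩, ?_, ?_, ?_, ?_, ?_, ?_, ?_, ?_, ?_⟩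
  · rw [hε', Complex.conj_conj, mul_comm]; exact h0
  · rw [hA, hε']; exact h2.conj
  · rw [hD, hε']; exact h1.conj
  · rw [hA, hε']; exact h4.conj
  · rw [hD, hε']; exact h3.conj
  · rw [hA, det_conjTranspose]; simpa using! hdD.conj
  · rw [hD, det_conjTranspose]; simpa using! hdA.conj
  · rw [hA]; exact hd.conj_zero
  · rw [hB]; simpa using hb.conj.neg
  · rw [hD]; exact ha.conj_zero
  · rw [hC]; simpa using hc1.conj.neg
  · rw [hC]; simpa using hc3.conj.neg
  · rw [hC]; simpa using hc2.conj.neg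
  · rw [hC]; simpa using hc4.conj.neg

theorem det_mem {m : ℕ} {X : Matrix (Fin 2) (Fin 2) ℂ} (hX : ∀ i j, X i j ∈ (toC m).range) :
    X.det ∈ (toC m).range := by
  rw [Matrix.det_fin_two]
  exact sub_mem (mul_mem (hX _ _) (hX _ _)) (mul_mem (hX _ _) (hX _ _))

theorem det_cong {m N : ℕ} {X Y : Matrix (Fin 2) (Fin 2) ℂ} (hX : ∀ i j, X i j ∈ (toC m).range)
    (hY : ∀ i j, Y i j ∈ (toC m).range) (h : ∀ i j, CongMod m N (X i j) (Y i j)) :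
    CongMod m N X.det Y.det := by
  rw [Matrix.det_fin_two, Matrix.det_fin_two, sub_eq_add_neg, sub_eq_add_neg]
  exact (CongMod.mul (hX _ _) (hY _ _) (h _ _) (h _ _)).add
    (CongMod.mul (hX _ _) (hY _ _) (h _ _) (h _ _)).neg

theorem mixedCond_mul {m n N : ℕ} (hn : n ∣ N) {M M' : Gam m} (h : mixedCond n N M)
    (h' : mixedCond n N M') : mixedCond n N (M * M') := by
  obtain ⟨eA, eB, eC, eD⟩ := blk_mul M M'
  obtain ⟨⟨ε, h0, h1, h2, h3, h4⟩, hdA, hdD, ha, hb, hd, hc1, hc2, hc3, hc4⟩ := h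
  obtain ⟨⟨ε', h0', h1', h2', h3', h4'⟩, hdA', hdD', ha', hb', hd', hc1', hc2', hc3', hc4'⟩ := h'
  have mA := fun i j => (blk_mem M i j).1
  have mB := fun i j => (blk_mem M i j).2.1
  have mC := fun i j => (blk_mem M i j).2.2.1
  have mD := fun i j => (blk_mem M i j).2.2.2
  have mA' := fun i j => (blk_mem M' i j).1
  have mB' := fun i j => (blk_mem M' i j).2.1
  have mC' := fun i j => (blk_mem M' i j).2.2.1
  have mD' := fun i j => (blk_mem M' i j).2.2.2
  have hC : ∀ i j, CongMod m N (blkC M i j) 0 := by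
    intro i j
    fin_cases i <;> fin_cases j
    exacts [hc1.of_dvd (dvd_mul_right _ _), hc2, hc3, hc4]
  have hC' : ∀ i j, CongMod m N (blkC M' i j) 0 := by
    intro i j
    fin_cases i <;> fin_cases j
    exacts [hc1'.of_dvd (dvd_mul_right _ _), hc2', hc3', hc4']
  have hCn := fun i j => (hC i j).of_dvd hn
  have hCn' := fun i j => (hC' i j).of_dvd hn
  have mε : toC m ε ∈ (toC m).range := ⟨ε, rfl⟩
  have mε' : toC m ε' ∈ (toC m).range := ⟨ε', rfl⟩
  have add0 : ∀ {k : ℕ} {x y : ℂ}, CongMod m k x 0 → CongMod m k y 0 → CongMod m k (x + y) 0 :=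
    fun h h' => by simpa using h.add h'
  have addr : ∀ {k : ℕ} {x y w : ℂ}, CongMod m k x w → CongMod m k y 0 → CongMod m k (x + y) w :=
    fun h h' => by simpa using h.add h'
  have addl : ∀ {k : ℕ} {x y w : ℂ}, CongMod m k x 0 → CongMod m k y w → CongMod m k (x + y) w :=
    fun h h' => by simpa using h.add h'
  have exp2 : ∀ (X Y : Matrix (Fin 2) (Fin 2) ℂ) (i j : Fin 2),
      (X * Y) i j = X i 0 * Y 0 j + X i 1 * Y 1 j := fun X Y i j => by
    rw [Matrix.mul_apply, Fin.sum_univ_two]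
  refine ⟨⟨ε * ε', ?_, ?_, ?_, ?_, ?_⟩, ?_, ?_, ?_, ?_, ?_, ?_, ?_, ?_, ?_⟩
  · have := CongMod.mul (mul_mem mε (conj_mem_range mε)) (one_mem _) h0 h0'
    simp only [map_mul]
    convert this using 1 <;> ring
  · rw [eA, Matrix.add_apply, exp2, exp2, map_mul]
    exact addr (addr (CongMod.mul (mA _ _) mε' h1 h1') ((ha').mul_left (mA _ _)))
      (add0 ((hCn' _ _).mul_left (mB _ _)) ((hCn' _ _).mul_left (mB _ _)))
  · rw [eD, Matrix.add_apply, exp2, exp2, map_mul]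
    exact addl (add0 ((hCn _ _).mul_right (mB' _ _)) ((hCn _ _).mul_right (mB' _ _)))
      (addr (CongMod.mul (mD _ _) mε' h2 h2') (hd.mul_right (mD' _ _)))
  · rw [eA, Matrix.add_apply, exp2, exp2]
    have k := CongMod.mul (conj_mem_range (mA 1 1)) mε' h3 h3'
    rw [← map_mul, ← map_mul] at k
    refine CongMod.trans (CongMod.conj ?_) k
    exact addr (addl (ha.mul_right (mA' _ _)) (CongMod.refl _))
      (add0 ((hCn' _ _).mul_left (mB _ _)) ((hCn' _ _).mul_left (mB _ _)))
  · rw [eD, Matrix.add_apply, exp2, exp2]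
    have k := CongMod.mul (conj_mem_range (mD 1 1)) mε' h4 h4'
    rw [← map_mul, ← map_mul] at k
    refine CongMod.trans (CongMod.conj ?_) k
    exact addl (add0 ((hCn _ _).mul_right (mB' _ _)) ((hCn _ _).mul_right (mB' _ _)))
      (addl (hd'.mul_left (mD _ _)) (CongMod.refl _))
  · have k := CongMod.mul (N := N) (det_mem mA) (one_mem _) hdA hdA'
    rw [← Matrix.det_mul, mul_one] at k
    refine CongMod.trans (det_cong (fun i j => (blk_mem (M * M') i j).1) ?_ fun i j => ?_) k
    · intro i j
      rw [exp2]
      exact add_mem (mul_mem (mA _ _) (mA' _ _)) (mul_mem (mA _ _) (mA' _ _))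
    · rw [eA, Matrix.add_apply, exp2 (blkB M)]
      exact addr (CongMod.refl _)
        (add0 ((hC' _ _).mul_left (mB _ _)) ((hC' _ _).mul_left (mB _ _)))
  · have k := CongMod.mul (N := N) (det_mem mD) (one_mem _) hdD hdD'
    rw [← Matrix.det_mul, mul_one] at k
    refine CongMod.trans (det_cong (fun i j => (blk_mem (M * M') i j).2.2.2) ?_ fun i j => ?_) k
    · intro i j
      rw [exp2]
      exact add_mem (mul_mem (mD _ _) (mD' _ _)) (mul_mem (mD _ _) (mD' _ _))
    · rw [eD, Matrix.add_apply, exp2 (blkC M)]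
      exact addl (add0 ((hC _ _).mul_right (mB' _ _)) ((hC _ _).mul_right (mB' _ _)))
        (CongMod.refl _)
  · rw [eA, Matrix.add_apply, exp2, exp2]
    exact add0 (add0 (ha.mul_right (mA' _ _)) (ha'.mul_left (mA _ _)))
      (add0 ((hCn' _ _).mul_left (mB _ _)) ((hCn' _ _).mul_left (mB _ _)))
  · rw [eB, Matrix.add_apply, exp2, exp2]
    exact add0 (add0 (ha.mul_right (mB' _ _)) (hb'.mul_left (mA _ _)))
      (add0 (hd'.mul_left (mB _ _)) (hb.mul_right (mD' _ _)))
  · rw [eD, Matrix.add_apply, exp2, exp2]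
    exact add0 (add0 ((hCn _ _).mul_right (mB' _ _)) ((hCn _ _).mul_right (mB' _ _)))
      (add0 (hd'.mul_left (mD _ _)) (hd.mul_right (mD' _ _)))
  · rw [eC, Matrix.add_apply, exp2, exp2]
    exact add0 (add0 (hc1.mul_right (mA' _ _)) (CongMod.mul_zero hc2 ha'))
      (add0 (hc1'.mul_left (mD _ _)) (by rw [Nat.mul_comm]; exact CongMod.mul_zero hd hc3'))
  all_goals
    rw [eC, Matrix.add_apply, exp2, exp2]
    exact add0 (add0 ((hC _ _).mul_right (mA' _ _)) ((hC _ _).mul_right (mA' _ _)))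
      (add0 ((hC' _ _).mul_left (mD _ _)) ((hC' _ _).mul_left (mD _ _)))

/-- For `n ∣ N`, the congruence subgroup of all `M ∈ Γ₂(𝒪_K)` such that
`a₁₁ ≡ d₁₁ ≡ ā₂₂ ≡ d̄₂₂ ≡ ε mod n` for some `ε ∈ 𝒪_K` with `ε ε̄ ≡ 1 mod n`,
`det A ≡ det D ≡ 1 mod N`, `a₂₁ ≡ b₂₂ ≡ d₁₂ ≡ 0 mod n`, `c₁₁ ≡ 0 mod Nn`,
`c₁₂ ≡ c₂₁ ≡ c₂₂ ≡ 0 mod N`. -/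
def mixedSubgroup (m n N : ℕ) (hn : n ∣ N) : Subgroup (Gam m) where
  carrier := {M | mixedCond n N M}
  one_mem' := mixedCond_one m n N
  mul_mem' := mixedCond_mul hn
  inv_mem' := mixedCond_inv

/-! ## Comparison of the two sides -/

/-- The matrix `F = diag(1, 1, 1, 1, n, N)` as an element of `GL₆(ℚ)`. -/
def matF (n N : ℕ+) : GL (Fin 6) ℚ :=
  Matrix.GeneralLinearGroup.mkOfDetNeZero
    (Matrix.diagonal ![1, 1, 1, 1, ((n : ℕ) : ℚ), ((N : ℕ) : ℚ)])
    (by simp [Matrix.det_diagonal, Fin.prod_univ_succ])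

/-- The inclusion `SL₆(ℤ) → GL₆(ℚ)`. -/
def toGLQ : Matrix.SpecialLinearGroup (Fin 6) ℤ →* GL (Fin 6) ℚ :=
  Matrix.SpecialLinearGroup.mapGL ℚ

/-- The image in `Γ₂(𝒪_K)/{±I}` of a subgroup `H` of `Γ₂(𝒪_K)`. -/
def modPm {m : ℕ} (H : Subgroup (Gam m)) : Subgroup (Gam m ⧸ pmOne m) :=
  H.map (QuotientGroup.mk' (pmOne m))

/-- The group `F 𝒟(U(N) ⊕ U(n) ⊕ (-S_K); ℤ) F⁻¹`, as a subgroup of `GL₆(ℚ)`. -/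
def conjKernel (m : ℕ) (n N : ℕ+) : Subgroup (GL (Fin 6) ℚ) :=
  ((discriminantKernel (hypSum₄ (N : ℤ) (hypSum₂ (n : ℤ) (-SK m)))).map toGLQ).map
    (MulAut.conj (matF n N)).toMonoidHom

end

end HermMod

open HermMod

/-!
The proof realizes `M̃` as the exterior square of `M`. The space `⋀² ℂ⁴` carries the wedge product
pairing into `⋀⁴ ℂ⁴ = ℂ` and, for `SU(2,2)`, an invariant real structure (`conj_extSq`). On the
real points, which are `ℝ ⊕ Herm₂(ℂ) ⊕ ℝ`, the pairing becomes the quadratic form `S₁`, and `M̃`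
is the matrix of `⋀² M` in the basis coming from `1, ω` (`tilde_eq`). This makes `M ↦ M̃` a
homomorphism into the orthogonal group of `S₁`. It takes values in the identity component, because
`SU(2,2)` is connected (`inComp_of_isSU`, `ortho_mem_specialOrthogonal₀`).

Membership in a discriminant kernel is controlled by the *defect* `(M̃ - I) S₁⁻¹`, which has to be
integral. As `S₁⁻¹` amounts to passing to the dual lattice, that is, to the inverse different of
`𝒪_K`, integrality of the defect, and more generally divisibility of its entries, is equivalent to
explicit congruences between the entries of `⋀² M` (`defect_dvd_iff`). For `M ∈ Γ₂(𝒪_K)` they hold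
without modulus (`defectCong_one`), which yields the homomorphism `orthoHom` into `𝒟(S₁; ℤ)`. A
matrix with trivial exterior square is `± I` (`diagonal_of_minors`, `ker_orthoHom`).

For surjectivity, let `U ∈ 𝒟(S₁; ℤ)`. In the orbit of `U` under `Γ₂(𝒪_K)` choose an element for
which the last entry of the first column is nonzero and minimal in absolute value. Translations
then show that this entry divides everything the first column pairs to, so it is `± 1`
(`isUnit_of_minimal`; the same argument excludes that these entries all vanish), and `U` can be
reduced to an isometry that fixes the two isotropic basis vectors of the outer hyperbolic plane.
The remaining isometry acts on Hermitian matrices, preserving the determinant. Since it lies in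
the identity component, it preserves the positive cone (`det_posGram_pos`), and so it is
`Z ↦ A Z Aᴴ` with `A ∈ SL₂(ℂ)` (`exists_levi_of_fix_two`). Integrality on Hermitian matrices only gives
that the products `aᵢⱼ āₖₗ` are integral; this allows for matrices `√r⁻¹ B`, where `B` is integral
of determinant `r`. Such matrices act nontrivially on the discriminant group unless they are
integral themselves, so the discriminant kernel condition forces `A` to have entries in `𝒪_K`
(`mem_range_of_mul_conj_mem`).

The two families of congruence subgroups are read off from the same criterion. The kernel of
`N S₁` corresponds to a defect divisible by `N`, which means that `⋀² M ≡ I` modulo `N` together with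
one congruence modulo the different; the first says that `M` is scalar modulo `N`, the second that
the scalar is a rational integer (`mem_principalSubgroup_iff`). With `F = diag(1, 1, 1, 1, n, N)`,
one has `U(N) ⊕ U(n) ⊕ (-S_K) = F S₁ F`, so the kernel of this form, conjugated by `F`,
corresponds to a defect whose entry at `(i, j)` is divisible by `fᵢ fⱼ`; these congruences for
minors are equivalent to the stated ones for entries (`defectCong_of_mixedCond`,
`mixedCond_of_defectCong`).
-/

namespace HermMod

noncomputable section

/-! ### The ring of integers of `ℚ(√(-m))` -/

/-- The trace `ω + ω̄` of `ω_K`. -/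
def omegaTr (m : ℕ) : ℤ := if m % 4 = 3 then m else 2 * m

/-- The norm `ω ω̄` of `ω_K`; the division by `4` is exact. -/
def omegaNm (m : ℕ) : ℤ := if m % 4 = 3 then (m * (m + 1)) / 4 else m * (m + 1)

theorem sqrtNeg_mul_self (m : ℕ) : sqrtNeg m * sqrtNeg m = -m := by
  have hs : (Real.sqrt m : ℂ) * (Real.sqrt m : ℂ) = m := by
    exact_mod_cast congrArg Complex.ofReal (Real.mul_self_sqrt (Nat.cast_nonneg m))
  have : sqrtNeg m * sqrtNeg m = (Real.sqrt m : ℂ) * (Real.sqrt m : ℂ) *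
      (Complex.I * Complex.I) := by
    unfold sqrtNeg; ring
  rw [this, hs, Complex.I_mul_I]; ring

theorem four_dvd_mul_succ {m : ℕ} (h : m % 4 = 3) : (4 : ℤ) ∣ (m : ℤ) * (m + 1) :=
  Dvd.dvd.mul_left (by omega) _

theorem omega_add_conj (m : ℕ) : omega m + conj (omega m) = omegaTr m := by
  unfold omega omegaTr
  split_ifs
  · simp [conj_sqrtNeg, map_ofNat]; ring
  · simp [conj_sqrtNeg]; ring

theorem omega_mul_conj (m : ℕ) : omega m * conj (omega m) = omegaNm m := by
  have hs := sqrtNeg_mul_self m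
  unfold omega omegaNm
  split_ifs with h
  · have h3 : (((m * (m + 1) / 4 : ℤ)) : ℂ) = (m * (m + 1) : ℂ) / 4 := by
      rw [Int.cast_div (four_dvd_mul_succ h) (by norm_num)]; push_cast; ring
    rw [h3]
    simp [conj_sqrtNeg, map_ofNat]; linear_combination -hs / 4
  · simp [conj_sqrtNeg]; linear_combination -hs

theorem conj_omega (m : ℕ) : conj (omega m) = omegaTr m - omega m := by
  linear_combination omega_add_conj m

theorem omega_sq (m : ℕ) : omega m * omega m = omegaTr m * omega m - omegaNm m := by
  have h := omega_mul_conj m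
  rw [conj_omega] at h
  linear_combination -h

theorem SK_eq (m : ℕ) : SK m = !![2, omegaTr m; omegaTr m, 2 * omegaNm m] := by
  unfold SK omegaTr omegaNm
  split_ifs with h
  · obtain ⟨k, hk⟩ := four_dvd_mul_succ h
    rw [hk, show 4 * k / 2 = 2 * (4 * k / 4) by omega]
  · rfl

theorem exists_rat_of_mem_K {m : ℕ} {x : ℂ} (hx : x ∈ K m) :
    ∃ a b : ℚ, x = a + b * sqrtNeg m := by
  have hs := sqrtNeg_mul_self m
  have hint : IsIntegral ℚ (sqrtNeg m) := by
    refine ⟨Polynomial.X ^ 2 + Polynomial.C (m : ℚ), Polynomial.monic_X_pow_add_C _ two_ne_zero, ?_⟩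
    simp [pow_two, hs]
  rw [← IntermediateField.mem_toSubalgebra,
    IntermediateField.adjoin_simple_toSubalgebra_of_isAlgebraic hint.isAlgebraic] at hx
  induction hx using Algebra.adjoin_induction with
  | mem x h => exact ⟨0, 1, by simpa using h⟩
  | algebraMap r => exact ⟨r, 0, by simp⟩
  | add x y _ _ h1 h2 =>
    obtain ⟨a, b, rfl⟩ := h1
    obtain ⟨c, d, rfl⟩ := h2
    exact ⟨a + c, b + d, by push_cast; ring⟩
  | mul x y _ _ h1 h2 =>
    obtain ⟨a, b, rfl⟩ := h1
    obtain ⟨c, d, rfl⟩ := h2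
    exact ⟨a * c - m * b * d, a * d + b * c, by push_cast; linear_combination (b * d : ℂ) * hs⟩

theorem sqrtNeg_mem_K (m : ℕ) : sqrtNeg m ∈ K m := IntermediateField.mem_adjoin_simple_self ℚ _

theorem exists_int_of_isIntegral {q : ℚ} (h : IsIntegral ℤ (q : ℂ)) : ∃ n : ℤ, q = n := by
  have h2 : IsIntegral ℤ q :=
    (isIntegral_algHom_iff ((Algebra.ofId ℚ ℂ).restrictScalars ℤ) (Algebra.ofId ℚ ℂ).injective).1
      (by simpa [Algebra.ofId_apply] using! h)
  obtain ⟨n, hn⟩ := IsIntegrallyClosed.isIntegral_iff.1 h2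
  exact ⟨n, by simpa using hn.symm⟩

theorem exists_int_of_squarefree_mul_sq {m : ℕ} (hm : Squarefree m) {q : ℚ} {n : ℤ}
    (h : m * q ^ 2 = n) : ∃ k : ℤ, q = k := by
  have hd : (q.den : ℚ) ≠ 0 := by exact_mod_cast q.den_ne_zero
  have h1 : (m : ℤ) * q.num ^ 2 = n * q.den ^ 2 := by
    have : (m : ℚ) * q.num ^ 2 = n * q.den ^ 2 := by
      rw [← h]
      nth_rewrite 2 [← Rat.num_div_den q]
      field_simp
    exact_mod_cast this
  have h2 : (q.den : ℤ) ^ 2 ∣ (m : ℤ) * q.num ^ 2 := ⟨n, by rw [h1]; ring⟩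
  have h3 : IsCoprime ((q.den : ℤ) ^ 2) (q.num ^ 2) := by
    apply IsCoprime.pow
    rw [Int.isCoprime_iff_nat_coprime]
    exact (by simpa using q.reduced.symm)
  have h4 : q.den * q.den ∣ m := by
    have := h3.dvd_of_dvd_mul_right h2
    rw [pow_two] at this
    exact_mod_cast this
  have h5 : q.den = 1 := by simpa using hm _ h4
  exact ⟨q.num, (Rat.den_eq_one_iff q).1 h5 |>.symm⟩

theorem not_four_dvd {m : ℕ} (hm : Squarefree m) : m % 4 ≠ 0 := fun h => by
  have := hm 2 (by omega)
  simp at this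

theorem omega_isIntegral (m : ℕ) : IsIntegral ℤ (omega m) := by
  refine ⟨Polynomial.X ^ 2 + (-Polynomial.C (omegaTr m) * Polynomial.X + Polynomial.C (omegaNm m)),
    ?_, ?_⟩
  · apply Polynomial.monic_X_pow_add
    compute_degree!
  · have h1 (k : ℤ) : Polynomial.eval₂ (Int.castRingHom ℂ) (omega m) (k : Polynomial ℤ) = k :=
      map_intCast (Polynomial.eval₂RingHom (Int.castRingHom ℂ) (omega m)) k
    simp [h1]
    linear_combination omega_sq m

theorem omega_mem_range (m : ℕ) : omega m ∈ (toC m).range := by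
  rw [mem_range_toC]
  refine ⟨?_, omega_isIntegral m⟩
  unfold omega
  have h : (m : ℂ) + sqrtNeg m ∈ K m :=
    add_mem (by simp) (sqrtNeg_mem_K m)
  split_ifs
  · exact div_mem h (by simp)
  · exact h

theorem int_mem_range (m : ℕ) (a : ℤ) : (a : ℂ) ∈ (toC m).range := ⟨a, by simp⟩

/-- The ring of integers is `ℤ + ℤ ω_K`. -/
theorem mem_range_iff {m : ℕ} (hm : Squarefree m) {x : ℂ} :
    x ∈ (toC m).range ↔ ∃ a b : ℤ, x = a + b * omega m := by
  constructor
  · intro hx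
    obtain ⟨h1, h2⟩ := mem_range_toC.1 hx
    obtain ⟨a, b, rfl⟩ := exists_rat_of_mem_K h1
    have h3 := (mem_range_toC.1 (conj_mem_range hx)).2
    have hc : conj ((a : ℂ) + b * sqrtNeg m) = a - b * sqrtNeg m := by
      simp [conj_sqrtNeg]; ring
    rw [hc] at h3
    have hs := sqrtNeg_mul_self m
    have htr : IsIntegral ℤ ((2 * a : ℚ) : ℂ) := by
      have e : ((2 * a : ℚ) : ℂ) = (a + b * sqrtNeg m) + (a - b * sqrtNeg m) := by
        push_cast; ring
      rw [e]; exact h2.add h3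
    have hnm : IsIntegral ℤ ((a ^ 2 + m * b ^ 2 : ℚ) : ℂ) := by
      have e : ((a ^ 2 + m * b ^ 2 : ℚ) : ℂ) = (a + b * sqrtNeg m) * (a - b * sqrtNeg m) := by
        push_cast; linear_combination (b : ℂ) ^ 2 * hs
      rw [e]; exact h2.mul h3
    obtain ⟨A, hA⟩ := exists_int_of_isIntegral htr
    obtain ⟨N, hN⟩ := exists_int_of_isIntegral hnm
    obtain ⟨B, hB⟩ : ∃ B : ℤ, 2 * b = B :=
      exists_int_of_squarefree_mul_sq hm (n := 4 * N - A ^ 2) (by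
        push_cast; rw [← hN, ← hA]; ring)
    have hAB : A ^ 2 + m * B ^ 2 = 4 * N := by
      have : (A : ℚ) ^ 2 + m * B ^ 2 = 4 * N := by rw [← hN, ← hA, ← hB]; ring
      exact_mod_cast this
    have ha : (a : ℂ) = A / 2 := by
      rw [eq_div_iff two_ne_zero, mul_comm]; exact_mod_cast hA
    have hb : (b : ℂ) = B / 2 := by
      rw [eq_div_iff two_ne_zero, mul_comm]; exact_mod_cast hB
    have h4 := not_four_dvd hm
    have hm' : ((m : ℤ) % 4 = 3 ∧ m % 4 = 3) ∨ ((m : ℤ) % 4 = 1 ∧ m % 4 ≠ 3) ∨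
        ((m : ℤ) % 4 = 2 ∧ m % 4 ≠ 3) := by omega
    have hmod : (A ^ 2 + m * B ^ 2) % 4 = 0 := by omega
    have hA4 : A % 4 = 0 ∨ A % 4 = 1 ∨ A % 4 = 2 ∨ A % 4 = 3 := by omega
    have hB4 : B % 4 = 0 ∨ B % 4 = 1 ∨ B % 4 = 2 ∨ B % 4 = 3 := by omega
    rcases hm' with ⟨h5, h6⟩ | h5
    · have h7 : (2 : ℤ) ∣ A - m * B := by
        have : ((A - m * B) % 2) = 0 := by
          have hm2 : (m : ℤ) % 2 = 1 := by omega
          rcases hA4 with h | h | h | h <;> rcases hB4 with h' | h' | h' | h' <;>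
            simp [pow_two, Int.add_emod, Int.mul_emod, h, h', h5] at hmod <;>
            (have : A % 2 = B % 2 := by omega) <;>
            simp [Int.sub_emod, Int.mul_emod, hm2, this]
        omega
      obtain ⟨k, hk⟩ := h7
      refine ⟨k, B, ?_⟩
      have hk' : (A : ℂ) - m * B = 2 * k := by exact_mod_cast hk
      rw [omega, if_pos h6, ha, hb]
      linear_combination hk' / 2
    · have h6 : m % 4 ≠ 3 := by omega
      have h7 : (2 : ℤ) ∣ A ∧ (2 : ℤ) ∣ B := by
        rcases h5 with ⟨h5, -⟩ | ⟨h5, -⟩ <;>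
        rcases hA4 with h | h | h | h <;> rcases hB4 with h' | h' | h' | h' <;>
            simp [pow_two, Int.add_emod, Int.mul_emod, h, h', h5] at hmod <;>
            omega
      obtain ⟨⟨k, hk⟩, l, hl⟩ := h7
      refine ⟨k - m * l, l, ?_⟩
      rw [omega, if_neg h6, ha, hb, hk, hl]
      push_cast; ring
  · rintro ⟨a, b, rfl⟩
    exact add_mem (int_mem_range m a) (mul_mem (int_mem_range m b) (omega_mem_range m))

/-! ### The exterior square of a `4 × 4` matrix -/

/-- The `2 × 2` minor of `X` with rows `i, i'` and columns `j, j'`. -/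
def minor (X : Matrix (Fin 2 ⊕ Fin 2) (Fin 2 ⊕ Fin 2) ℂ) (i i' j j' : Fin 2 ⊕ Fin 2) : ℂ :=
  X i j * X i' j' - X i j' * X i' j

/-- The first index of the six pairs labelling the basis of `⋀² ℂ⁴`. -/
def fstIdx : Fin 6 → Fin 2 ⊕ Fin 2 := ![.inl 1, .inl 0, .inr 0, .inl 1, .inr 0, .inr 0]

/-- The second index of the six pairs labelling the basis of `⋀² ℂ⁴`. -/
def sndIdx : Fin 6 → Fin 2 ⊕ Fin 2 := ![.inl 0, .inr 1, .inl 0, .inr 1, .inl 1, .inr 1]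

/-- The exterior square of `X`. The order of the pairs, and the order inside each pair, are chosen
such that the Plücker coordinates of the columns of `(P; Q)` are
`(-det P, P Q♯, det Q)`, the four entries of `P Q♯` being listed as `11, 12, 21, 22`. -/
def extSq (X : Matrix (Fin 2 ⊕ Fin 2) (Fin 2 ⊕ Fin 2) ℂ) : Matrix (Fin 6) (Fin 6) ℂ :=
  of fun I J => minor X (fstIdx I) (sndIdx I) (fstIdx J) (sndIdx J)

theorem extSq_mul (X Y : Matrix (Fin 2 ⊕ Fin 2) (Fin 2 ⊕ Fin 2) ℂ) :
    extSq (X * Y) = extSq X * extSq Y := by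
  have h (i i' j j') : minor (X * Y) i i' j j' =
      ∑ K, minor X i i' (fstIdx K) (sndIdx K) * minor Y (fstIdx K) (sndIdx K) j j' := by
    simp only [minor, Matrix.mul_apply, Fintype.sum_sum_type, Fin.sum_univ_two, Fin.sum_univ_six,
      fstIdx, sndIdx]
    simp
    ring
  ext I J
  exact h _ _ _ _

theorem extSq_one : extSq 1 = 1 := by
  ext I J
  fin_cases I <;> fin_cases J <;> simp [extSq, minor, fstIdx, sndIdx, Matrix.one_apply]

theorem extSq_neg (X : Matrix (Fin 2 ⊕ Fin 2) (Fin 2 ⊕ Fin 2) ℂ) : extSq (-X) = extSq X := by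
  ext I J
  simp [extSq, minor]

theorem extSq_conjTranspose (X : Matrix (Fin 2 ⊕ Fin 2) (Fin 2 ⊕ Fin 2) ℂ) :
    extSq Xᴴ = (extSq X)ᴴ := by
  ext I J
  simp [extSq, minor]
  ring

theorem det_four (X : Matrix (Fin 2 ⊕ Fin 2) (Fin 2 ⊕ Fin 2) ℂ) :
    X.det = extSq X 0 0 * extSq X 5 5 + extSq X 1 0 * extSq X 4 5 - extSq X 2 0 * extSq X 3 5
      - extSq X 3 0 * extSq X 2 5 + extSq X 4 0 * extSq X 1 5 + extSq X 5 0 * extSq X 0 5 := by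
  have h : X.submatrix finSumFinEquiv.symm finSumFinEquiv.symm =
      !![X (.inl 0) (.inl 0), X (.inl 0) (.inl 1), X (.inl 0) (.inr 0), X (.inl 0) (.inr 1);
         X (.inl 1) (.inl 0), X (.inl 1) (.inl 1), X (.inl 1) (.inr 0), X (.inl 1) (.inr 1);
         X (.inr 0) (.inl 0), X (.inr 0) (.inl 1), X (.inr 0) (.inr 0), X (.inr 0) (.inr 1);
         X (.inr 1) (.inl 0), X (.inr 1) (.inl 1), X (.inr 1) (.inr 0), X (.inr 1) (.inr 1)] := by
    ext i j
    fin_cases i <;> fin_cases j <;> rfl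
  rw [← Matrix.det_submatrix_equiv_self finSumFinEquiv.symm, h]
  simp [Matrix.det_succ_row_zero, Fin.sum_univ_succ, extSq, minor, fstIdx, sndIdx, Fin.succAbove]
  ring

/-- The Gram matrix of the wedge product pairing on `⋀² ℂ⁴`, which is the polar form of
`(x, H, y) ↦ x y + det H`. -/
def wedgeForm : Matrix (Fin 6) (Fin 6) ℂ :=
  !![0, 0, 0, 0, 0, 1;
     0, 0, 0, 0, 1, 0;
     0, 0, 0, -1, 0, 0;
     0, 0, -1, 0, 0, 0;
     0, 1, 0, 0, 0, 0;
     1, 0, 0, 0, 0, 0]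

theorem extSq_wedgeForm (X : Matrix (Fin 2 ⊕ Fin 2) (Fin 2 ⊕ Fin 2) ℂ) :
    (extSq X)ᵀ * wedgeForm * extSq X = X.det • wedgeForm := by
  rw [det_four]
  ext I J
  simp only [Matrix.mul_apply, Fin.sum_univ_six, wedgeForm, Matrix.smul_apply,
    Matrix.transpose_apply, extSq, of_apply, minor, fstIdx, sndIdx]
  fin_cases I <;> fin_cases J <;> simp <;> ring

/-! ### The real structure preserved by `SU(2,2)` -/

/-- The transposition of the coordinates `H₁₂` and `H₂₁`. -/
def swapIdx : Fin 6 → Fin 6 := ![0, 1, 3, 2, 4, 5]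

/-- The columns of `V` are fixed by the conjugation `(x, H, y) ↦ (x̄, Hᴴ, ȳ)`. -/
def IsRealMat (V : Matrix (Fin 6) (Fin 6) ℂ) : Prop := ∀ i j, conj (V i j) = V (swapIdx i) j

/-- For `X ∈ SU(2,2)` the inverse of `⋀² X` can be computed from the wedge product pairing and from
`X⁻¹ = -J Xᴴ J`; the comparison shows that `⋀² X` commutes with the conjugation
`(x, H, y) ↦ (x̄, Hᴴ, ȳ)`. -/
theorem conj_extSq {X : Matrix (Fin 2 ⊕ Fin 2) (Fin 2 ⊕ Fin 2) ℂ} (hd : X.det = 1)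
    (hX : Xᴴ * J * X = J) (I K : Fin 6) :
    conj (extSq X I K) = extSq X (swapIdx I) (swapIdx K) := by
  set S : Matrix (Fin 6) (Fin 6) ℂ := of fun i j => if i = swapIdx j then 1 else 0 with hS
  have hJ : J * J = -1 := by
    simp [J, fromBlocks_multiply, ← fromBlocks_one, fromBlocks_neg]
  have hinv : extSq J * (extSq X)ᴴ * extSq J * extSq X = 1 := by
    rw [← extSq_conjTranspose, ← extSq_mul, ← extSq_mul, ← extSq_mul, Matrix.mul_assoc J,
      Matrix.mul_assoc J, hX, hJ, extSq_neg, extSq_one]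
  have hW := extSq_wedgeForm X
  rw [hd, one_smul] at hW
  have h1 : wedgeForm * extSq J = -S := by
    ext i j
    simp only [Matrix.mul_apply, Fin.sum_univ_six, wedgeForm, extSq, of_apply, minor, fstIdx,
      sndIdx, hS, swapIdx, Matrix.neg_apply, J]
    fin_cases i <;> fin_cases j <;> simp
  have h2 : extSq J * wedgeForm = -S := by
    ext i j
    simp only [Matrix.mul_apply, Fin.sum_univ_six, wedgeForm, extSq, of_apply, minor, fstIdx,
      sndIdx, hS, swapIdx, Matrix.neg_apply, J]
    fin_cases i <;> fin_cases j <;> simp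
  have h3 : wedgeForm * wedgeForm = 1 := by
    ext i j
    simp only [Matrix.mul_apply, Fin.sum_univ_six, wedgeForm, of_apply]
    fin_cases i <;> fin_cases j <;> simp
  have hinv' := mul_eq_one_comm.1 hinv
  have h4 : (extSq X)ᵀ = S * (extSq X)ᴴ * S := by
    calc (extSq X)ᵀ = (extSq X)ᵀ * wedgeForm *
          (extSq X * (extSq J * (extSq X)ᴴ * extSq J)) * wedgeForm := by
            rw [hinv', Matrix.mul_one, Matrix.mul_assoc, h3, Matrix.mul_one]
      _ = ((extSq X)ᵀ * wedgeForm * extSq X) * extSq J * (extSq X)ᴴ * (extSq J * wedgeForm) := by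
            simp only [Matrix.mul_assoc]
      _ = _ := by rw [hW, h1, h2]; simp
  have h5 := congrFun (congrFun h4 (swapIdx K)) (swapIdx I)
  simp only [hS, Matrix.mul_apply, Fin.sum_univ_six, Matrix.transpose_apply,
    Matrix.conjTranspose_apply, of_apply] at h5
  rw [h5]
  fin_cases I <;> fin_cases K <;> simp [swapIdx]

/-- `X ∈ SU(2,2)`, as a predicate on matrices. -/
def IsSU (X : Matrix (Fin 2 ⊕ Fin 2) (Fin 2 ⊕ Fin 2) ℂ) : Prop := X.det = 1 ∧ Xᴴ * J * X = J

theorem IsSU.mul {X Y : Matrix (Fin 2 ⊕ Fin 2) (Fin 2 ⊕ Fin 2) ℂ} (hX : IsSU X) (hY : IsSU Y) :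
    IsSU (X * Y) := by
  refine ⟨by rw [det_mul, hX.1, hY.1, one_mul], ?_⟩
  rw [conjTranspose_mul]
  calc Yᴴ * Xᴴ * J * (X * Y) = Yᴴ * (Xᴴ * J * X) * Y := by simp only [Matrix.mul_assoc]
    _ = J := by rw [hX.2, hY.2]

theorem isSU_cmat {m : ℕ} (M : Gam m) : IsSU (cmat M) := by
  refine ⟨?_, cmat_unitary M⟩
  have := (Matrix.SpecialLinearGroup.map (toC m) M.1).det_coe
  simpa [cmat] using! this

/-- The columns express the basis of `ℝ ⊕ Herm ⊕ ℝ` used for `M̃` in the coordinates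
`(x, H₁₁, H₁₂, H₂₁, H₂₂, y)`. -/
def coordMat (m : ℕ) : Matrix (Fin 6) (Fin 6) ℂ :=
  !![1, 0, 0, 0, 0, 0;
     0, 1, 0, 0, 0, 0;
     0, 0, 1, omega m, 0, 0;
     0, 0, 1, conj (omega m), 0, 0;
     0, 0, 0, 0, 1, 0;
     0, 0, 0, 0, 0, 1]

/-- The coordinate `β` of `β + γ ω_K`. -/
def coordB (m : ℕ) (z : ℂ) : ℝ := z.re - z.im / (omega m).im * (omega m).re

/-- The coordinate `γ` of `β + γ ω_K`. -/
def coordC (m : ℕ) (z : ℂ) : ℝ := z.im / (omega m).im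

theorem coord_add_mul {m : ℕ} (hm : m ≠ 0) (z : ℂ) :
    (coordB m z : ℂ) + coordC m z * omega m = z := by
  have h := omega_im_ne_zero hm
  apply Complex.ext <;> simp [coordB, coordC, h]

theorem coordB_eq {m : ℕ} (hm : m ≠ 0) (a b : ℝ) : coordB m (a + b * omega m) = a := by
  have h := omega_im_ne_zero hm
  simp [coordB, h]

theorem coordC_eq {m : ℕ} (hm : m ≠ 0) (a b : ℝ) : coordC m (a + b * omega m) = b := by
  have h := omega_im_ne_zero hm
  simp [coordC, h]

/-- The real coordinates of the columns of `V`, which are supposed to be fixed by the conjugation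
`(x, H, y) ↦ (x̄, Hᴴ, ȳ)`. -/
def realCoord (m : ℕ) (V : Matrix (Fin 6) (Fin 6) ℂ) : Matrix (Fin 6) (Fin 6) ℝ :=
  of fun i j => ![(V 0 j).re, (V 1 j).re, coordB m (V 2 j), coordC m (V 2 j), (V 4 j).re,
    (V 5 j).re] i

theorem IsRealMat.coordMat_mul {m : ℕ} (hm : m ≠ 0) {V : Matrix (Fin 6) (Fin 6) ℂ}
    (hV : IsRealMat V) : coordMat m * (realCoord m V).map Complex.ofReal = V := by
  have h0 : ∀ i, swapIdx i = i → ∀ j, ((V i j).re : ℂ) = V i j := fun i hi j => by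
    rw [← Complex.conj_eq_iff_re, hV i j, hi]
  have h2 (j) := coord_add_mul hm (V 2 j)
  have h3 (j) : (coordB m (V 2 j) : ℂ) + coordC m (V 2 j) * conj (omega m) = V 3 j := by
    have := congrArg conj (h2 j)
    rw [hV 2 j] at this
    simpa [swapIdx] using this
  ext i j
  rw [Matrix.mul_apply, Fin.sum_univ_six]
  fin_cases i <;> simp [coordMat, realCoord]
  · exact h0 0 rfl j
  · exact h0 1 rfl j
  · linear_combination h2 j
  · linear_combination h3 j
  · exact h0 4 rfl j
  · exact h0 5 rfl j

theorem coordMat_injective {m : ℕ} (hm : m ≠ 0) {A B : Matrix (Fin 6) (Fin 6) ℝ}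
    (h : coordMat m * A.map Complex.ofReal = coordMat m * B.map Complex.ofReal) : A = B := by
  ext i j
  have hr (k) : (coordMat m * A.map Complex.ofReal) k j = (coordMat m * B.map Complex.ofReal) k j :=
    by rw [h]
  simp only [Matrix.mul_apply, Fin.sum_univ_six] at hr
  have h2 : A 2 j = B 2 j ∧ A 3 j = B 3 j := by
    have := hr 2
    simp [coordMat] at this
    have e (C : Matrix (Fin 6) (Fin 6) ℝ) :
        (C 2 j : ℂ) + omega m * C 3 j = C 2 j + C 3 j * omega m := by ring
    rw [e, e] at this
    refine ⟨?_, ?_⟩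
    · rw [← coordB_eq hm (A 2 j) (A 3 j), this, coordB_eq hm]
    · rw [← coordC_eq hm (A 2 j) (A 3 j), this, coordC_eq hm]
  have h0 := hr 0
  have h1 := hr 1
  have h4 := hr 4
  have h5 := hr 5
  simp [coordMat] at h0 h1 h4 h5
  fin_cases i
  exacts [h0, h1, h2.1, h2.2, h4, h5]

theorem IsRealMat.sub {V V' : Matrix (Fin 6) (Fin 6) ℂ} (h : IsRealMat V) (h' : IsRealMat V') :
    IsRealMat (V - V') := fun i j => by
  rw [Matrix.sub_apply, Matrix.sub_apply, map_sub, h, h']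

theorem IsRealMat.extSq_mul {X : Matrix (Fin 2 ⊕ Fin 2) (Fin 2 ⊕ Fin 2) ℂ} (hX : IsSU X)
    {V : Matrix (Fin 6) (Fin 6) ℂ} (hV : IsRealMat V) : IsRealMat (extSq X * V) := by
  intro i j
  simp only [Matrix.mul_apply, map_add, map_mul, Fin.sum_univ_six]
  have h (k) : conj (extSq X i k) * conj (V k j) =
      extSq X (swapIdx i) (swapIdx k) * V (swapIdx k) j := by rw [conj_extSq hX.1 hX.2, hV]
  simp only [h]
  simp [swapIdx]
  ring

theorem isRealMat_coordMat (m : ℕ) : IsRealMat (coordMat m) := by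
  intro i j
  fin_cases i <;> fin_cases j <;> simp [coordMat, swapIdx]

/-! ### The orthogonal matrix attached to an element of `SU(2,2)` -/

/-- The matrix of `⋀² X` with respect to the basis of `ℝ ⊕ Herm ⊕ ℝ` used for `M̃`. -/
def ortho (m : ℕ) (X : Matrix (Fin 2 ⊕ Fin 2) (Fin 2 ⊕ Fin 2) ℂ) : Matrix (Fin 6) (Fin 6) ℝ :=
  realCoord m (extSq X * coordMat m)

theorem coordMat_mul_ortho {m : ℕ} (hm : m ≠ 0) {X : Matrix (Fin 2 ⊕ Fin 2) (Fin 2 ⊕ Fin 2) ℂ}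
    (hX : IsSU X) : coordMat m * (ortho m X).map Complex.ofReal = extSq X * coordMat m :=
  (IsRealMat.extSq_mul hX (isRealMat_coordMat m)).coordMat_mul hm

theorem ortho_mul {m : ℕ} (hm : m ≠ 0) {X Y : Matrix (Fin 2 ⊕ Fin 2) (Fin 2 ⊕ Fin 2) ℂ}
    (hX : IsSU X) (hY : IsSU Y) : ortho m (X * Y) = ortho m X * ortho m Y := by
  apply coordMat_injective hm
  have : (ortho m X * ortho m Y).map Complex.ofReal =
      (ortho m X).map Complex.ofReal * (ortho m Y).map Complex.ofReal :=
    Matrix.map_mul (f := Complex.ofRealHom)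
  rw [this, coordMat_mul_ortho hm (hX.mul hY), ← Matrix.mul_assoc, coordMat_mul_ortho hm hX,
    Matrix.mul_assoc, coordMat_mul_ortho hm hY, ← Matrix.mul_assoc, extSq_mul]

theorem isSU_one : IsSU 1 := ⟨det_one, by simp⟩

theorem ortho_one {m : ℕ} (hm : m ≠ 0) : ortho m 1 = 1 := by
  apply coordMat_injective hm
  rw [coordMat_mul_ortho hm isSU_one, extSq_one]
  simp [Matrix.map_one]

theorem S₁_eq (m : ℕ) : S₁ m =
    !![0, 0, 0, 0, 0, 1;
       0, 0, 0, 0, 1, 0;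
       0, 0, -2, -omegaTr m, 0, 0;
       0, 0, -omegaTr m, -(2 * omegaNm m), 0, 0;
       0, 1, 0, 0, 0, 0;
       1, 0, 0, 0, 0, 0] := by
  rw [S₁, S₀, SK_eq]
  ext i j
  fin_cases i <;> fin_cases j <;> rfl

/-- In the coordinates `(x, H, y)` the quadratic form of `S₁` is `x y + det H`. -/
theorem coordMat_wedgeForm (m : ℕ) :
    (coordMat m)ᵀ * wedgeForm * coordMat m = (S₁ m).map (Int.cast : ℤ → ℂ) := by
  have h1 := omega_add_conj m
  have h2 := omega_mul_conj m
  rw [S₁_eq]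
  ext i j
  simp only [Matrix.mul_apply, Fin.sum_univ_six, wedgeForm, coordMat, Matrix.transpose_apply,
    Matrix.map_apply, of_apply]
  fin_cases i <;> fin_cases j <;> simp [← h1, ← h2] <;> ring

theorem ortho_form {m : ℕ} (hm : m ≠ 0) {X : Matrix (Fin 2 ⊕ Fin 2) (Fin 2 ⊕ Fin 2) ℂ}
    (hX : IsSU X) :
    (ortho m X)ᵀ * (S₁ m).map (Int.cast : ℤ → ℝ) * ortho m X = (S₁ m).map (Int.cast : ℤ → ℝ) := by
  apply Matrix.map_injective Complex.ofReal_injective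
  have e : ((S₁ m).map (Int.cast : ℤ → ℝ)).map Complex.ofReal = (S₁ m).map (Int.cast : ℤ → ℂ) := by
    ext i j; simp
  have hmap (A B : Matrix (Fin 6) (Fin 6) ℝ) : (A * B).map Complex.ofReal =
      A.map Complex.ofReal * B.map Complex.ofReal := Matrix.map_mul (f := Complex.ofRealHom)
  have hP := coordMat_mul_ortho hm hX
  have hW := extSq_wedgeForm X
  rw [hX.1, one_smul] at hW
  change ((ortho m X)ᵀ * _ * ortho m X).map Complex.ofReal = (Matrix.map _ _).map Complex.ofReal
  rw [hmap, hmap, e, ← coordMat_wedgeForm, transpose_map]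
  calc _ = (coordMat m * (ortho m X).map Complex.ofReal)ᵀ * wedgeForm *
        (coordMat m * (ortho m X).map Complex.ofReal) := by
        rw [transpose_mul]; simp only [Matrix.mul_assoc]
    _ = (coordMat m)ᵀ * ((extSq X)ᵀ * wedgeForm * extSq X) * coordMat m := by
        rw [hP, transpose_mul]; simp only [Matrix.mul_assoc]
    _ = _ := by rw [hW]

/-- The different `ω - ω̄` of `𝒪_K`, a square root of the discriminant. -/
def diffGen (m : ℕ) : ℂ := omega m - conj (omega m)

theorem diffGen_ne_zero {m : ℕ} (hm : m ≠ 0) : diffGen m ≠ 0 := by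
  intro h
  have := congrArg Complex.im h
  simp [diffGen, omega_im_ne_zero hm] at this

theorem conj_diffGen (m : ℕ) : conj (diffGen m) = -diffGen m := by
  simp [diffGen]

/-- The matrix `P S₁⁻¹`, where `P` is the coordinate matrix: its columns are the basis of the dual
lattice that is dual to the basis of `ℝ ⊕ Herm ⊕ ℝ` used for `M̃`. The middle columns come from
the basis `-ω/(ω - ω̄), 1/(ω - ω̄)` of the inverse different. -/
def dualMat (m : ℕ) : Matrix (Fin 6) (Fin 6) ℂ :=
  !![0, 0, 0, 0, 0, 1;
     0, 0, 0, 0, 1, 0;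
     0, 0, -omega m / diffGen m, 1 / diffGen m, 0, 0;
     0, 0, conj (omega m) / diffGen m, -1 / diffGen m, 0, 0;
     0, 1, 0, 0, 0, 0;
     1, 0, 0, 0, 0, 0]

theorem isRealMat_dualMat (m : ℕ) : IsRealMat (dualMat m) := by
  intro i j
  fin_cases i <;> fin_cases j <;> simp [dualMat, swapIdx, conj_diffGen, div_neg, neg_div]

theorem dualMat_mul {m : ℕ} (hm : m ≠ 0) :
    dualMat m * (S₁ m).map (Int.cast : ℤ → ℂ) = coordMat m := by
  have h1 := omega_add_conj m
  have h2 := omega_mul_conj m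
  have hd := diffGen_ne_zero hm
  rw [S₁_eq]
  ext i j
  simp only [Matrix.mul_apply, Fin.sum_univ_six, dualMat, coordMat, Matrix.map_apply, of_apply]
  fin_cases i <;> fin_cases j <;> simp [← h1, ← h2] <;> field_simp <;> rw [diffGen] <;> ring

/-- The matrix `(X̃ - 1) S₁⁻¹`; the discriminant kernel is defined by its integrality. -/
def defect (m : ℕ) (X : Matrix (Fin 2 ⊕ Fin 2) (Fin 2 ⊕ Fin 2) ℂ) : Matrix (Fin 6) (Fin 6) ℝ :=
  realCoord m (extSq X * dualMat m - dualMat m)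

theorem defect_mul {m : ℕ} (hm : m ≠ 0) {X : Matrix (Fin 2 ⊕ Fin 2) (Fin 2 ⊕ Fin 2) ℂ}
    (hX : IsSU X) : defect m X * (S₁ m).map (Int.cast : ℤ → ℝ) = ortho m X - 1 := by
  apply coordMat_injective hm
  have hmap (A B : Matrix (Fin 6) (Fin 6) ℝ) : (A * B).map Complex.ofReal =
      A.map Complex.ofReal * B.map Complex.ofReal := Matrix.map_mul (f := Complex.ofRealHom)
  have e : ((S₁ m).map (Int.cast : ℤ → ℝ)).map Complex.ofReal = (S₁ m).map (Int.cast : ℤ → ℂ) := by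
    ext i j; simp
  have h1 : coordMat m * (defect m X).map Complex.ofReal = extSq X * dualMat m - dualMat m :=
    ((IsRealMat.extSq_mul hX (isRealMat_dualMat m)).sub (isRealMat_dualMat m)).coordMat_mul hm
  have h2 : (ortho m X - 1).map Complex.ofReal = (ortho m X).map Complex.ofReal - 1 := by
    ext i j; by_cases h : i = j <;> simp [h]
  rw [hmap, e, ← Matrix.mul_assoc, h1, h2, Matrix.mul_sub, coordMat_mul_ortho hm hX, Matrix.sub_mul,
    Matrix.mul_assoc, dualMat_mul hm, Matrix.mul_one]

theorem exists_S₁_mul_eq_one {m : ℕ} (hm : m ≠ 0) :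
    ∃ D : Matrix (Fin 6) (Fin 6) ℝ, (S₁ m).map (Int.cast : ℤ → ℝ) * D = 1 := by
  refine ⟨realCoord m (dualMat m), ?_⟩
  rw [mul_eq_one_comm]
  apply coordMat_injective hm
  have hmap (A B : Matrix (Fin 6) (Fin 6) ℝ) : (A * B).map Complex.ofReal =
      A.map Complex.ofReal * B.map Complex.ofReal := Matrix.map_mul (f := Complex.ofRealHom)
  have e : ((S₁ m).map (Int.cast : ℤ → ℝ)).map Complex.ofReal = (S₁ m).map (Int.cast : ℤ → ℂ) := by
    ext i j; simp
  rw [hmap, e, ← Matrix.mul_assoc, (isRealMat_dualMat m).coordMat_mul hm, dualMat_mul hm]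
  simp [Matrix.map_one]

theorem mul_S₁_injective {m : ℕ} (hm : m ≠ 0) {A B : Matrix (Fin 6) (Fin 6) ℝ}
    (h : A * (S₁ m).map (Int.cast : ℤ → ℝ) = B * (S₁ m).map (Int.cast : ℤ → ℝ)) : A = B := by
  obtain ⟨D, hD⟩ := exists_S₁_mul_eq_one hm
  rw [← Matrix.mul_one A, ← Matrix.mul_one B, ← hD, ← Matrix.mul_assoc, h, Matrix.mul_assoc]

/-! ### Comparison with `M̃` -/

theorem fM_apply {m : ℕ} (M : Gam m) (Z : Matrix (Fin 2) (Fin 2) ℂ) (i j : Fin 2) :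
    fM M Z i j = extSq (cmat M) (![![1, 2], ![3, 4]] i j) 1 * Z 0 0 +
      extSq (cmat M) (![![1, 2], ![3, 4]] i j) 2 * Z 0 1 +
      extSq (cmat M) (![![1, 2], ![3, 4]] i j) 3 * Z 1 0 +
      extSq (cmat M) (![![1, 2], ![3, 4]] i j) 4 * Z 1 1 := by
  fin_cases i <;> fin_cases j <;>
    simp [fM, sharp, Matrix.mul_apply, Fin.sum_univ_two, extSq, minor, fstIdx, sndIdx, blkA, blkB,
      blkC, blkD, toBlocks₁₁, toBlocks₁₂, toBlocks₂₁, toBlocks₂₂] <;> ring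

section Blocks

variable {m : ℕ} (M : Gam m)

theorem extSq_corners : extSq (cmat M) 0 0 = (blkA M).det ∧ extSq (cmat M) 0 5 = -(blkB M).det ∧
    extSq (cmat M) 5 0 = -(blkC M).det ∧ extSq (cmat M) 5 5 = (blkD M).det := by
  refine ⟨?_, ?_, ?_, ?_⟩ <;>
    simp [det_fin_two, extSq, minor, fstIdx, sndIdx, blkA, blkB,
      blkC, blkD, toBlocks₁₁, toBlocks₁₂, toBlocks₂₁, toBlocks₂₂] <;> ring

theorem extSq_row_zero : extSq (cmat M) 0 1 = -(sharp (blkA M) * blkB M) 1 1 ∧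
    extSq (cmat M) 0 2 = (sharp (blkA M) * blkB M) 1 0 ∧
    extSq (cmat M) 0 3 = (sharp (blkA M) * blkB M) 0 1 ∧
    extSq (cmat M) 0 4 = -(sharp (blkA M) * blkB M) 0 0 := by
  refine ⟨?_, ?_, ?_, ?_⟩ <;>
    simp [sharp, Matrix.mul_apply, Fin.sum_univ_two, extSq, minor, fstIdx, sndIdx, blkA, blkB,
      toBlocks₁₁, toBlocks₁₂] <;> ring

theorem extSq_row_five : extSq (cmat M) 5 1 = (sharp (blkC M) * blkD M) 1 1 ∧
    extSq (cmat M) 5 2 = -(sharp (blkC M) * blkD M) 1 0 ∧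
    extSq (cmat M) 5 3 = -(sharp (blkC M) * blkD M) 0 1 ∧
    extSq (cmat M) 5 4 = (sharp (blkC M) * blkD M) 0 0 := by
  refine ⟨?_, ?_, ?_, ?_⟩ <;>
    simp [sharp, Matrix.mul_apply, Fin.sum_univ_two, extSq, minor, fstIdx, sndIdx, blkC, blkD,
      toBlocks₂₁, toBlocks₂₂] <;> ring

theorem extSq_col_zero : extSq (cmat M) 1 0 = -(blkA M * sharp (blkC M)) 0 0 ∧
    extSq (cmat M) 2 0 = -(blkA M * sharp (blkC M)) 0 1 ∧
    extSq (cmat M) 3 0 = -(blkA M * sharp (blkC M)) 1 0 ∧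
    extSq (cmat M) 4 0 = -(blkA M * sharp (blkC M)) 1 1 := by
  refine ⟨?_, ?_, ?_, ?_⟩ <;>
    simp [sharp, Matrix.mul_apply, Fin.sum_univ_two, extSq, minor, fstIdx, sndIdx, blkA, blkC,
      toBlocks₁₁, toBlocks₂₁] <;> ring

theorem extSq_col_five : extSq (cmat M) 1 5 = (blkB M * sharp (blkD M)) 0 0 ∧
    extSq (cmat M) 2 5 = (blkB M * sharp (blkD M)) 0 1 ∧
    extSq (cmat M) 3 5 = (blkB M * sharp (blkD M)) 1 0 ∧
    extSq (cmat M) 4 5 = (blkB M * sharp (blkD M)) 1 1 := by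
  refine ⟨?_, ?_, ?_, ?_⟩ <;>
    simp [sharp, Matrix.mul_apply, Fin.sum_univ_two, extSq, minor, fstIdx, sndIdx, blkB, blkD,
      toBlocks₁₂, toBlocks₂₂] <;> ring

end Blocks

theorem isHermitian_of_conj {X : Matrix (Fin 2) (Fin 2) ℂ} (h0 : conj (X 0 0) = X 0 0)
    (h1 : conj (X 0 1) = X 1 0) (h2 : conj (X 1 1) = X 1 1) : X.IsHermitian := by
  ext i j
  fin_cases i <;> fin_cases j
  · exact h0
  · change conj (X 1 0) = X 0 1
    rw [← h1, Complex.conj_conj]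
  · exact h1
  · exact h2

theorem tildeWellDefined {m : ℕ} (M : Gam m) : TildeWellDefined M := by
  have h := conj_extSq (isSU_cmat M).1 (isSU_cmat M).2
  obtain ⟨c1, c2, c3, c4⟩ := extSq_corners M
  obtain ⟨r1, r2, r3, r4⟩ := extSq_row_zero M
  obtain ⟨s1, s2, s3, s4⟩ := extSq_row_five M
  obtain ⟨t1, t2, t3, t4⟩ := extSq_col_zero M
  obtain ⟨u1, u2, u3, u4⟩ := extSq_col_five M
  refine ⟨?_, ?_, ?_, ?_, ?_, ?_, ?_, ?_, fun Z hZ => ?_⟩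
  · have := h 0 0
    exact Complex.conj_eq_iff_im.1 (by simpa [swapIdx, c1] using! this)
  · have := h 0 5
    simp [swapIdx, c2] at this
    exact Complex.conj_eq_iff_im.1 this
  · have := h 5 0
    simp [swapIdx, c3] at this
    exact Complex.conj_eq_iff_im.1 this
  · have := h 5 5
    exact Complex.conj_eq_iff_im.1 (by simpa [swapIdx, c4] using! this)
  · exact isHermitian_of_conj (by simpa [swapIdx, r4] using h 0 4)
      (by simpa [swapIdx, r2, r3] using h 0 3) (by simpa [swapIdx, r1] using h 0 1)
  · exact isHermitian_of_conj (by simpa [swapIdx, t1] using h 1 0)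
      (by simpa [swapIdx, t2, t3] using h 2 0) (by simpa [swapIdx, t4] using h 4 0)
  · exact isHermitian_of_conj (by simpa [swapIdx, u1] using h 1 5)
      (by simpa [swapIdx, u2, u3] using h 2 5) (by simpa [swapIdx, u4] using h 4 5)
  · exact isHermitian_of_conj (by simpa [swapIdx, s4] using h 5 4)
      (by simpa [swapIdx, s2, s3] using h 5 3) (by simpa [swapIdx, s1] using h 5 1)
  · have z0 : conj (Z 0 0) = Z 0 0 := hZ.apply 0 0
    have z1 : conj (Z 0 1) = Z 1 0 := hZ.apply 1 0
    have z2 : conj (Z 1 0) = Z 0 1 := hZ.apply 0 1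
    have z3 : conj (Z 1 1) = Z 1 1 := hZ.apply 1 1
    apply isHermitian_of_conj <;> rw [fM_apply] <;>
      simp [h, z0, z1, z2, z3, swapIdx, fM_apply] <;> ring

set_option maxHeartbeats 2000000 in
/-- `M̃` is the matrix of the exterior square of `M` in real coordinates. -/
theorem tilde_eq {m : ℕ} (hm : m ≠ 0) (M : Gam m) : tilde M = ortho m (cmat M) := by
  obtain ⟨-, -, -, -, hAB, -, -, hCD, -⟩ := tildeWellDefined M
  obtain ⟨c1, c2, c3, c4⟩ := extSq_corners M
  obtain ⟨r1, r2, r3, r4⟩ := extSq_row_zero M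
  obtain ⟨s1, s2, s3, s4⟩ := extSq_row_five M
  obtain ⟨t1, t2, t3, t4⟩ := extSq_col_zero M
  obtain ⟨u1, u2, u3, u4⟩ := extSq_col_five M
  have hS : (S₀ m).map (Int.cast : ℤ → ℝ) =
      !![0, 0, 0, 1;
         0, -2, -(omegaTr m : ℝ), 0;
         0, -(omegaTr m : ℝ), -(2 * (omegaNm m : ℝ)), 0;
         1, 0, 0, 0] := by
    unfold S₀
    rw [SK_eq]
    ext i j
    fin_cases i <;> fin_cases j <;> simp [hypSum₂]
  have tr : (omegaTr m : ℝ) = 2 * (omega m).re := by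
    have := congrArg Complex.re (omega_add_conj m)
    simp at this
    linarith
  have nm : (omegaNm m : ℝ) = (omega m).re ^ 2 + (omega m).im ^ 2 := by
    have := congrArg Complex.re (omega_mul_conj m)
    simp at this
    linarith
  have ab : (sharp (blkA M) * blkB M) 1 0 = conj ((sharp (blkA M) * blkB M) 0 1) :=
    (hAB.apply 1 0).symm
  have cd : (sharp (blkC M) * blkD M) 1 0 = conj ((sharp (blkC M) * blkD M) 0 1) :=
    (hCD.apply 1 0).symm
  unfold tilde ortho
  simp only [hS]
  have him := omega_im_ne_zero hm
  ext i j
  rw [realCoord, of_apply]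
  simp only [Matrix.mul_apply, Fin.sum_univ_six, coordMat]
  generalize hP : blkA M * sharp (blkC M) = P at *
  generalize hQ : blkB M * sharp (blkD M) = Q at *
  generalize hG : sharp (blkA M) * blkB M = G at *
  generalize hH : sharp (blkC M) * blkD M = H at *
  have hmat (k l) : matK M k l = phi m (fM M (hermBasis m l)) k := rfl
  fin_cases j
  · fin_cases i <;> simp [c1, t1, t2, t4, c3, vecb, phi, coordB, coordC, hP, neg_div] <;> ring
  · fin_cases i
    · simp [veca, hG, phi, r1, vecMul, dotProduct, Fin.sum_univ_four]
    · simp [hmat, phi, hermBasis, fM_apply]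
    · simp [hmat, phi, hermBasis, fM_apply, coordB]
    · simp [hmat, phi, hermBasis, fM_apply, coordC]
    · simp [hmat, phi, hermBasis, fM_apply]
    · simp [vecd, hH, phi, s1, vecMul, dotProduct, Fin.sum_univ_four]
  · fin_cases i
    · simp [veca, hG, phi, r2, r3, vecMul, dotProduct, Fin.sum_univ_four, ab, tr]
      field_simp
      ring
    · simp [hmat, phi, hermBasis, fM_apply]
    · simp [hmat, phi, hermBasis, fM_apply, coordB]
    · simp [hmat, phi, hermBasis, fM_apply, coordC]
    · simp [hmat, phi, hermBasis, fM_apply]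
    · simp [vecd, hH, phi, s2, s3, vecMul, dotProduct, Fin.sum_univ_four, cd, tr]
      field_simp
      ring
  · fin_cases i
    · simp [veca, hG, phi, r2, r3, vecMul, dotProduct, Fin.sum_univ_four, ab, tr, nm]
      field_simp
      ring
    · simp [hmat, phi, hermBasis, fM_apply]
    · simp [hmat, phi, hermBasis, fM_apply, coordB]
    · simp [hmat, phi, hermBasis, fM_apply, coordC]
    · simp [hmat, phi, hermBasis, fM_apply]
    · simp [vecd, hH, phi, s2, s3, vecMul, dotProduct, Fin.sum_univ_four, cd, tr, nm]
      field_simp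
      ring
  · fin_cases i
    · simp [veca, hG, phi, r4, vecMul, dotProduct, Fin.sum_univ_four]
    · simp [hmat, phi, hermBasis, fM_apply]
    · simp [hmat, phi, hermBasis, fM_apply, coordB]
    · simp [hmat, phi, hermBasis, fM_apply, coordC]
    · simp [hmat, phi, hermBasis, fM_apply]
    · simp [vecd, hH, phi, s4, vecMul, dotProduct, Fin.sum_univ_four]
  · fin_cases i <;> simp [c2, u1, u2, u4, c4, vecc, phi, coordB, coordC, hQ]

/-! ### Integrality of the defect in terms of the exterior square -/

theorem CongMod.sub_iff {m N : ℕ} {x y : ℂ} : CongMod m N (x - y) 0 ↔ CongMod m N x y := by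
  simp [CongMod]

theorem CongMod.symm {m N : ℕ} {x y : ℂ} (h : CongMod m N x y) : CongMod m N y x := by
  obtain ⟨z, hz⟩ := h
  exact ⟨-z, by rw [map_neg]; linear_combination -hz⟩

theorem CongMod.sub {m N : ℕ} {x y x' y' : ℂ} (h : CongMod m N x y) (h' : CongMod m N x' y') :
    CongMod m N (x - x') (y - y') := by
  simpa only [sub_eq_add_neg] using h.add h'.neg

theorem congMod_zero_iff {m N : ℕ} {x : ℂ} :
    CongMod m N x 0 ↔ ∃ z ∈ (toC m).range, x = N * z := by
  constructor
  · rintro ⟨z, hz⟩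
    exact ⟨_, ⟨z, rfl⟩, by simpa using hz⟩
  · rintro ⟨_, ⟨z, rfl⟩, hz⟩
    exact ⟨z, by simpa using hz⟩

theorem mem_range_iff_congMod {m : ℕ} {x : ℂ} : x ∈ (toC m).range ↔ CongMod m 1 x 0 := by
  simp [congMod_zero_iff]

theorem congMod_zero_iff_coord {m : ℕ} (hm : Squarefree m) {N : ℕ} {x : ℂ} :
    CongMod m N x 0 ↔ (∃ k : ℤ, coordB m x = N * k) ∧ ∃ k : ℤ, coordC m x = N * k := by
  rw [congMod_zero_iff]
  constructor
  · rintro ⟨z, hz, rfl⟩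
    obtain ⟨a, b, rfl⟩ := (mem_range_iff hm).1 hz
    have : (N : ℂ) * (a + b * omega m) = ((N * a : ℝ) : ℂ) + ((N * b : ℝ) : ℂ) * omega m := by
      push_cast; ring
    rw [this]
    exact ⟨⟨a, coordB_eq hm.ne_zero _ _⟩, b, coordC_eq hm.ne_zero _ _⟩
  · rintro ⟨⟨a, ha⟩, b, hb⟩
    refine ⟨a + b * omega m, (mem_range_iff hm).2 ⟨a, b, rfl⟩, ?_⟩
    rw [← coord_add_mul hm.ne_zero x, ha, hb]
    push_cast; ring

theorem congMod_zero_iff_re {m : ℕ} (hm : Squarefree m) {N : ℕ} {x : ℂ} (hx : conj x = x) :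
    CongMod m N x 0 ↔ ∃ k : ℤ, x.re = N * k := by
  have h0 : x.im = 0 := Complex.conj_eq_iff_im.1 hx
  rw [congMod_zero_iff_coord hm]
  simp only [coordB, coordC, h0, zero_div, zero_mul, sub_zero]
  exact and_iff_left ⟨0, by simp⟩

theorem congMod_sub_conj_div {m : ℕ} (hm : Squarefree m) {N : ℕ} {x : ℂ} (h : CongMod m N x 0) :
    CongMod m N ((x - conj x) / diffGen m) 0 := by
  obtain ⟨z, hz, rfl⟩ := congMod_zero_iff.1 h
  obtain ⟨a, b, rfl⟩ := (mem_range_iff hm).1 hz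
  refine congMod_zero_iff.2 ⟨b, int_mem_range m b, ?_⟩
  rw [div_eq_iff (diffGen_ne_zero hm.ne_zero), diffGen]
  simp
  ring

theorem sub_conj_div_mem {m : ℕ} (hm : Squarefree m) {x : ℂ} (h : x ∈ (toC m).range) :
    (x - conj x) / diffGen m ∈ (toC m).range :=
  mem_range_iff_congMod.2 (congMod_sub_conj_div hm (mem_range_iff_congMod.1 h))

/-- The map `t ↦ α t + β t̄` sends the inverse different, spanned by `-ω/(ω - ω̄)` and
`1/(ω - ω̄)`, into `N 𝒪_K` if and only if `β ∈ N 𝒪_K` and `α - β ∈ N (ω - ω̄) 𝒪_K`. -/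
theorem congMod_different_iff {m : ℕ} (hm : m ≠ 0) {N : ℕ} {α β : ℂ} :
    (CongMod m N ((-α * omega m + β * conj (omega m)) / diffGen m) 0 ∧
      CongMod m N ((α - β) / diffGen m) 0) ↔
    CongMod m N β 0 ∧ CongMod m N ((α - β) / diffGen m) 0 := by
  have hd := diffGen_ne_zero hm
  have e : (-α * omega m + β * conj (omega m)) / diffGen m =
      -(omega m * ((α - β) / diffGen m)) - β := by
    field_simp
    rw [diffGen]; ring
  rw [e]
  refine and_congr_left fun h => ?_
  have h1 := (h.mul_left (omega_mem_range m)).neg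
  constructor
  · intro h2
    simpa using h1.sub h2
  · intro h2
    simpa using h1.sub h2

theorem congMod_conj_iff {m N : ℕ} {x : ℂ} : CongMod m N (conj x) 0 ↔ CongMod m N x 0 :=
  ⟨fun h => by simpa using h.conj_zero, fun h => h.conj_zero⟩

/-- The trace pairing of `α` with the inverse different has values in `N ℤ` if and only if
`α ∈ N 𝒪_K`. -/
theorem congMod_trace_iff {m : ℕ} (hm : Squarefree m) {N : ℕ} {α : ℂ} :
    (CongMod m N ((-α * omega m + conj α * conj (omega m)) / diffGen m) 0 ∧
      CongMod m N ((α - conj α) / diffGen m) 0) ↔ CongMod m N α 0 := by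
  rw [congMod_different_iff hm.ne_zero, congMod_conj_iff]
  exact and_iff_left_of_imp fun h => congMod_sub_conj_div hm h

/-- The congruences between the entries of `⋀² X` which express that the `(i, j)` entry of the
defect of `X` is divisible by `f i j`. -/
def DefectCong (m : ℕ) (f : Fin 6 → Fin 6 → ℕ) (X : Matrix (Fin 2 ⊕ Fin 2) (Fin 2 ⊕ Fin 2) ℂ) :
    Prop :=
  (∀ i, i ≠ 3 → ∀ j, j ≠ 2 → j ≠ 3 →
    CongMod m (f i j.rev) (extSq X i j) ((1 : Matrix (Fin 6) (Fin 6) ℂ) i j)) ∧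
  (∀ i, i ≠ 2 → i ≠ 3 → CongMod m (f i 2) (extSq X i 2) 0) ∧
  CongMod m (f 2 2) (extSq X 2 3) 0 ∧
  CongMod m (f 2 2) ((extSq X 2 2 - extSq X 2 3 - 1) / diffGen m) 0

theorem realCoord_dvd_iff {m : ℕ} (hm : Squarefree m) {f : Fin 6 → ℕ} (hf : f 3 = f 2)
    {V : Matrix (Fin 6) (Fin 6) ℂ} (hV : IsRealMat V) (j : Fin 6) :
    (∀ i, ∃ k : ℤ, realCoord m V i j = f i * k) ↔ ∀ i, i ≠ 3 → CongMod m (f i) (V i j) 0 := by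
  have h0 := congMod_zero_iff_re hm (N := f 0) (hV 0 j)
  have h1 := congMod_zero_iff_re hm (N := f 1) (hV 1 j)
  have h2 := congMod_zero_iff_coord hm (N := f 2) (x := V 2 j)
  have h4 := congMod_zero_iff_re hm (N := f 4) (hV 4 j)
  have h5 := congMod_zero_iff_re hm (N := f 5) (hV 5 j)
  constructor
  · intro h i hi
    fin_cases i
    · exact h0.2 (h 0)
    · exact h1.2 (h 1)
    · exact h2.2 ⟨h 2, by simpa [hf] using! h 3⟩
    · exact absurd rfl hi
    · exact h4.2 (h 4)
    · exact h5.2 (h 5)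
  · intro h i
    fin_cases i
    · exact h0.1 (h 0 (by decide))
    · exact h1.1 (h 1 (by decide))
    · exact (h2.1 (h 2 (by decide))).1
    · simpa [hf] using! (h2.1 (h 2 (by decide))).2
    · exact h4.1 (h 4 (by decide))
    · exact h5.1 (h 5 (by decide))

theorem extSq_mul_dualMat (m : ℕ) (X : Matrix (Fin 2 ⊕ Fin 2) (Fin 2 ⊕ Fin 2) ℂ) (i : Fin 6) :
    (extSq X * dualMat m) i 0 = extSq X i 5 ∧ (extSq X * dualMat m) i 1 = extSq X i 4 ∧
    (extSq X * dualMat m) i 2 =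
      (-extSq X i 2 * omega m + extSq X i 3 * conj (omega m)) / diffGen m ∧
    (extSq X * dualMat m) i 3 = (extSq X i 2 - extSq X i 3) / diffGen m ∧
    (extSq X * dualMat m) i 4 = extSq X i 1 ∧ (extSq X * dualMat m) i 5 = extSq X i 0 := by
  simp only [Matrix.mul_apply, Fin.sum_univ_six]
  refine ⟨?_, ?_, ?_, ?_, ?_, ?_⟩ <;> simp [dualMat] <;> ring

theorem defect_dvd_iff {m : ℕ} (hm : Squarefree m) {f : Fin 6 → Fin 6 → ℕ}
    (hf : ∀ j, f 3 j = f 2 j) (hf' : ∀ i, f i 3 = f i 2)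
    {X : Matrix (Fin 2 ⊕ Fin 2) (Fin 2 ⊕ Fin 2) ℂ} (hX : IsSU X) :
    (∀ i j, ∃ k : ℤ, defect m X i j = f i j * k) ↔ DefectCong m f X := by
  have hV := (IsRealMat.extSq_mul hX (isRealMat_dualMat m)).sub (isRealMat_dualMat m)
  rw [forall_comm]
  have h1 (j) := realCoord_dvd_iff hm (f := fun i => f i j) (hf j) hV j
  simp only [defect, h1]
  have hrow (i : Fin 6) (h2 : i ≠ 2) (h3 : i ≠ 3) : 
      (CongMod m (f i 2) ((extSq X * dualMat m - dualMat m) i 2) 0 ∧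
      CongMod m (f i 2) ((extSq X * dualMat m - dualMat m) i 3) 0) ↔
      CongMod m (f i 2) (extSq X i 2) 0 := by
    have hc : extSq X i 3 = conj (extSq X i 2) := by
      rw [conj_extSq hX.1 hX.2]
      congr 1
      fin_cases i <;> first | rfl | exact absurd rfl h2 | exact absurd rfl h3
    have z2 : dualMat m i 2 = 0 := by
      fin_cases i <;> first | rfl | exact absurd rfl h2 | exact absurd rfl h3
    have z3 : dualMat m i 3 = 0 := by
      fin_cases i <;> first | rfl | exact absurd rfl h2 | exact absurd rfl h3
    rw [Matrix.sub_apply, Matrix.sub_apply, z2, z3, sub_zero, sub_zero,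
      (extSq_mul_dualMat m X i).2.2.1, (extSq_mul_dualMat m X i).2.2.2.1, hc]
    exact congMod_trace_iff hm
  have hrow2 : (CongMod m (f 2 2) ((extSq X * dualMat m - dualMat m) 2 2) 0 ∧
      CongMod m (f 2 2) ((extSq X * dualMat m - dualMat m) 2 3) 0) ↔
      CongMod m (f 2 2) (extSq X 2 3) 0 ∧
      CongMod m (f 2 2) ((extSq X 2 2 - extSq X 2 3 - 1) / diffGen m) 0 := by
    have e1 : (extSq X * dualMat m - dualMat m) 2 2 =
        (-(extSq X 2 2 - 1) * omega m + extSq X 2 3 * conj (omega m)) / diffGen m := by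
      rw [Matrix.sub_apply, (extSq_mul_dualMat m X 2).2.2.1]
      simp [dualMat]; ring
    have e2 : (extSq X * dualMat m - dualMat m) 2 3 =
        ((extSq X 2 2 - 1) - extSq X 2 3) / diffGen m := by
      rw [Matrix.sub_apply, (extSq_mul_dualMat m X 2).2.2.2.1]
      simp [dualMat]; ring
    rw [e1, e2, congMod_different_iff hm.ne_zero, sub_right_comm]
  have hcol (i j : Fin 6) (h2 : j ≠ 2) (h3 : j ≠ 3) :
      CongMod m (f i j.rev) ((extSq X * dualMat m - dualMat m) i j.rev) 0 ↔
      CongMod m (f i j.rev) (extSq X i j) ((1 : Matrix (Fin 6) (Fin 6) ℂ) i j) := by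
    rw [← CongMod.sub_iff (x := extSq X i j)]
    have e : (extSq X * dualMat m - dualMat m) i j.rev =
        extSq X i j - (1 : Matrix (Fin 6) (Fin 6) ℂ) i j := by
      rw [Matrix.sub_apply]
      obtain ⟨a0, a1, -, -, a4, a5⟩ := extSq_mul_dualMat m X i
      have hd : dualMat m i j.rev = (1 : Matrix (Fin 6) (Fin 6) ℂ) i j := by
        fin_cases j
        all_goals first | exact absurd rfl h2 | exact absurd rfl h3 | skip
        all_goals fin_cases i <;> rfl
      rw [hd]
      congr 1
      fin_cases j
      exacts [a5, a4, absurd rfl h2, absurd rfl h3, a1, a0]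
    rw [e]
  constructor
  · intro h
    refine ⟨fun i hi j h2 h3 => (hcol i j h2 h3).1 (h _ i hi), fun i h2 h3 => ?_, ?_⟩
    · exact (hrow i h2 h3).1 ⟨h 2 i h3, by simpa [hf'] using h 3 i h3⟩
    · exact hrow2.1 ⟨h 2 2 (by decide), by simpa [hf'] using h 3 2 (by decide)⟩
  · rintro ⟨h1, h2, h3⟩ j i hi
    by_cases hj2 : j = 2
    · subst hj2
      by_cases hi2 : i = 2
      · subst hi2; exact (hrow2.2 h3).1
      · exact ((hrow i hi2 hi).2 (h2 i hi2 hi)).1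
    by_cases hj3 : j = 3
    · subst hj3
      rw [hf']
      by_cases hi2 : i = 2
      · subst hi2; exact (hrow2.2 h3).2
      · exact ((hrow i hi2 hi).2 (h2 i hi2 hi)).2
    have hr2 : j.rev ≠ 2 := by revert hj3; revert j; decide
    have hr3 : j.rev ≠ 3 := by revert hj2; revert j; decide
    have := (hcol i j.rev hr2 hr3).2 (h1 i hi _ hr2 hr3)
    rwa [Fin.rev_rev] at this

/-! ### Connectedness of `SU(2,2)` -/

theorem unitary_fromBlocks_iff {A B C D : Matrix (Fin 2) (Fin 2) ℂ} :
    (fromBlocks A B C D)ᴴ * J * fromBlocks A B C D = J ↔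
      Aᴴ * C = Cᴴ * A ∧ Aᴴ * D - Cᴴ * B = 1 ∧ Bᴴ * D = Dᴴ * B := by
  rw [fromBlocks_conjTranspose, J, fromBlocks_multiply, fromBlocks_multiply, fromBlocks_inj]
  simp only [Matrix.mul_zero, Matrix.mul_one, Matrix.mul_neg, zero_add, add_zero, Matrix.neg_mul]
  constructor
  · rintro ⟨h1, h2, -, h4⟩
    refine ⟨?_, ?_, ?_⟩
    · rw [← sub_eq_zero, ← h1]; abel
    · rw [← h2]; abel
    · rw [← sub_eq_zero, ← h4]; abel
  · rintro ⟨h1, h2, h3⟩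
    refine ⟨?_, ?_, ?_, ?_⟩
    · rw [h1]; abel
    · rw [← h2]; abel
    · have := congrArg conjTranspose h2
      simp at this
      rw [← this]; abel
    · rw [h3]; abel

/-- The translation `(1, H; 0, 1)`. -/
def trans (H : Matrix (Fin 2) (Fin 2) ℂ) : Matrix (Fin 2 ⊕ Fin 2) (Fin 2 ⊕ Fin 2) ℂ :=
  fromBlocks 1 H 0 1

/-- The lower triangular unipotent matrix `(1, 0; H, 1)`. -/
def lowTrans (H : Matrix (Fin 2) (Fin 2) ℂ) : Matrix (Fin 2 ⊕ Fin 2) (Fin 2 ⊕ Fin 2) ℂ :=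
  fromBlocks 1 0 H 1

/-- The block diagonal matrix `diag(A, (A⁻¹)ᴴ)`. -/
def levi (A : Matrix (Fin 2) (Fin 2) ℂ) : Matrix (Fin 2 ⊕ Fin 2) (Fin 2 ⊕ Fin 2) ℂ :=
  fromBlocks A 0 0 (A⁻¹)ᴴ

theorem isSU_trans {H : Matrix (Fin 2) (Fin 2) ℂ} (hH : H.IsHermitian) : IsSU (trans H) := by
  refine ⟨by simp [trans], unitary_fromBlocks_iff.2 ?_⟩
  simp [hH.eq]

theorem isSU_lowTrans {H : Matrix (Fin 2) (Fin 2) ℂ} (hH : H.IsHermitian) :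
    IsSU (lowTrans H) := by
  refine ⟨by simp [lowTrans], unitary_fromBlocks_iff.2 ?_⟩
  simp [hH.eq]

theorem conjTranspose_mul_inv {A : Matrix (Fin 2) (Fin 2) ℂ} (hA : A.det ≠ 0) :
    Aᴴ * (A⁻¹)ᴴ = 1 := by
  rw [← conjTranspose_mul, nonsing_inv_mul _ (isUnit_iff_ne_zero.2 hA), conjTranspose_one]

theorem isSU_levi {A : Matrix (Fin 2) (Fin 2) ℂ} (hA : A.det ≠ 0) (hA' : conj A.det = A.det) :
    IsSU (levi A) := by
  refine ⟨?_, unitary_fromBlocks_iff.2 ?_⟩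
  · have := congrArg det (conjTranspose_mul_inv hA)
    rw [det_mul, det_conjTranspose, det_one] at this
    rw [levi, det_fromBlocks_zero₂₁]
    change conj A.det * _ = 1 at this
    rwa [hA'] at this
  · simp [conjTranspose_mul_inv hA]

theorem levi_mul (A B : Matrix (Fin 2) (Fin 2) ℂ) : levi (A * B) = levi A * levi B := by
  simp [levi, fromBlocks_multiply, Matrix.mul_inv_rev]

theorem levi_eq {A B : Matrix (Fin 2) (Fin 2) ℂ} (h : A * B = 1) :
    levi A = fromBlocks A 0 0 Bᴴ := by
  rw [levi, Matrix.inv_eq_right_inv h]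

theorem levi_eq_of_det_one {A : Matrix (Fin 2) (Fin 2) ℂ} (hA : A.det = 1) : levi A =
    fromBlocks A 0 0 !![conj (A 1 1), -conj (A 1 0); -conj (A 0 1), conj (A 0 0)] := by
  rw [det_fin_two] at hA
  rw [levi_eq (B := !![A 1 1, -A 0 1; -A 1 0, A 0 0])]
  · congr 1
    ext i j; fin_cases i <;> fin_cases j <;> simp
  · ext i j
    fin_cases i <;> fin_cases j <;> simp [Matrix.mul_apply] <;>
      first | ring1 | linear_combination hA

/-- `X` lies in the connected component of the identity of `SU(2,2)`. -/
def InComp (X : Matrix (Fin 2 ⊕ Fin 2) (Fin 2 ⊕ Fin 2) ℂ) : Prop :=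
  ∃ h : IsSU X, (⟨⟨X, h.1⟩, h.2⟩ : SU22) ∈ Subgroup.connectedComponentOfOne SU22

theorem InComp.mul {X Y : Matrix (Fin 2 ⊕ Fin 2) (Fin 2 ⊕ Fin 2) ℂ} (hX : InComp X)
    (hY : InComp Y) : InComp (X * Y) := by
  obtain ⟨h, h'⟩ := hX
  obtain ⟨k, k'⟩ := hY
  exact ⟨h.mul k, mul_mem h' k'⟩

theorem InComp.of_path {γ : ℝ → Matrix (Fin 2 ⊕ Fin 2) (Fin 2 ⊕ Fin 2) ℂ} (hγ : Continuous γ)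
    (h : ∀ t, IsSU (γ t)) (h0 : γ 0 = 1) (t : ℝ) : InComp (γ t) := by
  refine ⟨h t, ?_⟩
  let g : ℝ → SU22 := fun t => ⟨⟨γ t, (h t).1⟩, (h t).2⟩
  have hg : Continuous g := Continuous.subtype_mk (Continuous.subtype_mk hγ _) _
  have h1 : g 0 = 1 := Subtype.ext (Subtype.ext h0)
  have := (isPreconnected_range hg).subset_connectedComponent (Set.mem_range_self 0)
  rw [h1] at this
  exact this (Set.mem_range_self t)

theorem inComp_trans {H : Matrix (Fin 2) (Fin 2) ℂ} (hH : H.IsHermitian) : InComp (trans H) := by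
  have := InComp.of_path (γ := fun t => trans ((t : ℂ) • H)) ?_ (fun t => isSU_trans ?_) ?_ 1
  · simpa using this
  · refine Continuous.matrix_fromBlocks ?_ ?_ ?_ ?_ <;> fun_prop
  · rw [IsHermitian, conjTranspose_smul, hH.eq]; simp
  · simp [trans]

theorem inComp_lowTrans {H : Matrix (Fin 2) (Fin 2) ℂ} (hH : H.IsHermitian) :
    InComp (lowTrans H) := by
  have := InComp.of_path (γ := fun t => lowTrans ((t : ℂ) • H)) ?_ (fun t => isSU_lowTrans ?_) ?_ 1
  · simpa using this
  · refine Continuous.matrix_fromBlocks ?_ ?_ ?_ ?_ <;> fun_prop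
  · rw [IsHermitian, conjTranspose_smul, hH.eq]; simp
  · simp [lowTrans]

theorem inComp_levi_upper (x : ℂ) : InComp (levi !![1, x; 0, 1]) := by
  have e (x : ℂ) : levi !![1, x; 0, 1] = fromBlocks !![1, x; 0, 1] 0 0 !![1, -x; 0, 1]ᴴ :=
    levi_eq (by ext i j; fin_cases i <;> fin_cases j <;> simp [Matrix.mul_apply])
  have := InComp.of_path (γ := fun t => levi !![1, (t : ℂ) * x; 0, 1]) ?_
    (fun t => isSU_levi (by simp [det_fin_two]) (by simp [det_fin_two])) ?_ 1
  · simpa using this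
  · simp only [e]
    refine Continuous.matrix_fromBlocks ?_ ?_ ?_ (Continuous.matrix_conjTranspose ?_) <;>
      fun_prop
  · simp [levi, ← one_fin_two]

theorem inComp_levi_lower (x : ℂ) : InComp (levi !![1, 0; x, 1]) := by
  have e (x : ℂ) : levi !![1, 0; x, 1] = fromBlocks !![1, 0; x, 1] 0 0 !![1, 0; -x, 1]ᴴ :=
    levi_eq (by ext i j; fin_cases i <;> fin_cases j <;> simp [Matrix.mul_apply])
  have := InComp.of_path (γ := fun t => levi !![1, 0; (t : ℂ) * x, 1]) ?_
    (fun t => isSU_levi (by simp [det_fin_two]) (by simp [det_fin_two])) ?_ 1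
  · simpa using this
  · simp only [e]
    refine Continuous.matrix_fromBlocks ?_ ?_ ?_ (Continuous.matrix_conjTranspose ?_) <;>
      fun_prop
  · simp [levi, ← one_fin_two]

theorem inComp_levi_scalar {r : ℝ} (hr : 0 < r) : InComp (levi !![(r : ℂ), 0; 0, r]) := by
  have e (t : ℝ) : levi !![(Real.exp t : ℂ), 0; 0, Real.exp t] =
      fromBlocks !![(Real.exp t : ℂ), 0; 0, Real.exp t] 0 0
        !![(Real.exp (-t) : ℂ), 0; 0, Real.exp (-t)]ᴴ := by
    have h : (Real.exp t : ℂ) * Real.exp (-t) = 1 := by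
      rw [← Complex.ofReal_mul, ← Real.exp_add]; simp
    refine levi_eq ?_
    ext i j
    fin_cases i <;> fin_cases j <;> simp [Matrix.mul_apply, -Complex.ofReal_exp, h]
  have := InComp.of_path (γ := fun t => levi !![(Real.exp t : ℂ), 0; 0, Real.exp t]) ?_
    (fun t => isSU_levi ?_ ?_) ?_ (Real.log r)
  · rwa [Real.exp_log hr] at this
  · simp only [e]
    refine Continuous.matrix_fromBlocks ?_ ?_ ?_ (Continuous.matrix_conjTranspose ?_) <;>
      fun_prop
  · simp [det_fin_two]
  · rw [det_fin_two]; simp [-Complex.ofReal_exp]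
  · simp [levi, ← one_fin_two]

theorem inComp_levi_of_det_one {A : Matrix (Fin 2) (Fin 2) ℂ} (hA : A.det = 1) :
    InComp (levi A) := by
  have key {A : Matrix (Fin 2) (Fin 2) ℂ} (hA : A.det = 1) (hc : A 1 0 ≠ 0) : InComp (levi A) := by
    have e : A = !![1, (A 0 0 - 1) / A 1 0; 0, 1] * !![1, 0; A 1 0, 1] *
        !![1, (A 1 1 - 1) / A 1 0; 0, 1] := by
      rw [det_fin_two] at hA
      ext i j
      fin_cases i <;> fin_cases j <;> simp [Matrix.mul_apply] <;> field_simp <;>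
        first | ring1 | linear_combination hA | linear_combination -hA
    rw [e, levi_mul, levi_mul]
    exact ((inComp_levi_upper _).mul (inComp_levi_lower _)).mul (inComp_levi_upper _)
  by_cases hc : A 1 0 = 0
  · have e : A = (A * !![1, 0; 1, 1]) * !![1, 0; -1, 1] := by
      rw [Matrix.mul_assoc]
      have : (!![1, 0; 1, 1] : Matrix (Fin 2) (Fin 2) ℂ) * !![1, 0; -1, 1] = 1 := by
        ext i j; fin_cases i <;> fin_cases j <;> simp [Matrix.mul_apply]
      rw [this, Matrix.mul_one]
    rw [e, levi_mul]
    refine (key ?_ ?_).mul (inComp_levi_lower _)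
    · rw [det_mul, hA]; simp [det_fin_two]
    · rw [det_fin_two, hc] at hA
      simp [Matrix.mul_apply, hc]
      rintro h; simp [h] at hA
  · exact key hA hc

theorem isHermitian_diag (a b : ℝ) : (!![(a : ℂ), 0; 0, b]).IsHermitian := by
  apply isHermitian_of_conj <;> simp

/-- `diag(1, -1, 1, -1)` is the square of the Weyl element in the second coordinate, which is a
product of three unipotent matrices. -/
theorem inComp_levi_diag : InComp (levi !![1, 0; 0, -1]) := by
  have h1 : InComp (trans !![0, 0; 0, 1]) := by
    simpa using inComp_trans (isHermitian_diag 0 1)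
  have h2 : InComp (lowTrans !![0, 0; 0, -1]) := by
    simpa using inComp_lowTrans (isHermitian_diag 0 (-1))
  have h3 := (h1.mul h2).mul h1
  convert h3.mul h3
  rw [levi_eq (B := !![1, 0; 0, -1])]
  · simp only [trans, lowTrans, fromBlocks_multiply, one_fin_two]
    congr 1 <;> ext i j <;> fin_cases i <;> fin_cases j <;> simp
  · ext i j; fin_cases i <;> fin_cases j <;> simp [Matrix.mul_apply]

theorem inComp_levi {A : Matrix (Fin 2) (Fin 2) ℂ} (hA : A.det ≠ 0) (hA' : conj A.det = A.det) :
    InComp (levi A) := by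
  have key {A : Matrix (Fin 2) (Fin 2) ℂ} {d : ℝ} (hA : A.det = d) (hd : 0 < d) :
      InComp (levi A) := by
    have hs := Real.sqrt_pos.2 hd
    have hs' : ((Real.sqrt d : ℝ) : ℂ) ≠ 0 := by exact_mod_cast hs.ne'
    have e : A = !![((Real.sqrt d : ℝ) : ℂ), 0; 0, ((Real.sqrt d : ℝ) : ℂ)] *
        ((((Real.sqrt d : ℝ) : ℂ)⁻¹) • A) := by
      ext i j
      fin_cases i <;> fin_cases j <;> simp [Matrix.mul_apply, hs']
    rw [e, levi_mul]
    refine (inComp_levi_scalar hs).mul (inComp_levi_of_det_one ?_)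
    have h2 : ((Real.sqrt d : ℝ) : ℂ) ^ 2 = d := by
      exact_mod_cast congrArg Complex.ofReal (Real.sq_sqrt hd.le)
    have hd' : (d : ℂ) ≠ 0 := by exact_mod_cast hd.ne'
    rw [det_smul, hA, Fintype.card_fin, inv_pow, h2, inv_mul_cancel₀ hd']
  rw [Complex.conj_eq_iff_re] at hA'
  have h0 : A.det.re ≠ 0 := fun h => hA (by rw [← hA', h]; simp)
  rcases lt_or_gt_of_ne h0 with h | h
  · have e : A = (A * !![1, 0; 0, -1]) * !![1, 0; 0, -1] := by
      rw [Matrix.mul_assoc]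
      have : (!![1, 0; 0, -1] : Matrix (Fin 2) (Fin 2) ℂ) * !![1, 0; 0, -1] = 1 := by
        ext i j; fin_cases i <;> fin_cases j <;> simp [Matrix.mul_apply]
      rw [this, Matrix.mul_one]
    rw [e, levi_mul]
    refine (key (d := -A.det.re) ?_ (neg_pos.2 h)).mul inComp_levi_diag
    rw [det_mul, ← hA']
    simp [det_fin_two]
  · exact key hA'.symm h

/-- The matrix `A + i C` is invertible, since `(A + i C)ᴴ (A + i C) = Aᴴ A + Cᴴ C`. -/
theorem det_add_I_smul_ne_zero {A B C D : Matrix (Fin 2) (Fin 2) ℂ} (h1 : Aᴴ * C = Cᴴ * A)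
    (h2 : Aᴴ * D - Cᴴ * B = 1) : (A + Complex.I • C).det ≠ 0 := by
  intro h
  obtain ⟨v, hv, h0⟩ := Matrix.exists_mulVec_eq_zero_iff.2 h
  apply hv
  have e : (A + Complex.I • C)ᴴ * (A + Complex.I • C) = Aᴴ * A + Cᴴ * C := by
    rw [conjTranspose_add, conjTranspose_smul, Matrix.add_mul, Matrix.mul_add, Matrix.mul_add,
      Matrix.mul_smul, Matrix.smul_mul, Matrix.smul_mul, Matrix.mul_smul, h1, smul_smul]
    simp
  have h3 : star (A *ᵥ v) ⬝ᵥ (A *ᵥ v) + star (C *ᵥ v) ⬝ᵥ (C *ᵥ v) = 0 := by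
    have : star v ⬝ᵥ (((A + Complex.I • C)ᴴ * (A + Complex.I • C)) *ᵥ v) = 0 := by
      rw [← mulVec_mulVec, h0, mulVec_zero, dotProduct_zero]
    have e1 (M : Matrix (Fin 2) (Fin 2) ℂ) :
        star v ⬝ᵥ (Mᴴ * M) *ᵥ v = star (M *ᵥ v) ⬝ᵥ (M *ᵥ v) := by
      rw [← mulVec_mulVec, dotProduct_mulVec, star_mulVec]
    rwa [e, add_mulVec, dotProduct_add, e1, e1] at this
  have h4 : ∀ w : Fin 2 → ℂ, star w ⬝ᵥ w =
      ((Complex.normSq (w 0) + Complex.normSq (w 1) : ℝ) : ℂ) := by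
    intro w
    simp [dotProduct, Complex.normSq_eq_conj_mul_self]
  rw [h4, h4, ← Complex.ofReal_add, Complex.ofReal_eq_zero] at h3
  have hz {w : Fin 2 → ℂ} (h : Complex.normSq (w 0) = 0) (h' : Complex.normSq (w 1) = 0) :
      w = 0 := by
    ext i
    fin_cases i
    exacts [Complex.normSq_eq_zero.1 h, Complex.normSq_eq_zero.1 h']
  have a0 := Complex.normSq_nonneg ((A *ᵥ v) 0)
  have a1 := Complex.normSq_nonneg ((A *ᵥ v) 1)
  have c0 := Complex.normSq_nonneg ((C *ᵥ v) 0)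
  have c1 := Complex.normSq_nonneg ((C *ᵥ v) 1)
  have hAv : A *ᵥ v = 0 := hz (by linarith) (by linarith)
  have hCv : C *ᵥ v = 0 := hz (by linarith) (by linarith)
  have h5 := congrArg conjTranspose h2
  rw [conjTranspose_sub, conjTranspose_mul, conjTranspose_mul, conjTranspose_conjTranspose,
    conjTranspose_conjTranspose, conjTranspose_one] at h5
  rw [← one_mulVec v, ← h5, sub_mulVec, ← mulVec_mulVec, ← mulVec_mulVec, hAv, hCv]
  simp

/-- `det (A + z C)` is a polynomial in `z` of degree at most two: if it vanished at `0`, `1` and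
`-1`, it would vanish at `i`. -/
theorem exists_real_det_ne_zero {A C : Matrix (Fin 2) (Fin 2) ℂ}
    (h : (A + Complex.I • C).det ≠ 0) : ∃ z : ℝ, (A + (z : ℂ) • C).det ≠ 0 := by
  by_contra! hz
  apply h
  have h0 := hz 0
  have h1 := hz 1
  have h2 := hz (-1)
  simp [det_fin_two] at h0 h1 h2 ⊢
  linear_combination (1 - Complex.I ^ 2) * h0 + (Complex.I ^ 2 + Complex.I) / 2 * h1 +
    (Complex.I ^ 2 - Complex.I) / 2 * h2

/-- `SU(2,2)` is connected: after a translation by a real scalar the upper left block is invertible,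
and then the matrix is a product of a lower translation, an upper translation and a Levi matrix. -/
theorem inComp_of_isSU {X : Matrix (Fin 2 ⊕ Fin 2) (Fin 2 ⊕ Fin 2) ℂ} (hX : IsSU X) :
    InComp X := by
  have upper {A B D : Matrix (Fin 2) (Fin 2) ℂ} (h : IsSU (fromBlocks A B 0 D)) :
      InComp (fromBlocks A B 0 D) := by
    obtain ⟨-, h2, h3⟩ := unitary_fromBlocks_iff.1 h.2
    have hd := h.1
    simp at h2
    have h2d := congrArg det h2
    rw [det_mul, det_conjTranspose, det_one] at h2d
    change conj A.det * _ = 1 at h2d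
    rw [det_fromBlocks_zero₂₁] at hd
    have hD : D.det ≠ 0 := right_ne_zero_of_mul_eq_one hd
    have hA : A.det ≠ 0 := left_ne_zero_of_mul_eq_one hd
    have hD' : D = (A⁻¹)ᴴ := by
      have e : (A⁻¹)ᴴ * Aᴴ = 1 := mul_eq_one_comm.1 (conjTranspose_mul_inv hA)
      rw [← Matrix.one_mul D, ← e, Matrix.mul_assoc, h2, Matrix.mul_one]
    have h2' : Dᴴ * A = 1 := by
      have := congrArg conjTranspose h2
      simpa using this
    have e : fromBlocks A B 0 D = trans (B * Aᴴ) * levi A := by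
      rw [trans, levi, fromBlocks_multiply, ← hD']
      simp [Matrix.mul_assoc, h2]
    rw [e]
    refine (inComp_trans ?_).mul (inComp_levi hA ?_)
    · rw [IsHermitian, conjTranspose_mul, conjTranspose_conjTranspose]
      have h4 : A * Dᴴ = 1 := mul_eq_one_comm.1 h2'
      calc A * Bᴴ = A * (Bᴴ * (D * Aᴴ)) := by rw [mul_eq_one_comm.1 h2, Matrix.mul_one]
        _ = A * (Bᴴ * D) * Aᴴ := by simp only [Matrix.mul_assoc]
        _ = (A * Dᴴ) * B * Aᴴ := by rw [h3]; simp only [Matrix.mul_assoc]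
        _ = B * Aᴴ := by rw [h4, Matrix.one_mul]
    · exact mul_right_cancel₀ hD (h2d.trans hd.symm)
  have inv {A B C D : Matrix (Fin 2) (Fin 2) ℂ} (h : IsSU (fromBlocks A B C D)) (hA : A.det ≠ 0) :
      InComp (fromBlocks A B C D) := by
    obtain ⟨h1, h2, h3⟩ := unitary_fromBlocks_iff.1 h.2
    have hAu := isUnit_iff_ne_zero.2 hA
    have hC : C * A⁻¹ * A = C := by rw [Matrix.mul_assoc, nonsing_inv_mul _ hAu, Matrix.mul_one]
    have hH : (C * A⁻¹).IsHermitian := by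
      have e : (A⁻¹)ᴴ * Aᴴ = 1 := mul_eq_one_comm.1 (conjTranspose_mul_inv hA)
      rw [IsHermitian, conjTranspose_mul]
      calc (A⁻¹)ᴴ * Cᴴ = (A⁻¹)ᴴ * (Cᴴ * A) * A⁻¹ := by
            rw [Matrix.mul_assoc, Matrix.mul_assoc, mul_nonsing_inv _ hAu, Matrix.mul_one]
        _ = ((A⁻¹)ᴴ * Aᴴ) * C * A⁻¹ := by rw [← h1]; simp only [Matrix.mul_assoc]
        _ = C * A⁻¹ := by rw [e, Matrix.one_mul]
    have e : fromBlocks A B C D = lowTrans (C * A⁻¹) *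
        fromBlocks A B 0 (D - C * A⁻¹ * B) := by
      rw [lowTrans, fromBlocks_multiply]
      simp [hC]
    have e' : fromBlocks A B 0 (D - C * A⁻¹ * B) =
        lowTrans (-(C * A⁻¹)) * fromBlocks A B C D := by
      rw [lowTrans, fromBlocks_multiply]
      simp [hC, sub_eq_neg_add]
    rw [e]
    refine (inComp_lowTrans hH).mul (upper ?_)
    rw [e']
    exact (isSU_lowTrans hH.neg).mul h
  obtain ⟨A, B, C, D, rfl⟩ : ∃ A B C D, X = fromBlocks A B C D :=
    ⟨_, _, _, _, (fromBlocks_toBlocks X).symm⟩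
  obtain ⟨h1, h2, h3⟩ := unitary_fromBlocks_iff.1 hX.2
  obtain ⟨z, hz⟩ := exists_real_det_ne_zero (det_add_I_smul_ne_zero h1 h2)
  have hH (z : ℝ) : ((z : ℂ) • (1 : Matrix (Fin 2) (Fin 2) ℂ)).IsHermitian := by
    rw [IsHermitian, conjTranspose_smul, conjTranspose_one]; simp
  have e : fromBlocks A B C D = trans (((-z : ℝ) : ℂ) • (1 : Matrix (Fin 2) (Fin 2) ℂ)) *
      (trans ((z : ℂ) • (1 : Matrix (Fin 2) (Fin 2) ℂ)) * fromBlocks A B C D) := by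
    simp [trans, fromBlocks_multiply]
  rw [e]
  refine (inComp_trans (hH _)).mul ?_
  have hs := (isSU_trans (hH z)).mul hX
  have e2 : trans ((z : ℂ) • (1 : Matrix (Fin 2) (Fin 2) ℂ)) * fromBlocks A B C D =
      fromBlocks (A + (z : ℂ) • C) (B + (z : ℂ) • D) C D := by
    simp [trans, fromBlocks_multiply]
  rw [e2] at hs ⊢
  exact inv hs hz

/-! ### The image of `SU(2,2)` lies in the identity component -/

theorem connectedComponentOfOne_SU22 : Subgroup.connectedComponentOfOne SU22 = ⊤ :=
  (Subgroup.eq_top_iff' _).2 fun g => (inComp_of_isSU (X := g.1.1) ⟨g.1.2, g.2⟩).2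

theorem isPreconnected_univ_SU22 : IsPreconnected (Set.univ : Set SU22) := by
  have h : (Set.univ : Set SU22) = connectedComponent 1 := by
    have := congrArg (fun H : Subgroup SU22 => (H : Set SU22)) connectedComponentOfOne_SU22
    exact this.symm
  rw [h]
  exact isPreconnected_connectedComponent

theorem continuous_ortho (m : ℕ) : Continuous (ortho m) := by
  have h1 : Continuous extSq := by
    refine continuous_matrix fun i j => ?_
    simp only [extSq, of_apply, minor]
    fun_prop
  have h2 : Continuous fun X => extSq X * coordMat m := h1.matrix_mul continuous_const
  have h3 (i j) : Continuous fun X => (extSq X * coordMat m) i j := h2.matrix_elem i j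
  refine continuous_matrix fun i j => ?_
  have hr (i) := Complex.continuous_re.comp (h3 i j)
  have hi (i) := Complex.continuous_im.comp (h3 i j)
  fin_cases i
  · exact hr 0
  · exact hr 1
  · exact (hr 2).sub (((hi 2).div_const _).mul_const _)
  · exact (hi 2).div_const _
  · exact hr 4
  · exact hr 5

theorem det_S₁_ne_zero {m : ℕ} (hm : m ≠ 0) : ((S₁ m).map (Int.cast : ℤ → ℝ)).det ≠ 0 := by
  obtain ⟨D, hD⟩ := exists_S₁_mul_eq_one hm
  have := congrArg det hD
  rw [det_mul, det_one] at this
  exact left_ne_zero_of_mul_eq_one this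

theorem det_ortho {m : ℕ} (hm : m ≠ 0) {X : Matrix (Fin 2 ⊕ Fin 2) (Fin 2 ⊕ Fin 2) ℂ}
    (hX : IsSU X) : (ortho m X).det = 1 := by
  have hsq {X} (hX : IsSU X) : (ortho m X).det = 1 ∨ (ortho m X).det = -1 := by
    have := congrArg det (ortho_form hm hX)
    rw [det_mul, det_mul, det_transpose] at this
    have h0 := det_S₁_ne_zero hm
    have h1 : (ortho m X).det * (ortho m X).det = 1 := by
      apply mul_right_cancel₀ h0
      linear_combination this
    exact mul_self_eq_one_iff.1 h1
  refine (hsq hX).resolve_right fun hneg => ?_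
  let g : SU22 → ℝ := fun Y => (ortho m Y.1.1).det
  have hg : Continuous g := ((continuous_ortho m).comp
    (continuous_subtype_val.comp continuous_subtype_val)).matrix_det
  have h1 : g 1 = 1 := by
    change (ortho m 1).det = 1
    rw [ortho_one hm, det_one]
  have h2 : g ⟨⟨X, hX.1⟩, hX.2⟩ = -1 := hneg
  have := isPreconnected_univ_SU22.intermediate_value (Set.mem_univ (⟨⟨X, hX.1⟩, hX.2⟩ : SU22))
    (Set.mem_univ 1) hg.continuousOn
  rw [h1, h2] at this
  obtain ⟨Y, -, hY⟩ := this (show (0 : ℝ) ∈ Set.Icc (-1) 1 by simp)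
  rcases hsq (X := Y.1.1) ⟨Y.1.2, Y.2⟩ with h | h
  · exact one_ne_zero (h.symm.trans hY)
  · exact neg_ne_zero.2 one_ne_zero (h.symm.trans hY)

theorem ortho_mem_specialOrthogonal₀ {m : ℕ} (hm : m ≠ 0)
    {X : Matrix (Fin 2 ⊕ Fin 2) (Fin 2 ⊕ Fin 2) ℂ} (hX : IsSU X) :
    (⟨ortho m X, det_ortho hm hX⟩ : SpecialLinearGroup (Fin 6) ℝ) ∈ specialOrthogonal₀ (S₁ m) := by
  let g : SU22 → specialOrthogonal (S₁ m) := fun Y =>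
    ⟨⟨ortho m Y.1.1, det_ortho hm ⟨Y.1.2, Y.2⟩⟩, ortho_form hm ⟨Y.1.2, Y.2⟩⟩
  have hg : Continuous g := Continuous.subtype_mk (Continuous.subtype_mk ((continuous_ortho m).comp
    (continuous_subtype_val.comp continuous_subtype_val)) _) _
  have h1 : g 1 = 1 := Subtype.ext (Subtype.ext (ortho_one hm))
  have h2 := (isPreconnected_univ_SU22.image g hg.continuousOn).subset_connectedComponent
    (Set.mem_image_of_mem g (Set.mem_univ 1))
  rw [h1] at h2
  exact ⟨g ⟨⟨X, hX.1⟩, hX.2⟩, h2 (Set.mem_image_of_mem g (Set.mem_univ _)), rfl⟩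

/-! ### Positivity on the identity component -/

/-- The basis `(1, 0, 1)`, `(0, I, 0)` of a maximal positive definite subspace. -/
def posFrame : Matrix (Fin 2) (Fin 6) ℝ := !![1, 0, 0, 0, 0, 1; 0, 1, 0, 0, 1, 0]

/-- The Gram matrix `(fᵢ, U fⱼ)` for the basis `f₁, f₂` of a maximal positive definite subspace. -/
def posGram (m : ℕ) (U : Matrix (Fin 6) (Fin 6) ℝ) : Matrix (Fin 2) (Fin 2) ℝ :=
  posFrame * ((S₁ m).map (Int.cast : ℤ → ℝ) * U) *
    posFrameᵀ

theorem S₁_pairing (m : ℕ) (v w : Fin 6 → ℝ) : v ⬝ᵥ ((S₁ m).map (Int.cast : ℤ → ℝ) *ᵥ w) =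
    v 0 * w 5 + v 5 * w 0 + v 1 * w 4 + v 4 * w 1
      - 2 * ((v 2 + v 3 * omega m) * conj (w 2 + w 3 * omega m)).re := by
  have tr : (omegaTr m : ℝ) = 2 * (omega m).re := by
    have := congrArg Complex.re (omega_add_conj m)
    simp at this
    linarith
  have nm : (omegaNm m : ℝ) = (omega m).re ^ 2 + (omega m).im ^ 2 := by
    have := congrArg Complex.re (omega_mul_conj m)
    simp at this
    linarith
  rw [S₁_eq]
  simp [dotProduct, mulVec, Fin.sum_univ_six, tr, nm]
  ring

theorem S₁_quadratic (m : ℕ) (w : Fin 6 → ℝ) : w ⬝ᵥ ((S₁ m).map (Int.cast : ℤ → ℝ) *ᵥ w) =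
    2 * (w 0 * w 5 + w 1 * w 4 - Complex.normSq (w 2 + w 3 * omega m)) := by
  rw [S₁_pairing, Complex.mul_conj, Complex.ofReal_re]
  ring

/-- A vector orthogonal to a maximal positive definite subspace is not positive, whereas an isometry
maps the subspace to positive vectors. -/
theorem det_posGram_ne_zero (m : ℕ) {U : Matrix (Fin 6) (Fin 6) ℝ}
    (hU : Uᵀ * (S₁ m).map (Int.cast : ℤ → ℝ) * U = (S₁ m).map (Int.cast : ℤ → ℝ)) :
    (posGram m U).det ≠ 0 := by
  intro h
  obtain ⟨c, hc, h0⟩ := Matrix.exists_mulVec_eq_zero_iff.2 h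
  set S := (S₁ m).map (Int.cast : ℤ → ℝ) with hS
  set p : Fin 6 → ℝ := posFrameᵀ *ᵥ c with hp
  set w := U *ᵥ p with hw
  have h1 : posFrame *ᵥ (S *ᵥ w) = (0 : Fin 2 → ℝ) := by
    rw [← h0, posGram, ← mulVec_mulVec, ← mulVec_mulVec, ← mulVec_mulVec]
  have h2 : w ⬝ᵥ (S *ᵥ w) = p ⬝ᵥ (S *ᵥ p) := by
    conv_rhs => rw [← hU]
    rw [← mulVec_mulVec, ← mulVec_mulVec, dotProduct_mulVec p, vecMul_transpose]
  have e0 : w 0 + w 5 = 0 := by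
    have := congrFun h1 0
    rw [hS, S₁_eq] at this
    simp [posFrame, mulVec, dotProduct, Fin.sum_univ_six] at this
    linarith
  have e1 : w 1 + w 4 = 0 := by
    have := congrFun h1 1
    rw [hS, S₁_eq] at this
    simp [posFrame, mulVec, dotProduct, Fin.sum_univ_six] at this
    linarith
  rw [hS, S₁_quadratic, S₁_quadratic] at h2
  have e2 : p 0 = c 0 ∧ p 1 = c 1 ∧ p 2 = 0 ∧ p 3 = 0 ∧ p 4 = c 1 ∧ p 5 = c 0 := by
    simp [hp, posFrame, mulVec, dotProduct, Fin.sum_univ_two, transpose_apply]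
  obtain ⟨p0, p1, p2, p3, p4, p5⟩ := e2
  rw [p0, p1, p2, p3, p4, p5] at h2
  have h3 := Complex.normSq_nonneg (w 2 + w 3 * omega m)
  have e5 : w 5 = -w 0 := by linarith
  have e4 : w 4 = -w 1 := by linarith
  rw [e5, e4] at h2
  simp at h2
  apply hc
  ext i
  fin_cases i
  · change c 0 = 0
    nlinarith [sq_nonneg (w 0), sq_nonneg (w 1), sq_nonneg (c 0), sq_nonneg (c 1)]
  · change c 1 = 0
    nlinarith [sq_nonneg (w 0), sq_nonneg (w 1), sq_nonneg (c 0), sq_nonneg (c 1)]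

/-- The determinant of `posGram` never vanishes on the orthogonal group and is `4` at the
identity. -/
theorem det_posGram_pos {m : ℕ} {U : SpecialLinearGroup (Fin 6) ℝ}
    (hU : U ∈ specialOrthogonal₀ (S₁ m)) : 0 < (posGram m U).det := by
  obtain ⟨V, hV, rfl⟩ := hU
  let g : specialOrthogonal (S₁ m) → ℝ := fun V => (posGram m V.1.1).det
  have hg : Continuous g := by
    have h1 : Continuous fun V : specialOrthogonal (S₁ m) => V.1.1 :=
      continuous_subtype_val.comp continuous_subtype_val
    exact (((continuous_const.matrix_mul (continuous_const.matrix_mul h1)).matrix_mul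
      continuous_const)).matrix_det
  have h0 (V) : g V ≠ 0 := det_posGram_ne_zero m V.2
  have h1 : g 1 = 4 := by
    change (posGram m 1).det = 4
    rw [posGram, S₁_eq, Matrix.mul_one, det_fin_two]
    simp [posFrame, Matrix.mul_apply, Fin.sum_univ_six, vecMul, dotProduct]
    norm_num
  by_contra hneg
  have := isPreconnected_connectedComponent.intermediate_value hV mem_connectedComponent
    hg.continuousOn
  obtain ⟨Y, -, hY⟩ := this (show (0 : ℝ) ∈ Set.Icc (g V) (g 1) from
    ⟨not_lt.1 hneg, by rw [h1]; norm_num⟩)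
  exact h0 Y hY

/-! ### Surjectivity of `SL₂(ℂ)` onto the stabilizer of a hyperbolic plane -/

theorem extSq_levi {A : Matrix (Fin 2) (Fin 2) ℂ} (hA : A.det = 1) : extSq (levi A) =
    !![1, 0, 0, 0, 0, 0;
       0, A 0 0 * conj (A 0 0), A 0 0 * conj (A 0 1), A 0 1 * conj (A 0 0),
        A 0 1 * conj (A 0 1), 0;
       0, A 0 0 * conj (A 1 0), A 0 0 * conj (A 1 1), A 0 1 * conj (A 1 0),
        A 0 1 * conj (A 1 1), 0;
       0, A 1 0 * conj (A 0 0), A 1 0 * conj (A 0 1), A 1 1 * conj (A 0 0),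
        A 1 1 * conj (A 0 1), 0;
       0, A 1 0 * conj (A 1 0), A 1 0 * conj (A 1 1), A 1 1 * conj (A 1 0),
        A 1 1 * conj (A 1 1), 0;
       0, 0, 0, 0, 0, 1] := by
  have hd := hA
  rw [det_fin_two] at hd
  have hd' := congrArg conj hd
  simp at hd'
  rw [levi_eq_of_det_one hA]
  ext i j
  fin_cases i <;> fin_cases j <;> simp [extSq, minor, fstIdx, sndIdx] <;>
    first | ring1 | linear_combination hd | linear_combination -hd | linear_combination hd'

/-- A Hermitian matrix of determinant zero is `± v vᴴ`. -/
theorem exists_eq_vecMulVec {a b : ℝ} {t : ℂ} (h : a * b = Complex.normSq t) :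
    ∃ (ε : ℝ) (v w : ℂ), (ε = 1 ∨ ε = -1) ∧ a = ε * Complex.normSq v ∧
      b = ε * Complex.normSq w ∧ t = ε * (v * conj w) := by
  have key {a b : ℝ} {t : ℂ} (h : a * b = Complex.normSq t) (ha : 0 ≤ a) (hb : 0 ≤ b) :
      ∃ v w : ℂ, a = Complex.normSq v ∧ b = Complex.normSq w ∧ t = v * conj w := by
    rcases ha.eq_or_lt with rfl | ha
    · rw [zero_mul] at h
      have ht := Complex.normSq_eq_zero.1 h.symm
      refine ⟨0, Real.sqrt b, by simp, ?_, by simp [ht]⟩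
      rw [Complex.normSq_ofReal, Real.mul_self_sqrt hb]
    · have hs : Real.sqrt a * Real.sqrt a = a := Real.mul_self_sqrt ha.le
      have hs' : ((Real.sqrt a : ℝ) : ℂ) ≠ 0 := by exact_mod_cast (Real.sqrt_pos.2 ha).ne'
      refine ⟨Real.sqrt a, conj t / Real.sqrt a, ?_, ?_, ?_⟩
      · rw [Complex.normSq_ofReal, hs]
      · rw [Complex.normSq_div, Complex.normSq_conj, Complex.normSq_ofReal, hs, ← h]
        field_simp
      · simp
        field_simp
  by_cases hp : 0 ≤ a ∧ 0 ≤ b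
  · obtain ⟨v, w, h1, h2, h3⟩ := key h hp.1 hp.2
    exact ⟨1, v, w, Or.inl rfl, by simpa using h1, by simpa using h2, by simpa using h3⟩
  · have h0 : 0 ≤ a * b := h ▸ Complex.normSq_nonneg t
    have hn : 0 ≤ -a ∧ 0 ≤ -b := by
      rcases mul_nonneg_iff.1 h0 with h1 | h1
      · exact absurd h1 hp
      · exact ⟨neg_nonneg.2 h1.1, neg_nonneg.2 h1.2⟩
    obtain ⟨v, w, h1, h2, h3⟩ := key (t := -t)
      (by rw [neg_mul_neg, h, Complex.normSq_neg]) hn.1 hn.2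
    refine ⟨-1, v, w, Or.inr rfl, by linarith, by linarith, ?_⟩
    rw [← h3]; simp

/-- Two Hermitian matrices of determinant zero whose polar determinant is `1` and whose sum has
positive trace are `A E₁₁ Aᴴ` and `A E₂₂ Aᴴ` for a matrix `A ∈ SL₂(ℂ)`. -/
theorem exists_det_one_of_rank_one {a b a' b' : ℝ} {t t' : ℂ} (h : a * b = Complex.normSq t)
    (h' : a' * b' = Complex.normSq t') (hp : a * b' + b * a' - 2 * (t * conj t').re = 1)
    (htr : 0 < a + b + a' + b') : ∃ A : Matrix (Fin 2) (Fin 2) ℂ, A.det = 1 ∧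
      a = A 0 0 * conj (A 0 0) ∧ b = A 1 0 * conj (A 1 0) ∧ t = A 0 0 * conj (A 1 0) ∧
      a' = A 0 1 * conj (A 0 1) ∧ b' = A 1 1 * conj (A 1 1) ∧ t' = A 0 1 * conj (A 1 1) := by
  obtain ⟨ε, v, w, hε, rfl, rfl, rfl⟩ := exists_eq_vecMulVec h
  obtain ⟨ε', v', w', hε', rfl, rfl, rfl⟩ := exists_eq_vecMulVec h'
  have hd : ε * ε' * Complex.normSq (v * w' - w * v') = 1 := by
    rw [← hp]
    simp [Complex.normSq_apply]
    ring
  have n0 := Complex.normSq_nonneg (v * w' - w * v')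
  have n1 := Complex.normSq_nonneg v
  have n2 := Complex.normSq_nonneg w
  have n3 := Complex.normSq_nonneg v'
  have n4 := Complex.normSq_nonneg w'
  have hee : ε = 1 ∧ ε' = 1 := by
    rcases hε with rfl | rfl <;> rcases hε' with rfl | rfl
    · exact ⟨rfl, rfl⟩
    · linarith
    · linarith
    · linarith
  obtain ⟨rfl, rfl⟩ := hee
  rw [one_mul, one_mul] at hd
  set d := v * w' - w * v' with hd'
  have hdd : d * conj d = 1 := by rw [Complex.mul_conj, hd, Complex.ofReal_one]
  refine ⟨!![v, conj d * v'; w, conj d * w'], ?_, ?_, ?_, ?_, ?_, ?_, ?_⟩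
  · rw [det_fin_two, ← hdd, hd']
    simp; ring
  · simp [Complex.mul_conj]
  · simp [Complex.mul_conj]
  · simp
  · simp only [one_mul, ← Complex.mul_conj]
    simp
    linear_combination -(v' * conj v') * hdd
  · simp only [one_mul, ← Complex.mul_conj]
    simp
    linear_combination -(w' * conj w') * hdd
  · simp
    linear_combination -(v' * conj w') * hdd

theorem form_apply {m : ℕ} {V : Matrix (Fin 6) (Fin 6) ℝ}
    (hV : Vᵀ * (S₁ m).map (Int.cast : ℤ → ℝ) * V = (S₁ m).map (Int.cast : ℤ → ℝ)) (i j : Fin 6) :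
    V 0 i * V 5 j + V 5 i * V 0 j + V 1 i * V 4 j + V 4 i * V 1 j
      - 2 * ((V 2 i + V 3 i * omega m) * conj (V 2 j + V 3 j * omega m : ℂ)).re = S₁ m i j := by
  have h1 := congrFun (congrFun hV i) j
  have h2 := S₁_pairing m (fun k => V k i) (fun k => V k j)
  rw [← h2, ← Int.cast_id (n := S₁ m i j)]
  rw [Matrix.map_apply] at h1
  rw [Int.cast_id, ← h1, Matrix.mul_assoc, Matrix.mul_apply]
  simp only [Matrix.mul_apply, dotProduct, mulVec, transpose_apply]

theorem conj_mul_eq_of_re_of_normSq {z w : ℂ} {c : ℂ} (h1 : Complex.normSq z = 1)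
    (hre : (z * conj w).re = c.re) (him : (conj z * w).im = c.im) : w = z * c := by
  have h2 : conj z * w = c := by
    apply Complex.ext
    · rw [← hre]; simp
    · exact him
  have h3 : z * conj z = 1 := by rw [Complex.mul_conj, h1, Complex.ofReal_one]
  rw [← h2]
  linear_combination -w * h3

/-- An isometry fixing the basis vectors of both hyperbolic planes is a rotation of the remaining
definite plane, which comes from a diagonal matrix in `SL₂(ℂ)`. -/
theorem exists_levi_of_fix_four {m : ℕ} (hm : m ≠ 0) {V : Matrix (Fin 6) (Fin 6) ℝ}
    (hV : Vᵀ * (S₁ m).map (Int.cast : ℤ → ℝ) * V = (S₁ m).map (Int.cast : ℤ → ℝ))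
    (hd : V.det = 1) (hc : ∀ j, j ≠ 2 → j ≠ 3 → ∀ i, V i j = (1 : Matrix (Fin 6) (Fin 6) ℝ) i j) :
    ∃ A : Matrix (Fin 2) (Fin 2) ℂ, A.det = 1 ∧ ortho m (levi A) = V := by
  have hf := form_apply hV
  have c0 := hc 0 (by decide) (by decide)
  have c1 := hc 1 (by decide) (by decide)
  have c4 := hc 4 (by decide) (by decide)
  have c5 := hc 5 (by decide) (by decide)
  have r0 (j) : V 5 j = S₁ m 0 j := by rw [← hf 0 j]; simp [c0]
  have r5 (j) : V 0 j = S₁ m 5 j := by rw [← hf 5 j]; simp [c5]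
  have r1 (j) : V 4 j = S₁ m 1 j := by rw [← hf 1 j]; simp [c1]
  have r4 (j) : V 1 j = S₁ m 4 j := by rw [← hf 4 j]; simp [c4]
  have eV : V = !![1, 0, 0, 0, 0, 0;
                   0, 1, 0, 0, 0, 0;
                   0, 0, V 2 2, V 2 3, 0, 0;
                   0, 0, V 3 2, V 3 3, 0, 0;
                   0, 0, 0, 0, 1, 0;
                   0, 0, 0, 0, 0, 1] := by
    ext i j
    fin_cases i <;> fin_cases j <;> simp [r0, r5, r1, r4, c0, c1, c4, c5, S₁_eq]
  have hdet : V 2 2 * V 3 3 - V 2 3 * V 3 2 = 1 := by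
    rw [← hd, eV]
    simp [det_succ_row_zero, Fin.sum_univ_succ, Fin.succAbove]
    ring
  have tr : (omegaTr m : ℝ) = 2 * (omega m).re := by
    have := congrArg Complex.re (omega_add_conj m)
    simp at this
    linarith
  have hS : S₁ m 0 2 = 0 ∧ S₁ m 0 3 = 0 ∧ S₁ m 5 2 = 0 ∧ S₁ m 5 3 = 0 ∧ S₁ m 1 2 = 0 ∧
      S₁ m 1 3 = 0 ∧ S₁ m 4 2 = 0 ∧ S₁ m 4 3 = 0 ∧ S₁ m 2 2 = -2 ∧ S₁ m 2 3 = -omegaTr m := by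
    rw [S₁_eq]
    simp
  obtain ⟨s1, s2, s3, s4, s5, s6, s7, s8, s9, s10⟩ := hS
  have h22 := hf 2 2
  have h23 := hf 2 3
  rw [r0, r5, r1, r4, s1, s3, s5, s7, s9] at h22
  rw [r0, r0, r5, r5, r1, r1, r4, r4, s1, s2, s3, s4, s5, s6, s7, s8, s10] at h23
  set z : ℂ := V 2 2 + V 3 2 * omega m with hz
  set w : ℂ := V 2 3 + V 3 3 * omega m with hw
  have hz1 : Complex.normSq z = 1 := by
    rw [Complex.mul_conj, Complex.ofReal_re] at h22
    push_cast at h22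
    linarith
  have hwz : w = z * omega m := by
    refine conj_mul_eq_of_re_of_normSq hz1 ?_ ?_
    · push_cast at h23
      linarith
    · rw [hz, hw]
      simp
      linear_combination (omega m).im * hdet
  obtain ⟨ζ, hζ⟩ := IsAlgClosed.exists_pow_nat_eq z two_pos
  have hζ1 : ζ * conj ζ = 1 := by
    have h1 : Complex.normSq ζ ^ 2 = 1 := by rw [← map_pow, hζ, hz1]
    have h2 := Complex.normSq_nonneg ζ
    have h3 : Complex.normSq ζ = 1 := (pow_eq_one_iff_of_nonneg h2 two_ne_zero).1 h1
    rw [Complex.mul_conj, h3, Complex.ofReal_one]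
  have hA : (!![ζ, 0; 0, conj ζ] : Matrix (Fin 2) (Fin 2) ℂ).det = 1 := by
    rw [det_fin_two]; simpa using hζ1
  refine ⟨_, hA, coordMat_injective hm ?_⟩
  rw [coordMat_mul_ortho hm (isSU_levi (by rw [hA]; exact one_ne_zero) (by rw [hA]; simp)),
    extSq_levi hA, eV]
  have hz' : ζ * ζ = z := by rw [← hζ, pow_two]
  have hw' : ζ * ζ * omega m = w := by rw [hz', hwz]
  have hzc := congrArg conj hz'
  have hwc := congrArg conj hw'
  rw [hz] at hz' hzc
  rw [hw] at hw' hwc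
  simp at hzc hwc
  ext i j
  rw [Matrix.mul_apply, Matrix.mul_apply, Fin.sum_univ_six, Fin.sum_univ_six]
  fin_cases i <;> fin_cases j <;> simp [coordMat] <;>
    first | linear_combination hζ1 | linear_combination hz' | linear_combination hw' |
      linear_combination hzc | linear_combination hwc

/-- An isometry in the identity component which fixes the basis of one hyperbolic plane comes from
`diag(A, (A⁻¹)ᴴ)` for a matrix `A ∈ SL₂(ℂ)`. -/
theorem exists_levi_of_fix_two {m : ℕ} (hm : m ≠ 0) {V : Matrix (Fin 6) (Fin 6) ℝ}
    (hV : Vᵀ * (S₁ m).map (Int.cast : ℤ → ℝ) * V = (S₁ m).map (Int.cast : ℤ → ℝ))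
    (hd : V.det = 1) (hpos : 0 < (posGram m V).det)
    (c0 : ∀ i, V i 0 = (1 : Matrix (Fin 6) (Fin 6) ℝ) i 0)
    (c5 : ∀ i, V i 5 = (1 : Matrix (Fin 6) (Fin 6) ℝ) i 5) :
    ∃ A : Matrix (Fin 2) (Fin 2) ℂ, A.det = 1 ∧ ortho m (levi A) = V := by
  have hf := form_apply hV
  have r5 (j) : V 5 j = S₁ m 0 j := by rw [← hf 0 j]; simp [c0]
  have r0 (j) : V 0 j = S₁ m 5 j := by rw [← hf 5 j]; simp [c5]
  have hS : S₁ m 0 1 = 0 ∧ S₁ m 0 4 = 0 ∧ S₁ m 5 1 = 0 ∧ S₁ m 5 4 = 0 ∧ S₁ m 1 1 = 0 ∧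
      S₁ m 4 4 = 0 ∧ S₁ m 1 4 = 1 := by
    rw [S₁_eq]
    simp
  obtain ⟨s1, s2, s3, s4, s5, s6, s7⟩ := hS
  have h11 := hf 1 1
  have h44 := hf 4 4
  have h14 := hf 1 4
  rw [r5, r0, s1, s3, s5] at h11
  rw [r5, r0, s2, s4, s6] at h44
  rw [r5, r5, r0, r0, s1, s2, s3, s4, s7] at h14
  rw [Complex.mul_conj, Complex.ofReal_re] at h11 h44
  push_cast at h11 h44 h14
  have htr : 0 < V 1 1 + V 4 1 + V 1 4 + V 4 4 := by
    have e : (posGram m V).det = 2 * (V 1 1 + V 4 1 + V 1 4 + V 4 4) := by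
      rw [posGram, S₁_eq, det_fin_two]
      simp [posFrame, Matrix.mul_apply, Fin.sum_univ_six, vecMul, dotProduct, c0, c5, r0, r5, S₁_eq]
      ring
    rw [e] at hpos
    linarith
  obtain ⟨A, hA, a1, a2, a3, a4, a5, a6⟩ := exists_det_one_of_rank_one (a := V 1 1) (b := V 4 1)
    (a' := V 1 4) (b' := V 4 4) (t := V 2 1 + V 3 1 * omega m)
    (t' := V 2 4 + V 3 4 * omega m) (by linarith) (by linarith) (by linarith) htr
  have hsu : IsSU (levi A) := isSU_levi (by rw [hA]; exact one_ne_zero) (by rw [hA]; simp)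
  have hR (j : Fin 6) (h2 : j ≠ 2) (h3 : j ≠ 3) (i) : ortho m (levi A) i j = V i j := by
    rw [ortho, extSq_levi hA, realCoord, of_apply]
    simp only [Matrix.mul_apply, Fin.sum_univ_six]
    fin_cases j
    · fin_cases i <;> simp [coordMat, c0, coordB, coordC]
    · have e3 := coordB_eq hm (V 2 1) (V 3 1)
      have e4 := coordC_eq hm (V 2 1) (V 3 1)
      rw [a3] at e3 e4
      fin_cases i <;> simp [coordMat, r0, r5, s1, s3, ← a1, ← a2, e3, e4, -Complex.mul_re]
    · exact absurd rfl h2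
    · exact absurd rfl h3
    · have e3 := coordB_eq hm (V 2 4) (V 3 4)
      have e4 := coordC_eq hm (V 2 4) (V 3 4)
      rw [a6] at e3 e4
      fin_cases i <;> simp [coordMat, r0, r5, s2, s4, ← a4, ← a5, e3, e4, -Complex.mul_re]
    · fin_cases i <;> simp [coordMat, c5, coordB, coordC]
  have hAA : A⁻¹ * A = 1 := nonsing_inv_mul _ (by rw [hA]; exact isUnit_one)
  have hA' : (A⁻¹).det = 1 := by
    have := congrArg det hAA
    rwa [det_mul, hA, mul_one, det_one] at this
  have hsu' : IsSU (levi A⁻¹) := isSU_levi (by rw [hA']; exact one_ne_zero) (by rw [hA']; simp)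
  have hinv : ortho m (levi A⁻¹) * ortho m (levi A) = 1 := by
    rw [← ortho_mul hm hsu' hsu, ← levi_mul, hAA, levi_eq (Matrix.one_mul 1)]
    simp [ortho_one hm]
  have hform : (ortho m (levi A⁻¹) * V)ᵀ * (S₁ m).map (Int.cast : ℤ → ℝ) *
      (ortho m (levi A⁻¹) * V) = (S₁ m).map (Int.cast : ℤ → ℝ) := by
    have := ortho_form hm hsu'
    rw [transpose_mul]
    calc Vᵀ * (ortho m (levi A⁻¹))ᵀ * (S₁ m).map (Int.cast : ℤ → ℝ) * (ortho m (levi A⁻¹) * V) =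
          Vᵀ * ((ortho m (levi A⁻¹))ᵀ * (S₁ m).map (Int.cast : ℤ → ℝ) * ortho m (levi A⁻¹)) *
            V := by
          simp only [Matrix.mul_assoc]
      _ = _ := by rw [this, hV]
  obtain ⟨B, hB, hBV⟩ := exists_levi_of_fix_four hm hform
    (by rw [det_mul, det_ortho hm hsu', hd, one_mul]) (fun j h2 h3 i => by
      rw [← hinv, Matrix.mul_apply, Matrix.mul_apply]
      simp only [hR j h2 h3])
  have hsuB : IsSU (levi B) := isSU_levi (by rw [hB]; exact one_ne_zero) (by rw [hB]; simp)
  refine ⟨A * B, by rw [det_mul, hA, hB, one_mul], ?_⟩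
  rw [levi_mul, ortho_mul hm hsu hsuB, hBV, ← Matrix.mul_assoc, mul_eq_one_comm.1 hinv,
    Matrix.one_mul]

/-! ### Integrality of matrices in `SL₂(ℂ)` with integral products of entries -/

/-- Four integers `η = u + v ω` of `𝒪_K` whose norms and whose multiples `η (η + η̄)` are divisible
by `p`, with determinant `r`, such that `p` divides `det v` and `det (u₀, v₁)`. Then `p² ∣ r`. -/
theorem sq_dvd_of_prime_dvd {m : ℕ} (hm : Squarefree m) {p : ℕ} (hp : p.Prime) {r : ℤ}
    (u v : Fin 2 → Fin 2 → ℤ)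
    (hN : ∀ i j, (p : ℤ) ∣ u i j ^ 2 + u i j * v i j * omegaTr m + v i j ^ 2 * omegaNm m)
    (hu : ∀ i j, (p : ℤ) ∣ u i j * (2 * u i j + v i j * omegaTr m))
    (hv : ∀ i j, (p : ℤ) ∣ v i j * (2 * u i j + v i j * omegaTr m))
    (huv : (p : ℤ) ∣ u 0 0 * v 1 1 - u 0 1 * v 1 0)
    (hvv : (p : ℤ) ∣ v 0 0 * v 1 1 - v 0 1 * v 1 0)
    (hr : u 0 0 * u 1 1 - u 0 1 * u 1 0 - omegaNm m * (v 0 0 * v 1 1 - v 0 1 * v 1 0) = r)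
    (h0 : u 0 0 * v 1 1 + v 0 0 * u 1 1 - u 0 1 * v 1 0 - v 0 1 * u 1 0 +
      omegaTr m * (v 0 0 * v 1 1 - v 0 1 * v 1 0) = 0) : (p : ℤ) * p ∣ r := by
  have hpi : Prime (p : ℤ) := Nat.prime_iff_prime_int.1 hp
  have hT (i j) : (p : ℤ) ∣ 2 * u i j + v i j * omegaTr m := by
    by_contra h
    have h1 := (hpi.dvd_or_dvd (hu i j)).resolve_right h
    have h2 := (hpi.dvd_or_dvd (hv i j)).resolve_right h
    exact h (dvd_add (h1.mul_left _) (h2.mul_right _))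
  generalize ht' : omegaTr m = t at *
  generalize hn' : omegaNm m = n at *
  set T : Fin 2 → Fin 2 → ℤ := fun i j => 2 * u i j + v i j * t with hTdef
  have h4r : 4 * r = (T 0 0 * T 1 1 - T 0 1 * T 1 0) -
      (4 * n - t ^ 2) * (v 0 0 * v 1 1 - v 0 1 * v 1 0) := by
    rw [← hr, hTdef]
    linear_combination -(2 * t) * h0
  have hTT : (p : ℤ) * p ∣ T 0 0 * T 1 1 - T 0 1 * T 1 0 :=
    dvd_sub (mul_dvd_mul (hT _ _) (hT _ _)) (mul_dvd_mul (hT _ _) (hT _ _))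
  rcases hp.eq_two_or_odd' with rfl | hodd
  · push_cast at *
    by_cases h3 : m % 4 = 3
    · have htm : t = m := by rw [← ht', omegaTr, if_pos h3]
      have hv2 (i j) : (2 : ℤ) ∣ v i j := by
        have h1 : (2 : ℤ) ∣ v i j * t := (Int.dvd_add_right (Dvd.intro _ rfl)).1 (hT i j)
        refine (Int.prime_two.dvd_or_dvd h1).resolve_right ?_
        rw [htm]; omega
      have hu2 (i j) : (2 : ℤ) ∣ u i j := by
        refine Int.prime_two.dvd_of_dvd_pow (n := 2) ?_
        have h1 := hN i j
        rw [add_assoc] at h1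
        refine (Int.dvd_add_left ?_).1 h1
        exact dvd_add (((hv2 i j).mul_left _).mul_right _)
          ((Dvd.dvd.pow (hv2 i j) two_ne_zero).mul_right _)
      rw [← hr]
      exact dvd_sub (dvd_sub (mul_dvd_mul (hu2 _ _) (hu2 _ _)) (mul_dvd_mul (hu2 _ _) (hu2 _ _)))
        (Dvd.dvd.mul_left (dvd_sub (mul_dvd_mul (hv2 _ _) (hv2 _ _))
          (mul_dvd_mul (hv2 _ _) (hv2 _ _))) _)
    · have htm : t = 2 * m := by rw [← ht', omegaTr, if_neg h3]
      have hnm : n = m * (m + 1) := by rw [← hn', omegaNm, if_neg h3]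
      have hm4 := not_four_dvd hm
      rw [htm] at h0
      rw [hnm] at hr
      simp only [htm, hnm] at hN
      obtain ⟨c, hc⟩ := hvv
      have hN' (i j) : (2 : ℤ) ∣ (u i j + m * v i j) ^ 2 + m * v i j ^ 2 := by
        convert hN i j using 1; ring
      by_cases h2 : m % 4 = 2
      · obtain ⟨k, hk⟩ : ∃ k : ℤ, (m : ℤ) = 2 * k := ⟨m / 2, by omega⟩
        have hτ (i j) : ∃ w : ℤ, u i j = 2 * w - m * v i j := by
          have h1 : (2 : ℤ) ∣ u i j + m * v i j := by
            refine Int.prime_two.dvd_of_dvd_pow (n := 2) ((Int.dvd_add_left ?_).1 (hN' i j))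
            rw [hk]; exact (Dvd.intro _ rfl).mul_right _
          obtain ⟨w, hw⟩ := h1
          exact ⟨w, by linarith⟩
        choose w hw using hτ
        refine ⟨w 0 0 * w 1 1 - w 0 1 * w 1 0 - k * c, ?_⟩
        simp only [hw] at hr h0
        rw [← hr]
        linear_combination (-m) * h0 - m * hc - 2 * c * hk
      · obtain ⟨k, hk⟩ : ∃ k : ℤ, (m : ℤ) = 2 * k + 1 := ⟨m / 2, by omega⟩
        have hτ (i j) : ∃ w : ℤ, u i j = v i j + 2 * w - m * v i j := by
          have h1 : (2 : ℤ) ∣ u i j + m * v i j - v i j := by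
            have h5 := hN' i j
            rw [← even_iff_two_dvd] at h5 ⊢
            rw [Int.even_sub]
            rw [Int.even_add, Int.even_pow' two_ne_zero, Int.even_mul,
              Int.even_pow' two_ne_zero] at h5
            have : ¬ Even (m : ℤ) := by rw [Int.not_even_iff_odd]; exact ⟨k, hk⟩
            tauto
          obtain ⟨w, hw⟩ := h1
          exact ⟨w, by linarith⟩
        choose w hw using hτ
        refine ⟨w 0 0 * w 1 1 - w 0 1 * w 1 0 - (k + 1) * c, ?_⟩
        simp only [hw] at hr h0
        rw [← hr]
        linear_combination (1 - m) * h0 - (1 + m) * hc - 2 * c * hk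
  · have h4 : IsCoprime ((p : ℤ) * p) 4 := by
      have : IsCoprime (p : ℤ) 2 := by
        rw [Int.isCoprime_iff_nat_coprime]
        exact (Nat.coprime_two_right).2 hodd
      have h5 : IsCoprime ((p : ℤ) * p) 2 := this.mul_left this
      have := h5.mul_right h5
      norm_num at this
      exact this
    refine h4.dvd_of_dvd_mul_left ?_
    rw [h4r]
    refine dvd_sub hTT ?_
    by_cases hD : (p : ℤ) ∣ 4 * n - t ^ 2
    · exact mul_dvd_mul hD hvv
    · have hv' (i j) : (p : ℤ) ∣ v i j := by
        have h1 : (p : ℤ) ∣ (4 * n - t ^ 2) * v i j ^ 2 := by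
          have e : (4 * n - t ^ 2) * v i j ^ 2 =
              4 * (u i j ^ 2 + u i j * v i j * t + v i j ^ 2 * n) - T i j * T i j := by
            rw [hTdef]; ring
          rw [e]
          exact dvd_sub ((hN i j).mul_left _) ((hT i j).mul_left _)
        exact hpi.dvd_of_dvd_pow ((hpi.dvd_or_dvd h1).resolve_left hD)
      exact Dvd.dvd.mul_left
        (dvd_sub (mul_dvd_mul (hv' _ _) (hv' _ _)) (mul_dvd_mul (hv' _ _) (hv' _ _))) _

theorem eq_of_add_mul_omega {m : ℕ} (hm : m ≠ 0) {a b c d : ℤ}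
    (h : (a : ℂ) + b * omega m = c + d * omega m) : a = c ∧ b = d := by
  have h1 := congrArg (coordB m) h
  have h2 := congrArg (coordC m) h
  have e (x y : ℤ) : (x : ℂ) + y * omega m = ((x : ℝ) : ℂ) + ((y : ℝ) : ℂ) * omega m := by
    push_cast; rfl
  rw [e, e, coordB_eq hm, coordB_eq hm] at h1
  rw [e, e, coordC_eq hm, coordC_eq hm] at h2
  exact ⟨by exact_mod_cast h1, by exact_mod_cast h2⟩

theorem congMod_zero_iff_dvd {m : ℕ} (hm : Squarefree m) {N : ℕ} {a b : ℤ} :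
    CongMod m N (a + b * omega m) 0 ↔ (N : ℤ) ∣ a ∧ (N : ℤ) ∣ b := by
  rw [congMod_zero_iff]
  constructor
  · rintro ⟨z, hz, h⟩
    obtain ⟨c, d, rfl⟩ := (mem_range_iff hm).1 hz
    obtain ⟨h1, h2⟩ := eq_of_add_mul_omega (m := m) hm.ne_zero (a := a) (b := b) (c := N * c)
      (d := N * d) (by rw [h]; push_cast; ring)
    exact ⟨⟨c, h1⟩, d, h2⟩
  · rintro ⟨⟨c, rfl⟩, d, rfl⟩
    exact ⟨c + d * omega m, (mem_range_iff hm).2 ⟨c, d, rfl⟩, by push_cast; ring⟩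

theorem exists_int_of_mem_range_of_conj {m : ℕ} (hm : Squarefree m) {x : ℂ}
    (hx : x ∈ (toC m).range) (hc : conj x = x) : ∃ a : ℤ, x = a := by
  obtain ⟨k, hk⟩ := (congMod_zero_iff_re (N := 1) hm hc).1 (mem_range_iff_congMod.1 hx)
  refine ⟨k, ?_⟩
  rw [← Complex.conj_eq_iff_re.1 hc, hk]
  push_cast; ring

/-- A matrix of determinant one all of whose products `a_ij ā_kl` are integral is, up to a real
factor `ρ` with integral square, a matrix over `𝒪_K`. -/
theorem exists_real_mul_mem {m : ℕ} (hm : Squarefree m) {A : Matrix (Fin 2) (Fin 2) ℂ}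
    (hA : A.det = 1) (h : ∀ i j k l, A i j * conj (A k l) ∈ (toC m).range)
    (h2 : ∀ i j k l, A i j * A k l ∈ (toC m).range) :
    ∃ (ρ : ℂ) (R : ℕ), R ≠ 0 ∧ ρ ^ 2 = R ∧ conj ρ = ρ ∧ ∀ i j, ρ * A i j ∈ (toC m).range := by
  obtain ⟨i, j, ha⟩ : ∃ i j, A i j ≠ 0 := by
    by_contra! h0
    simp [det_fin_two, h0] at hA
  obtain ⟨ρ, h0, hc, h3, h4⟩ : ∃ ρ : ℂ, ρ ≠ 0 ∧ conj ρ = ρ ∧ ρ ^ 2 ∈ (toC m).range ∧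
      ∀ i j, ρ * A i j ∈ (toC m).range := by
    by_cases hre : A i j + conj (A i j) = 0
    · -- the entry is purely imaginary, and becomes real after multiplication by `√(-m)`
      have hs : sqrtNeg m ∈ (toC m).range := by
        rw [mem_range_toC]
        refine ⟨sqrtNeg_mem_K m, IsIntegral.of_pow (n := 2) two_pos ?_⟩
        rw [pow_two, sqrtNeg_mul_self]
        simpa using (isIntegral_algebraMap (R := ℤ) (x := (m : ℤ)) (A := ℂ)).neg
      have hs0 : sqrtNeg m ≠ 0 := fun h0 => hm.ne_zero (by
        have := sqrtNeg_mul_self m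
        rw [h0, mul_zero, eq_comm, neg_eq_zero] at this
        exact_mod_cast this)
      refine ⟨sqrtNeg m * A i j, mul_ne_zero hs0 ha, ?_, ?_, fun k l => ?_⟩
      · rw [map_mul, conj_sqrtNeg]
        linear_combination (-sqrtNeg m) * hre
      · rw [mul_pow, pow_two (A i j)]
        exact mul_mem (pow_mem hs 2) (h2 _ _ _ _)
      · rw [mul_assoc]
        exact mul_mem hs (h2 _ _ _ _)
    · refine ⟨A i j + conj (A i j), hre, by rw [map_add, Complex.conj_conj, add_comm], ?_,
        fun k l => ?_⟩
      · have e : (A i j + conj (A i j)) ^ 2 = A i j * A i j + 2 * (A i j * conj (A i j)) +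
          conj (A i j * A i j) := by rw [map_mul]; ring
        rw [e]
        exact add_mem (add_mem (h2 _ _ _ _) (mul_mem (by exact_mod_cast int_mem_range m 2)
          (h _ _ _ _))) (conj_mem_range (h2 _ _ _ _))
      · rw [add_mul]
        refine add_mem (h2 _ _ _ _) ?_
        rw [mul_comm]
        exact h _ _ _ _
  obtain ⟨R, hR⟩ := exists_int_of_mem_range_of_conj hm h3 (by rw [map_pow, hc])
  have hR' : ρ.re ^ 2 = R := by
    rw [← Complex.conj_eq_iff_re.1 hc] at hR
    exact_mod_cast hR
  have hpos : 0 ≤ R := by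
    have := sq_nonneg ρ.re
    rw [hR'] at this
    exact_mod_cast this
  lift R to ℕ using hpos
  refine ⟨ρ, R, ?_, by simpa using hR, hc, h4⟩
  rintro rfl
  exact h0 (by simpa using hR)

/-- An element of `SL₂(ℂ)` all of whose products `a_ij ā_kl` are integral lies in `SL₂(𝒪_K)`,
provided that `a₁₁ ā₂₂ - a₁₂ ā₂₁ - 1` lies in the different. Without the last condition, the matrix
could be `√r⁻¹` times a matrix over `𝒪_K` of determinant `r` with `r` a squarefree divisor of the
discriminant; these are the Atkin-Lehner-type extensions of `SL₂(𝒪_K)`. -/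
theorem mem_range_of_mul_conj_mem {m : ℕ} (hm : Squarefree m) {A : Matrix (Fin 2) (Fin 2) ℂ}
    (hA : A.det = 1) (h : ∀ i j k l, A i j * conj (A k l) ∈ (toC m).range)
    (hd : (A 0 0 * conj (A 1 1) - A 0 1 * conj (A 1 0) - 1) / diffGen m ∈ (toC m).range)
    (i j : Fin 2) : A i j ∈ (toC m).range := by
  have h2 (i j k l) : A i j * A k l ∈ (toC m).range := by
    have hA' : conj (A 0 0) * conj (A 1 1) - conj (A 0 1) * conj (A 1 0) = 1 := by
      rw [← map_mul, ← map_mul, ← map_sub, ← det_fin_two, hA, map_one]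
    have e : A i j * A k l = A i j * conj (A 0 0) * (A k l * conj (A 1 1)) -
        A i j * conj (A 0 1) * (A k l * conj (A 1 0)) := by
      linear_combination (-(A i j * A k l)) * hA'
    rw [e]
    exact sub_mem (mul_mem (h _ _ _ _) (h _ _ _ _)) (mul_mem (h _ _ _ _) (h _ _ _ _))
  obtain ⟨ρ, R, hR0, hR, hρ, hmem⟩ := exists_real_mul_mem hm hA h h2
  obtain ⟨r, k, hrk, hsq⟩ := Nat.sq_mul_squarefree R
  have hk0 : (k : ℂ) ≠ 0 := by
    rintro h0
    rw [Nat.cast_eq_zero] at h0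
    exact hR0 (by rw [← hrk, h0]; simp)
  have hρk : (ρ / k) ^ 2 = r := by
    rw [div_pow, hR, ← hrk, div_eq_iff (pow_ne_zero 2 hk0)]
    push_cast; ring
  have hρc : conj (ρ / k) = ρ / k := by rw [map_div₀, hρ, Complex.conj_natCast]
  -- `η = √r A` has entries in `𝒪_K`
  have hη (i j) : ρ / k * A i j ∈ (toC m).range := by
    rw [mem_range_toC]
    constructor
    · rw [div_mul_eq_mul_div]
      exact div_mem (mem_range_toC.1 (hmem i j)).1 (natCast_mem _ k)
    · refine IsIntegral.of_pow (n := 2) two_pos ?_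
      rw [mul_pow, hρk, pow_two]
      exact (mem_range_toC.1 (mul_mem (by exact_mod_cast int_mem_range m r) (h2 i j i j))).2
  choose u v huv using fun i j => (mem_range_iff hm).1 (hη i j)
  generalize ρ / k = σ at *
  have ecj (i j) : conj (σ * A i j) = u i j + v i j * (omegaTr m - omega m) := by
    rw [huv, map_add, map_mul, conj_omega]; simp
  have hsq' (i j k l) : σ * A i j * (σ * A k l) = r * (A i j * A k l) := by
    rw [← hρk]; ring
  have hsqc (i j k l) : σ * A i j * conj (σ * A k l) = r * (A i j * conj (A k l)) := by
    rw [map_mul, hρc, ← hρk]; ring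
  have hω := omega_sq m
  have hr1 : r = 1 := by
    by_contra hr1
    obtain ⟨p, hp, hpr⟩ := Nat.exists_prime_and_dvd hr1
    have hpr' : (p : ℤ) ∣ r := by exact_mod_cast hpr
    have key {a b : ℤ} {z : ℂ} (hz : z ∈ (toC m).range) (e : (a : ℂ) + b * omega m = r * z) :
        (p : ℤ) ∣ a ∧ (p : ℤ) ∣ b := by
      obtain ⟨h3, h4⟩ := (congMod_zero_iff_dvd hm).1 (congMod_zero_iff.2 ⟨z, hz, e⟩)
      exact ⟨hpr'.trans h3, hpr'.trans h4⟩
    have hN (i j) := (key (a := u i j ^ 2 + u i j * v i j * omegaTr m + v i j ^ 2 * omegaNm m)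
      (b := 0) (h i j i j) (by
        rw [← hsqc, ecj, huv]; push_cast
        linear_combination (v i j ^ 2 : ℂ) * hω)).1
    have huv' (i j) := key (a := u i j * (2 * u i j + v i j * omegaTr m))
      (b := v i j * (2 * u i j + v i j * omegaTr m)) (add_mem (h2 i j i j) (h i j i j)) (by
        rw [mul_add (r : ℂ), ← hsqc, ← hsq', ecj, huv]; push_cast; ring)
    have hdet : σ * A 0 0 * (σ * A 1 1) - σ * A 0 1 * (σ * A 1 0) = r := by
      rw [hsq', hsq', ← mul_sub, ← det_fin_two, hA, mul_one]
    have hdetc := eq_of_add_mul_omega (m := m) hm.ne_zero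
      (a := u 0 0 * u 1 1 - u 0 1 * u 1 0 - omegaNm m * (v 0 0 * v 1 1 - v 0 1 * v 1 0))
      (b := u 0 0 * v 1 1 + v 0 0 * u 1 1 - u 0 1 * v 1 0 - v 0 1 * u 1 0 +
        omegaTr m * (v 0 0 * v 1 1 - v 0 1 * v 1 0)) (c := r) (d := 0) (by
        simp only [huv] at hdet
        push_cast
        linear_combination hdet - ((v 0 0 : ℂ) * v 1 1 - v 0 1 * v 1 0) * hω)
    have hvd := key (a := u 0 0 * v 1 1 - u 0 1 * v 1 0) (b := v 0 0 * v 1 1 - v 0 1 * v 1 0)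
      (neg_mem hd) (by
        have hδ := diffGen_ne_zero hm.ne_zero
        have e1 : (r : ℂ) * (A 0 0 * conj (A 1 1) - A 0 1 * conj (A 1 0) - 1) =
            -diffGen m * (σ * A 0 0 * v 1 1 - σ * A 0 1 * v 1 0) := by
          rw [mul_sub, mul_sub, ← hsqc, ← hsqc, mul_one]
          rw [ecj, ecj, diffGen, conj_omega]
          linear_combination hdet - σ * A 0 0 * huv 1 1 + σ * A 0 1 * huv 1 0
        rw [mul_neg, ← mul_div_assoc, e1, huv, huv]
        field_simp
        push_cast
        ring)
    have h5 := sq_dvd_of_prime_dvd hm hp u v hN (fun i j => (huv' i j).1) (fun i j => (huv' i j).2)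
      hvd.1 hvd.2 hdetc.1 hdetc.2
    have h6 : p * p ∣ r := by exact_mod_cast h5
    exact hp.one_lt.ne' (Nat.isUnit_iff.1 (hsq p h6))
  rw [hr1, Nat.cast_one] at hρk
  have h7 := hη i j
  rcases sq_eq_sq_iff_eq_or_eq_neg.1 (hρk.trans (one_pow 2).symm) with rfl | rfl
  · simpa using h7
  · simpa using neg_mem h7

/-! ### The homomorphism into the discriminant kernel -/

theorem exists_cmat_eq {m : ℕ} {X : Matrix (Fin 2 ⊕ Fin 2) (Fin 2 ⊕ Fin 2) ℂ} (hX : IsSU X)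
    (h : ∀ i j, X i j ∈ (toC m).range) : ∃ M : Gam m, cmat M = X := by
  choose Y hY using h
  have hmap : (of Y).map (toC m) = X := by ext i j; exact hY i j
  have hinj : Function.Injective (toC m) := fun x y h => Subtype.ext (Subtype.ext h)
  have hdet : (of Y).det = 1 := by
    apply hinj
    rw [RingHom.map_det, map_one, ← hX.1, ← hmap]
    rfl
  refine ⟨⟨⟨of Y, hdet⟩, ?_⟩, hmap⟩
  change ((of Y).map (toC m))ᴴ * J * (of Y).map (toC m) = J
  rw [hmap]
  exact hX.2

theorem blk_mul_inv {m : ℕ} (M : Gam m) :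
    blkA M * (blkD M)ᴴ - blkB M * (blkC M)ᴴ = 1 ∧ blkB M * (blkA M)ᴴ = blkA M * (blkB M)ᴴ ∧
    blkC M * (blkD M)ᴴ = blkD M * (blkC M)ᴴ ∧ blkD M * (blkA M)ᴴ - blkC M * (blkB M)ᴴ = 1 := by
  obtain ⟨h1, h2, h3, h4⟩ := blk_mul M M⁻¹
  obtain ⟨i1, i2, i3, i4⟩ := blk_inv M
  obtain ⟨o1, o2, o3, o4⟩ := blk_one m
  rw [mul_inv_cancel] at h1 h2 h3 h4
  rw [i1, i3, o1] at h1
  rw [i2, i4, o2] at h2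
  rw [i1, i3, o3] at h3
  rw [i2, i4, o4] at h4
  refine ⟨?_, ?_, ?_, ?_⟩
  · rw [h1, Matrix.mul_neg, sub_eq_add_neg]
  · rw [← sub_eq_zero, h2, Matrix.mul_neg]; abel
  · rw [← sub_eq_zero, h3, Matrix.mul_neg]; abel
  · rw [h4, Matrix.mul_neg]; abel

theorem extSq_mem {m : ℕ} (M : Gam m) (i j : Fin 6) : extSq (cmat M) i j ∈ (toC m).range :=
  sub_mem (mul_mem (cmat_mem M _ _) (cmat_mem M _ _)) (mul_mem (cmat_mem M _ _) (cmat_mem M _ _))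

/-- The expression `W₂₂ - W₂₃ - 1`, `W = ⋀² M`, is a combination of differences `x - x̄`, which
lie in the different: the relation `A Dᴴ - B Cᴴ = I` has been subtracted. -/
theorem extSq_two_two_sub {m : ℕ} (M : Gam m) : extSq (cmat M) 2 2 - extSq (cmat M) 2 3 - 1 =
    blkA M 0 0 * (blkD M 0 0 - conj (blkD M 0 0)) + blkA M 0 1 * (blkD M 0 1 - conj (blkD M 0 1)) -
      blkB M 0 0 * (blkC M 0 0 - conj (blkC M 0 0)) -
      blkB M 0 1 * (blkC M 0 1 - conj (blkC M 0 1)) := by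
  have h := congrFun (congrFun (blk_mul_inv M).1 0) 0
  simp [Matrix.mul_apply, Fin.sum_univ_two] at h
  rw [← h]
  simp [extSq, minor, fstIdx, sndIdx, blkA, blkB, blkC, blkD, toBlocks₁₁, toBlocks₁₂, toBlocks₂₁,
    toBlocks₂₂]
  ring

/-- For `M ∈ Γ₂(𝒪_K)`, the matrix `M̃ - 1` is an integral multiple of `S₁`. -/
theorem defectCong_one {m : ℕ} (hm : Squarefree m) (M : Gam m) :
    DefectCong m (fun _ _ => 1) (cmat M) := by
  have hmem := extSq_mem M
  have h0 {x : ℂ} (hx : x ∈ (toC m).range) : CongMod m 1 x 0 := mem_range_iff_congMod.1 hx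
  refine ⟨fun i hi j h2 h3 => ?_, fun i _ _ => h0 (hmem _ _), h0 (hmem _ _), h0 ?_⟩
  · rw [← CongMod.sub_iff]
    refine h0 (sub_mem (hmem _ _) ?_)
    rw [Matrix.one_apply]
    split_ifs
    exacts [one_mem _, zero_mem _]
  · have hs (x : ℂ) (hx : x ∈ (toC m).range) := sub_conj_div_mem hm hx
    rw [extSq_two_two_sub]
    have hb := blk_mem M
    rw [sub_div, sub_div, add_div, mul_div_assoc, mul_div_assoc, mul_div_assoc, mul_div_assoc]
    exact sub_mem (sub_mem (add_mem (mul_mem (hb _ _).1 (hs _ (hb _ _).2.2.2))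
      (mul_mem (hb _ _).1 (hs _ (hb _ _).2.2.2))) (mul_mem (hb _ _).2.1 (hs _ (hb _ _).2.2.1)))
      (mul_mem (hb _ _).2.1 (hs _ (hb _ _).2.2.1))

theorem map_intCast_injective {ι : Type*} :
    Function.Injective fun U : Matrix ι ι ℤ => U.map (Int.cast : ℤ → ℝ) :=
  Matrix.map_injective Int.cast_injective

theorem map_intCast_mul (U V : Matrix (Fin 6) (Fin 6) ℤ) : (U * V).map (Int.cast : ℤ → ℝ) =
    U.map (Int.cast : ℤ → ℝ) * V.map (Int.cast : ℤ → ℝ) :=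
  Matrix.map_mul (f := Int.castRingHom ℝ)

theorem map_intCast_one_add (X : Matrix (Fin 6) (Fin 6) ℤ) : (1 + X).map (Int.cast : ℤ → ℝ) =
    1 + X.map (Int.cast : ℤ → ℝ) := by
  ext i j; by_cases h : i = j <;> simp [h]

theorem exists_mem_discriminantKernel {m : ℕ} (hm : m ≠ 0)
    {X : Matrix (Fin 2 ⊕ Fin 2) (Fin 2 ⊕ Fin 2) ℂ} (hX : IsSU X)
    (hd : ∀ i j, ∃ k : ℤ, defect m X i j = k) :
    ∃ U ∈ discriminantKernel (S₁ m), (U : Matrix (Fin 6) (Fin 6) ℤ).map (Int.cast : ℤ → ℝ) =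
      ortho m X := by
  choose Y hY using hd
  have e1 : defect m X = (of Y).map (Int.cast : ℤ → ℝ) := by ext i j; exact hY i j
  have e2 : (1 + of Y * S₁ m).map (Int.cast : ℤ → ℝ) = ortho m X := by
    rw [map_intCast_one_add, map_intCast_mul, ← e1, defect_mul hm hX, add_sub_cancel]
  have hdet : (1 + of Y * S₁ m).det = 1 := by
    have h1 := det_ortho hm hX
    rw [← e2] at h1
    have h2 := (Int.castRingHom ℝ).map_det (1 + of Y * S₁ m)
    rw [RingHom.mapMatrix_apply] at h2
    exact Int.cast_injective (α := ℝ) ((h2.trans h1).trans Int.cast_one.symm)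
  refine ⟨⟨1 + of Y * S₁ m, hdet⟩, ⟨?_, of Y, rfl⟩, e2⟩
  change SpecialLinearGroup.map (Int.castRingHom ℝ) _ ∈ specialOrthogonal₀ (S₁ m)
  have e3 : SpecialLinearGroup.map (Int.castRingHom ℝ) ⟨1 + of Y * S₁ m, hdet⟩ =
      ⟨ortho m X, det_ortho hm hX⟩ := Subtype.ext e2
  rw [e3]
  exact ortho_mem_specialOrthogonal₀ hm hX

theorem defect_eq {m : ℕ} (hm : m ≠ 0) {X : Matrix (Fin 2 ⊕ Fin 2) (Fin 2 ⊕ Fin 2) ℂ} (hX : IsSU X)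
    {Y : Matrix (Fin 6) (Fin 6) ℤ} (h : (1 + Y * S₁ m).map (Int.cast : ℤ → ℝ) = ortho m X) :
    defect m X = Y.map (Int.cast : ℤ → ℝ) := by
  apply mul_S₁_injective hm
  rw [defect_mul hm hX, ← h, map_intCast_one_add, map_intCast_mul, add_sub_cancel_left]

theorem exists_kernel_eq_ortho {m : ℕ} (hm : Squarefree m) (M : Gam m) :
    ∃ U : discriminantKernel (S₁ m),
      ((U : SpecialLinearGroup (Fin 6) ℤ) : Matrix (Fin 6) (Fin 6) ℤ).map (Int.cast : ℤ → ℝ) =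
      ortho m (cmat M) := by
  have h := (defect_dvd_iff hm (fun _ => rfl) (fun _ => rfl) (isSU_cmat M)).2 (defectCong_one hm M)
  obtain ⟨U, hU, e⟩ := exists_mem_discriminantKernel hm.ne_zero (isSU_cmat M)
    (fun i j => by simpa using h i j)
  exact ⟨⟨U, hU⟩, e⟩

/-- The homomorphism `M ↦ M̃` from `Γ₂(𝒪_K)` to the discriminant kernel of `S₁`. -/
def orthoHom {m : ℕ} (hm : Squarefree m) : Gam m →* discriminantKernel (S₁ m) :=
  MonoidHom.mk' (fun M => (exists_kernel_eq_ortho hm M).choose) fun M M' => by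
    apply Subtype.ext
    apply Subtype.ext
    apply map_intCast_injective
    beta_reduce
    refine (exists_kernel_eq_ortho hm (M * M')).choose_spec.trans ?_
    rw [cmat_mul, ortho_mul hm.ne_zero (isSU_cmat M) (isSU_cmat M')]
    refine (congrArg₂ (· * ·) (exists_kernel_eq_ortho hm M).choose_spec
      (exists_kernel_eq_ortho hm M').choose_spec).symm.trans ?_
    exact (map_intCast_mul _ _).symm

theorem orthoHom_map {m : ℕ} (hm : Squarefree m) (M : Gam m) :
    ((orthoHom hm M : SpecialLinearGroup (Fin 6) ℤ) : Matrix (Fin 6) (Fin 6) ℤ).map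
      (Int.cast : ℤ → ℝ) = ortho m (cmat M) :=
  (exists_kernel_eq_ortho hm M).choose_spec

/-! ### The kernel -/

/-- A `4 × 4` matrix acting trivially on the exterior square is a diagonal matrix, and the product
of any two of its diagonal entries is one. -/
theorem diagonal_of_minors {R : Type*} [CommRing R] {X : Matrix (Fin 2 ⊕ Fin 2) (Fin 2 ⊕ Fin 2) R}
    (hX : ∀ I K : Fin 6, X (fstIdx I) (fstIdx K) * X (sndIdx I) (sndIdx K) -
      X (fstIdx I) (sndIdx K) * X (sndIdx I) (fstIdx K) = (1 : Matrix (Fin 6) (Fin 6) R) I K) :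
    (∀ k i, k ≠ i → X k i = 0) ∧ ∀ i j, i ≠ j → X i i * X j j = 1 := by
  have hidx : ∀ a b : Fin 2 ⊕ Fin 2, a ≠ b → ∃ I : Fin 6,
      (a = fstIdx I ∧ b = sndIdx I) ∨ (a = sndIdx I ∧ b = fstIdx I) := by decide
  have H0 (a b c d : Fin 2 ⊕ Fin 2) (hab : a ≠ b) (hcd : c ≠ d) (h1 : ¬ (a = c ∧ b = d))
      (h2 : ¬ (a = d ∧ b = c)) : X a c * X b d - X a d * X b c = 0 := by
    obtain ⟨I, hI⟩ := hidx a b hab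
    obtain ⟨K, hK⟩ := hidx c d hcd
    have hIK : I ≠ K := by
      rintro rfl
      rcases hI with ⟨rfl, rfl⟩ | ⟨rfl, rfl⟩ <;> rcases hK with ⟨rfl, rfl⟩ | ⟨rfl, rfl⟩ <;> simp_all
    have h := hX I K
    rw [Matrix.one_apply_ne hIK] at h
    rcases hI with ⟨rfl, rfl⟩ | ⟨rfl, rfl⟩ <;> rcases hK with ⟨rfl, rfl⟩ | ⟨rfl, rfl⟩ <;>
      first | linear_combination h | linear_combination -h
  have H1 (a b : Fin 2 ⊕ Fin 2) (hab : a ≠ b) : X a a * X b b - X a b * X b a = 1 := by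
    obtain ⟨I, hI⟩ := hidx a b hab
    have h := hX I I
    rw [Matrix.one_apply_eq] at h
    rcases hI with ⟨rfl, rfl⟩ | ⟨rfl, rfl⟩ <;> linear_combination h
  have hoff (k i : Fin 2 ⊕ Fin 2) (hki : k ≠ i) : X k i = 0 := by
    obtain ⟨j, hjk, hji⟩ : ∃ j, j ≠ k ∧ j ≠ i := by revert k i; decide
    -- the determinant with rows `k, i, j` and columns `i, i, j` vanishes
    linear_combination (-X k i) * H1 i j hji.symm +
      X i i * H0 k j i j hjk.symm hji.symm (fun h => hki h.1) (fun h => hji h.2) -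
      X j i * H0 k i i j hki hji.symm (fun h => hki h.1) (fun h => hjk h.1.symm)
  refine ⟨hoff, fun i j hij => ?_⟩
  have := H1 i j hij
  rwa [hoff i j hij, zero_mul, sub_zero] at this

theorem diag_eq_of_mul_eq_one {R : Type*} [CommRing R] {x : Fin 2 ⊕ Fin 2 → R}
    (hx : ∀ i j, i ≠ j → x i * x j = 1) : x (.inl 0) ^ 2 = 1 ∧ ∀ i, x i = x (.inl 0) := by
  have hsq : x (.inl 0) ^ 2 = 1 := by
    linear_combination x (.inl 0) ^ 2 * (-hx (.inl 1) (.inr 0) (by decide)) +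
      x (.inl 0) * x (.inr 0) * hx (.inl 0) (.inl 1) (by decide) +
      hx (.inl 0) (.inr 0) (by decide)
  refine ⟨hsq, fun i => ?_⟩
  by_cases hi : i = .inl 0
  · rw [hi]
  · linear_combination x (.inl 0) * hx i (.inl 0) hi - x i * hsq

theorem eq_one_or_neg_one_of_extSq {X : Matrix (Fin 2 ⊕ Fin 2) (Fin 2 ⊕ Fin 2) ℂ}
    (hX : extSq X = 1) : X = 1 ∨ X = -1 := by
  obtain ⟨hoff, hdiag⟩ := diagonal_of_minors (X := X) fun I K => congrFun (congrFun hX I) K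
  obtain ⟨hsq, hall⟩ := diag_eq_of_mul_eq_one (x := fun i => X i i) hdiag
  rcases sq_eq_sq_iff_eq_or_eq_neg.1 (hsq.trans (one_pow 2).symm) with h | h
  · left
    ext i j
    by_cases hij : i = j
    · rw [hij, hall, h, Matrix.one_apply_eq]
    · rw [hoff i j hij, Matrix.one_apply_ne hij]
  · right
    ext i j
    by_cases hij : i = j
    · rw [hij, hall, h, Matrix.neg_apply, Matrix.one_apply_eq]
    · rw [hoff i j hij, Matrix.neg_apply, Matrix.one_apply_ne hij, neg_zero]

theorem exists_coordMat_mul_eq_one {m : ℕ} (hm : m ≠ 0) :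
    ∃ N : Matrix (Fin 6) (Fin 6) ℂ, coordMat m * N = 1 := by
  have hδ := diffGen_ne_zero hm
  refine ⟨!![1, 0, 0, 0, 0, 0;
     0, 1, 0, 0, 0, 0;
     0, 0, -conj (omega m) / diffGen m, omega m / diffGen m, 0, 0;
     0, 0, 1 / diffGen m, -1 / diffGen m, 0, 0;
     0, 0, 0, 0, 1, 0;
     0, 0, 0, 0, 0, 1], ?_⟩
  ext i j
  rw [Matrix.mul_apply, Fin.sum_univ_six]
  fin_cases i <;> fin_cases j <;> simp [coordMat] <;> field_simp <;> rw [diffGen] <;> ring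

theorem extSq_eq_one_of_ortho {m : ℕ} (hm : m ≠ 0) {X : Matrix (Fin 2 ⊕ Fin 2) (Fin 2 ⊕ Fin 2) ℂ}
    (hX : IsSU X) (h : ortho m X = 1) : extSq X = 1 := by
  have h1 := coordMat_mul_ortho hm hX
  rw [h, Matrix.map_one _ Complex.ofReal_zero Complex.ofReal_one, Matrix.mul_one] at h1
  obtain ⟨N, hN⟩ := exists_coordMat_mul_eq_one hm
  rw [← Matrix.mul_one (extSq X), ← hN, ← Matrix.mul_assoc, ← h1]

theorem ker_orthoHom {m : ℕ} (hm : Squarefree m) : (orthoHom hm).ker = pmOne m := by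
  ext M
  rw [MonoidHom.mem_ker]
  constructor
  · intro h
    apply eq_one_or_neg_one_of_extSq
    apply extSq_eq_one_of_ortho hm.ne_zero (isSU_cmat M)
    rw [← orthoHom_map hm, h]
    simp
  · intro h
    apply Subtype.ext
    apply Subtype.ext
    apply map_intCast_injective
    have h1 : extSq (cmat M) = 1 := by
      rcases h with h | h
      · rw [h, extSq_one]
      · rw [h, extSq_neg, extSq_one]
    refine (orthoHom_map hm M).trans ?_
    have h2 : ortho m (cmat M) = ortho m 1 := by rw [ortho, ortho, h1, extSq_one]
    rw [h2, ortho_one hm.ne_zero]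
    simp

/-! ### Surjectivity -/

/-- If the isometry attached to `diag(A, (A⁻¹)ᴴ)` lies in the discriminant kernel, then all products
`aᵢⱼ āₖₗ` are integral, and so is `A`. -/
theorem mem_range_of_defectCong_levi {m : ℕ} (hm : Squarefree m) {A : Matrix (Fin 2) (Fin 2) ℂ}
    (hA : A.det = 1) (h : DefectCong m (fun _ _ => 1) (levi A)) (i j : Fin 2) :
    A i j ∈ (toC m).range := by
  obtain ⟨h1, h2, h3, h4⟩ := h
  simp only [extSq_levi hA] at h1 h2 h3 h4
  have e1 := h1 1 (by decide) 1 (by decide) (by decide)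
  have e2 := h1 1 (by decide) 4 (by decide) (by decide)
  have e3 := h1 2 (by decide) 1 (by decide) (by decide)
  have e4 := h1 2 (by decide) 4 (by decide) (by decide)
  have e5 := h1 4 (by decide) 1 (by decide) (by decide)
  have e6 := h1 4 (by decide) 4 (by decide) (by decide)
  have e7 := h2 1 (by decide) (by decide)
  have e8 := h2 4 (by decide) (by decide)
  rw [← CongMod.sub_iff, ← mem_range_iff_congMod] at e1 e2 e3 e4 e5 e6
  rw [← mem_range_iff_congMod] at e7 e8 h3 h4
  have q1 : A 0 0 * conj (A 0 0) ∈ (toC m).range := by simpa using! add_mem e1 (one_mem _)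
  have q2 : A 0 1 * conj (A 0 1) ∈ (toC m).range := by simpa using! e2
  have q3 : A 0 0 * conj (A 1 0) ∈ (toC m).range := by simpa using! e3
  have q4 : A 0 1 * conj (A 1 1) ∈ (toC m).range := by simpa using! e4
  have q5 : A 1 0 * conj (A 1 0) ∈ (toC m).range := by simpa using! e5
  have q6 : A 1 1 * conj (A 1 1) ∈ (toC m).range := by simpa using! add_mem e6 (one_mem _)
  have q7 : A 0 0 * conj (A 0 1) ∈ (toC m).range := by simpa using! e7
  have q8 : A 1 0 * conj (A 1 1) ∈ (toC m).range := by simpa using! e8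
  have q9 : A 0 1 * conj (A 1 0) ∈ (toC m).range := by simpa using! h3
  have q10 : (A 0 0 * conj (A 1 1) - A 0 1 * conj (A 1 0) - 1) / diffGen m ∈ (toC m).range := by
    simpa using! h4
  have q11 : A 0 0 * conj (A 1 1) ∈ (toC m).range := by
    have hδ : diffGen m ∈ (toC m).range :=
      sub_mem (omega_mem_range m) (conj_mem_range (omega_mem_range m))
    have := add_mem (add_mem (mul_mem q10 hδ) q9) (one_mem _)
    rwa [div_mul_cancel₀ _ (diffGen_ne_zero hm.ne_zero), sub_right_comm, sub_add_cancel,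
      sub_add_cancel] at this
  have hsw (x y : ℂ) (h : x * conj y ∈ (toC m).range) : y * conj x ∈ (toC m).range := by
    simpa [mul_comm] using conj_mem_range h
  refine mem_range_of_mul_conj_mem hm hA (fun i j k l => ?_) q10 i j
  fin_cases i <;> fin_cases j <;> fin_cases k <;> fin_cases l
  exacts [q1, q7, q3, q11, hsw _ _ q7, q2, q9, q4, hsw _ _ q3, hsw _ _ q9, q5, q8, hsw _ _ q11,
    hsw _ _ q4, hsw _ _ q8, q6]

theorem exists_gam_trans {m : ℕ} {H : Matrix (Fin 2) (Fin 2) ℂ} (hH : H.IsHermitian)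
    (h : ∀ i j, H i j ∈ (toC m).range) : ∃ M : Gam m, cmat M = trans H := by
  refine exists_cmat_eq (isSU_trans hH) ?_
  rintro (i | i) (j | j)
  · change (1 : Matrix (Fin 2) (Fin 2) ℂ) i j ∈ _
    rw [Matrix.one_apply]; split_ifs; exacts [one_mem _, zero_mem _]
  · exact h i j
  · exact zero_mem _
  · change (1 : Matrix (Fin 2) (Fin 2) ℂ) i j ∈ _
    rw [Matrix.one_apply]; split_ifs; exacts [one_mem _, zero_mem _]

theorem isSU_J : IsSU J := by
  refine ⟨?_, unitary_fromBlocks_iff.2 (by simp)⟩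
  rw [J, det_four]
  simp [extSq, minor, fstIdx, sndIdx]

theorem exists_gam_J (m : ℕ) : ∃ M : Gam m, cmat M = J := by
  refine exists_cmat_eq isSU_J ?_
  rintro (i | i) (j | j)
  · exact zero_mem _
  · change (1 : Matrix (Fin 2) (Fin 2) ℂ) i j ∈ _
    rw [Matrix.one_apply]; split_ifs; exacts [one_mem _, zero_mem _]
  · change -(1 : Matrix (Fin 2) (Fin 2) ℂ) i j ∈ _
    rw [Matrix.one_apply]; split_ifs; exacts [neg_mem (one_mem _), neg_mem (zero_mem _)]
  · exact zero_mem _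

section Orbit

variable {m : ℕ} (hm : Squarefree m)

/-- The bottom row of `M̃ U` in terms of that of `⋀² M`. -/
theorem orthoHom_mul_five (M : Gam m) (U : discriminantKernel (S₁ m)) (j : Fin 6) :
    ((((orthoHom hm M * U : discriminantKernel (S₁ m)) : SpecialLinearGroup (Fin 6) ℤ) 5 j : ℤ) : ℂ)
      = extSq (cmat M) 5 0 * U.1 0 j + extSq (cmat M) 5 1 * U.1 1 j
      + extSq (cmat M) 5 2 * (U.1 2 j + U.1 3 j * omega m)
      + extSq (cmat M) 5 3 * (U.1 2 j + U.1 3 j * conj (omega m))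
      + extSq (cmat M) 5 4 * U.1 4 j + extSq (cmat M) 5 5 * U.1 5 j := by
  have h := coordMat_mul_ortho hm.ne_zero (isSU_cmat M)
  have h1 := congrArg (fun X => (X * U.1.1.map (Int.cast : ℤ → ℂ)) 5 j) h
  have e : (ortho m (cmat M)).map Complex.ofReal * U.1.1.map (Int.cast : ℤ → ℂ) =
      ((orthoHom hm M).1.1 * U.1.1).map (Int.cast : ℤ → ℂ) := by
    rw [← orthoHom_map hm]
    ext i k
    simp [Matrix.mul_apply]
  simp only [Matrix.mul_assoc] at h1
  rw [e, Matrix.mul_apply, Matrix.mul_apply] at h1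
  simp only [Matrix.mul_apply, Fin.sum_univ_six] at h1
  simp [coordMat] at h1
  refine h1.trans ?_
  ring

theorem exists_bottom_one (U : discriminantKernel (S₁ m)) (k : ℤ) :
    ∃ M : Gam m, (orthoHom hm M * U).1.1 5 0 = -(U.1.1 1 0 + k * U.1.1 5 0) := by
  let X := fromBlocks !![0, 0; 0, 1] !![1, 0; 0, 0] !![-1, 0; 0, 0] !![-(k : ℂ), 0; 0, 1]
  have hX : IsSU X := by
    refine ⟨?_, unitary_fromBlocks_iff.2 ⟨?_, ?_, ?_⟩⟩
    · rw [det_four]; simp [extSq, minor, fstIdx, sndIdx, X]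
    all_goals ext i j; fin_cases i <;> fin_cases j <;> simp [Matrix.mul_apply]
  obtain ⟨M, hM⟩ := exists_cmat_eq (m := m) hX (by
    have := int_mem_range m (-k)
    push_cast at this
    rintro (i | i) (j | j) <;> fin_cases i <;> fin_cases j <;>
      simp [X, -RingHom.mem_range, zero_mem, one_mem, this] )
  refine ⟨M, ?_⟩
  have h := orthoHom_mul_five hm M U 0
  rw [hM] at h
  simp [extSq, minor, fstIdx, sndIdx, X] at h
  have h' : (((orthoHom hm M * U).1.1 5 0 : ℤ) : ℂ) = ((-(U.1.1 1 0 + k * U.1.1 5 0) : ℤ) : ℂ) := by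
    push_cast
    refine h.trans ?_
    ring
  exact_mod_cast h'

theorem exists_bottom_two (U : discriminantKernel (S₁ m)) (k : ℤ) :
    ∃ M : Gam m, (orthoHom hm M * U).1.1 5 0 = -(U.1.1 4 0 + k * U.1.1 5 0) := by
  let X := fromBlocks !![1, 0; 0, 0] !![0, 0; 0, 1] !![0, 0; 0, -1] !![1, 0; 0, -(k : ℂ)]
  have hX : IsSU X := by
    refine ⟨?_, unitary_fromBlocks_iff.2 ⟨?_, ?_, ?_⟩⟩
    · rw [det_four]; simp [extSq, minor, fstIdx, sndIdx, X]
    all_goals ext i j; fin_cases i <;> fin_cases j <;> simp [Matrix.mul_apply]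
  obtain ⟨M, hM⟩ := exists_cmat_eq (m := m) hX (by
    have := int_mem_range m (-k)
    push_cast at this
    rintro (i | i) (j | j) <;> fin_cases i <;> fin_cases j <;>
      simp [X, -RingHom.mem_range, zero_mem, one_mem, this] )
  refine ⟨M, ?_⟩
  have h := orthoHom_mul_five hm M U 0
  rw [hM] at h
  simp [extSq, minor, fstIdx, sndIdx, X] at h
  have h' : (((orthoHom hm M * U).1.1 5 0 : ℤ) : ℂ) = ((-(U.1.1 4 0 + k * U.1.1 5 0) : ℤ) : ℂ) := by
    push_cast
    refine h.trans ?_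
    ring
  exact_mod_cast h'

theorem isHermitian_of_entries (a b : ℤ) (t : ℂ) : (!![(a : ℂ), t; conj t, b]).IsHermitian :=
  isHermitian_of_conj (by simp) (by simp) (by simp)

theorem exists_bottom_trans (U : discriminantKernel (S₁ m)) (k l p q : ℤ) :
    ∃ M : Gam m, (orthoHom hm M * U).1.1 5 0 = -U.1.1 0 0 + l * U.1.1 1 0 + k * U.1.1 4 0
      - (2 * p * U.1.1 2 0 + (p * U.1.1 3 0 + q * U.1.1 2 0) * omegaTr m
        + 2 * q * U.1.1 3 0 * omegaNm m)
      + (k * l - (p ^ 2 + p * q * omegaTr m + q ^ 2 * omegaNm m)) * U.1.1 5 0 := by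
  have hs : (p + q * omega m : ℂ) ∈ (toC m).range := (mem_range_iff hm).2 ⟨p, q, rfl⟩
  obtain ⟨M₁, hM₁⟩ := exists_gam_J m
  obtain ⟨M₂, hM₂⟩ := exists_gam_trans (m := m) (isHermitian_of_entries k l (p + q * omega m)) (by
    intro i j
    fin_cases i <;> fin_cases j
    exacts [int_mem_range m k, hs, conj_mem_range hs, int_mem_range m l])
  refine ⟨M₁ * M₂, ?_⟩
  have h := orthoHom_mul_five hm (M₁ * M₂) U 0
  rw [cmat_mul, hM₁, hM₂, J, trans, fromBlocks_multiply] at h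
  generalize orthoHom hm (M₁ * M₂) * U = W at h ⊢
  simp [extSq, minor, fstIdx, sndIdx] at h
  have h1 := omega_add_conj m
  have h2 := omega_mul_conj m
  refine Int.cast_injective (α := ℂ) (h.trans ?_)
  push_cast
  linear_combination (-(p * U.1.1 3 0 + q * U.1.1 2 0 + p * q * U.1.1 5 0 : ℂ)) * h1 -
    (2 * q * U.1.1 3 0 + q ^ 2 * U.1.1 5 0 : ℂ) * h2

/-- If a set of integers contains all `-(a + k y)` and none of its nonzero elements is smaller in
absolute value than `y`, then `y` divides `a`. Here `y = 0` is allowed only if the set has no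
nonzero elements. -/
theorem dvd_of_minimal {s : Set ℤ} {y a : ℤ} (hs : ∀ z ∈ s, z = 0 ∨ (y ≠ 0 ∧ |y| ≤ |z|))
    (h : ∀ k : ℤ, -(a + k * y) ∈ s) : y ∣ a := by
  by_cases hy : y = 0
  · rcases hs _ (h 0) with h1 | h1
    · rw [hy, zero_dvd_iff]
      linarith
    · exact absurd hy h1.1
  · have e : -(a + -(a / y) * y) = -(a % y) := by
      rw [Int.emod_def]; ring
    have h0 := hs _ (h (-(a / y)))
    rw [e, abs_neg, neg_eq_zero] at h0
    rcases h0 with h1 | ⟨-, h1⟩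
    · exact Int.dvd_of_emod_eq_zero h1
    · have := Int.emod_lt_abs a hy
      rw [abs_of_nonneg (Int.emod_nonneg a hy)] at h1
      omega

theorem transpose_mul_S₁_mul (U : discriminantKernel (S₁ m)) : U.1.1ᵀ * S₁ m * U.1.1 = S₁ m := by
  obtain ⟨⟨V, -, hV⟩, -⟩ := U.2
  apply map_intCast_injective
  beta_reduce
  have h := V.2
  have e : (V.1 : Matrix (Fin 6) (Fin 6) ℝ) = U.1.1.map (Int.cast : ℤ → ℝ) :=
    congrArg Subtype.val hV
  change (V.1 : Matrix (Fin 6) (Fin 6) ℝ)ᵀ * (S₁ m).map _ * (V.1 : Matrix (Fin 6) (Fin 6) ℝ) = _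
    at h
  rw [e] at h
  rw [map_intCast_mul, map_intCast_mul, transpose_map, h]

theorem pairing_eq (U : discriminantKernel (S₁ m)) (i j : Fin 6) :
    U.1.1 0 i * U.1.1 5 j + U.1.1 5 i * U.1.1 0 j + U.1.1 1 i * U.1.1 4 j + U.1.1 4 i * U.1.1 1 j
      - (2 * U.1.1 2 i * U.1.1 2 j + (U.1.1 2 i * U.1.1 3 j + U.1.1 3 i * U.1.1 2 j) * omegaTr m
        + 2 * U.1.1 3 i * U.1.1 3 j * omegaNm m) = S₁ m i j := by
  have h := congrFun (congrFun (transpose_mul_S₁_mul U) i) j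
  rw [← h]
  simp only [Matrix.mul_apply, Fin.sum_univ_six, transpose_apply, S₁_eq]
  simp
  ring

/-- If the last coordinate of `U e₁` is minimal in absolute value among the nonzero last coordinates
of all vectors in the `Γ₂(𝒪_K)`-orbit, then it divides all products of `U e₁` with integral vectors,
and hence equals `± 1`. -/
theorem isUnit_of_minimal (U : discriminantKernel (S₁ m))
    (hU : ∀ M : Gam m, (orthoHom hm M * U).1.1 5 0 = 0 ∨
      (U.1.1 5 0 ≠ 0 ∧ |U.1.1 5 0| ≤ |(orthoHom hm M * U).1.1 5 0|)) : IsUnit (U.1.1 5 0) := by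
  have hs : ∀ z ∈ Set.range fun M => (orthoHom hm M * U).1.1 5 0,
      z = 0 ∨ (U.1.1 5 0 ≠ 0 ∧ |U.1.1 5 0| ≤ |z|) := by
    rintro _ ⟨M, rfl⟩
    exact hU M
  obtain ⟨a, ha⟩ := dvd_of_minimal hs (a := U.1.1 1 0) fun k => exists_bottom_one hm U k
  obtain ⟨b, hb⟩ := dvd_of_minimal hs (a := U.1.1 4 0) fun k => exists_bottom_two hm U k
  have hx (p q : ℤ) : U.1.1 5 0 ∣ U.1.1 0 0 + (2 * p * U.1.1 2 0 +
      (p * U.1.1 3 0 + q * U.1.1 2 0) * omegaTr m + 2 * q * U.1.1 3 0 * omegaNm m) := by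
    refine dvd_of_minimal hs fun k => ?_
    -- for `l = 1 - b` the bottom entry depends linearly on the remaining parameter
    obtain ⟨M, hM⟩ := exists_bottom_trans hm U
      (-k - (1 - b) * a + (p ^ 2 + p * q * omegaTr m + q ^ 2 * omegaNm m)) (1 - b) p q
    refine ⟨M, hM.trans ?_⟩
    rw [ha, hb]
    ring
  have h := pairing_eq U 0 5
  have e : S₁ m 0 5 = 1 := by rw [S₁_eq]; rfl
  have h0 : U.1.1 5 0 ∣ U.1.1 0 0 := by simpa using hx 0 0
  have h1 := (Int.dvd_add_right h0).1 (hx (U.1.1 2 5) (U.1.1 3 5))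
  have h1' : U.1.1 5 0 ∣ 2 * U.1.1 2 0 * U.1.1 2 5 + (U.1.1 2 0 * U.1.1 3 5 +
      U.1.1 3 0 * U.1.1 2 5) * omegaTr m + 2 * U.1.1 3 0 * U.1.1 3 5 * omegaNm m :=
    h1.trans (dvd_of_eq (by ring))
  rw [e, ha, hb] at h
  refine isUnit_iff_dvd_one.2 (Dvd.dvd.trans ?_ h.dvd)
  exact dvd_sub (dvd_add (dvd_add (dvd_add (h0.mul_right _) (Dvd.intro _ rfl))
    ((Dvd.intro _ rfl).mul_right _)) ((Dvd.intro _ rfl).mul_right _)) h1'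

theorem exists_isUnit_bottom (U : discriminantKernel (S₁ m)) :
    ∃ M : Gam m, IsUnit ((orthoHom hm M * U).1.1 5 0) := by
  by_cases h : ∃ n : ℕ, n ≠ 0 ∧ ∃ M : Gam m, ((orthoHom hm M * U).1.1 5 0).natAbs = n
  · classical
    obtain ⟨h0, M, hM⟩ := Nat.find_spec h
    refine ⟨M, isUnit_of_minimal hm _ fun M' => ?_⟩
    rw [← mul_assoc, ← map_mul]
    by_cases h1 : (orthoHom hm (M' * M) * U).1.1 5 0 = 0
    · exact Or.inl h1
    · refine Or.inr ⟨fun h2 => h0 (by rw [← hM, h2]; rfl), ?_⟩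
      rw [Int.abs_eq_natAbs, Int.abs_eq_natAbs, hM]
      exact_mod_cast Nat.find_min' h ⟨by simpa using h1, M' * M, rfl⟩
  · push Not at h
    refine ⟨1, isUnit_of_minimal hm _ fun M' => Or.inl ?_⟩
    rw [← mul_assoc, ← map_mul]
    by_contra h1
    exact h _ (by simpa using h1) (M' * 1) rfl

end Orbit

theorem ortho_col_zero (m : ℕ) (X : Matrix (Fin 2 ⊕ Fin 2) (Fin 2 ⊕ Fin 2) ℂ) (i : Fin 6) :
    ortho m X i 0 = ![(extSq X 0 0).re, (extSq X 1 0).re, coordB m (extSq X 2 0),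
      coordC m (extSq X 2 0), (extSq X 4 0).re, (extSq X 5 0).re] i := by
  have h (k : Fin 6) : (extSq X * coordMat m) k 0 = extSq X k 0 := by
    rw [Matrix.mul_apply, Fin.sum_univ_six]; simp [coordMat]
  simp only [ortho, realCoord, of_apply, h]

theorem ortho_col_five (m : ℕ) (X : Matrix (Fin 2 ⊕ Fin 2) (Fin 2 ⊕ Fin 2) ℂ) (i : Fin 6) :
    ortho m X i 5 = ![(extSq X 0 5).re, (extSq X 1 5).re, coordB m (extSq X 2 5),
      coordC m (extSq X 2 5), (extSq X 4 5).re, (extSq X 5 5).re] i := by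
  have h (k : Fin 6) : (extSq X * coordMat m) k 5 = extSq X k 5 := by
    rw [Matrix.mul_apply, Fin.sum_univ_six]; simp [coordMat]
  simp only [ortho, realCoord, of_apply, h]

section Surjective

variable {m : ℕ} (hm : Squarefree m)

/-- A vector of norm zero in `ℤ^6` with last coordinate `y = ± 1` is the image of `e₁`. -/
theorem exists_col_zero (U : discriminantKernel (S₁ m)) (hU : IsUnit (U.1.1 5 0)) :
    ∃ M : Gam m, ∀ i, (orthoHom hm M).1.1 i 0 = U.1.1 i 0 := by
  have h00 := pairing_eq U 0 0
  have e : S₁ m 0 0 = 0 := by rw [S₁_eq]; rfl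
  rw [e] at h00
  generalize hy : U.1.1 5 0 = y at *
  generalize ha : U.1.1 1 0 = a at *
  generalize hb : U.1.1 4 0 = b at *
  generalize hx : U.1.1 0 0 = x at *
  generalize hc : U.1.1 2 0 = c at *
  generalize hd : U.1.1 3 0 = d at *
  have hyy : y * y = 1 := Int.isUnit_mul_self hU
  have hyy' : (y : ℂ) * y = 1 := by exact_mod_cast hyy
  have ht : (c + d * omega m : ℂ) ∈ (toC m).range := (mem_range_iff hm).2 ⟨c, d, rfl⟩
  have hnt : (c + d * omega m : ℂ) * conj (c + d * omega m) =
      ((c ^ 2 + c * d * omegaTr m + d ^ 2 * omegaNm m : ℤ) : ℂ) := by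
    simp
    linear_combination (c * d : ℂ) * omega_add_conj m + (d ^ 2 : ℂ) * omega_mul_conj m
  have hB := coordB_eq hm.ne_zero (c : ℝ) d
  have hC := coordC_eq hm.ne_zero (c : ℝ) d
  have ecast : ((c : ℝ) : ℂ) + ((d : ℝ) : ℂ) * omega m = c + d * omega m := by push_cast; rfl
  rw [ecast] at hB hC
  generalize (c + d * omega m : ℂ) = t at ht hnt hB hC
  let X := fromBlocks !![-(y * a : ℂ), t; -(y * conj t), b] !![1, 0; 0, -(y : ℂ)]
    !![-1, 0; 0, (y : ℂ)] 0
  have hX : IsSU X := by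
    refine ⟨?_, unitary_fromBlocks_iff.2 ⟨?_, ?_, ?_⟩⟩
    · rw [det_four]; simp [extSq, minor, fstIdx, sndIdx, X, hyy']
    all_goals
      ext i j
      fin_cases i <;> fin_cases j <;> simp [Matrix.mul_apply, hyy', mul_comm] <;>
        first | linear_combination t * hyy' | linear_combination (-conj t) * hyy'
  obtain ⟨M, hM⟩ := exists_cmat_eq (m := m) hX (by
    have hy' := int_mem_range m y
    have ha' := int_mem_range m a
    have hb' := int_mem_range m b
    have hct := conj_mem_range ht
    rintro (i | i) (j | j) <;> fin_cases i <;> fin_cases j <;>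
      simp [X, -RingHom.mem_range, zero_mem, one_mem, hy', hb', ht, mul_mem hy' ha',
        mul_mem hy' hct])
  refine ⟨M, fun i => Int.cast_injective (α := ℝ) ?_⟩
  have h1 := congrFun (congrFun (orthoHom_map hm M) i) 0
  rw [ortho_col_zero, hM] at h1
  refine h1.trans ?_
  have hW0 : extSq X 0 0 = x := by
    have h2 : x = -y * (a * b - (c ^ 2 + c * d * omegaTr m + d ^ 2 * omegaNm m)) := by
      have h3 : x * y + a * b - (c ^ 2 + c * d * omegaTr m + d ^ 2 * omegaNm m) = 0 := by linarith
      linear_combination (-x) * hyy + y * h3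
    rw [h2]
    simp only [extSq, minor, fstIdx, sndIdx, X]
    simp
    push_cast at hnt
    linear_combination (y : ℂ) * hnt
  have hW1 : extSq X 1 0 = a := by
    simp [extSq, minor, fstIdx, sndIdx, X]
    linear_combination (a : ℂ) * hyy'
  have hW2 : extSq X 2 0 = t := by simp [extSq, minor, fstIdx, sndIdx, X]
  have hW4 : extSq X 4 0 = b := by
    simp [extSq, minor, fstIdx, sndIdx, X]
  have hW5 : extSq X 5 0 = y := by simp [extSq, minor, fstIdx, sndIdx, X]
  rw [hW0, hW1, hW2, hW4, hW5, hB, hC]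
  fin_cases i
  · simp [hx]
  · simp [ha]
  · simp [hc]
  · simp [hd]
  · simp [hb]
  · simp [hy]

/-- An isometry fixing `e₁` maps `e₆` to the image of `e₆` under a translation. -/
theorem exists_col_five (U : discriminantKernel (S₁ m))
    (hU : ∀ i, U.1.1 i 0 = (1 : Matrix (Fin 6) (Fin 6) ℤ) i 0) :
    ∃ M : Gam m, (∀ i, (orthoHom hm M).1.1 i 0 = (1 : Matrix (Fin 6) (Fin 6) ℤ) i 0) ∧
      ∀ i, (orthoHom hm M).1.1 i 5 = U.1.1 i 5 := by
  have h05 := pairing_eq U 0 5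
  have h55 := pairing_eq U 5 5
  have e : S₁ m 0 5 = 1 ∧ S₁ m 5 5 = 0 := by rw [S₁_eq]; exact ⟨rfl, rfl⟩
  rw [e.1] at h05
  rw [e.2] at h55
  simp [hU] at h05
  rw [h05] at h55
  generalize ha : U.1.1 1 5 = a at *
  generalize hb : U.1.1 4 5 = b at *
  generalize hx : U.1.1 0 5 = x at *
  generalize hc : U.1.1 2 5 = c at *
  generalize hd : U.1.1 3 5 = d at *
  have ht : (c + d * omega m : ℂ) ∈ (toC m).range := (mem_range_iff hm).2 ⟨c, d, rfl⟩
  have hnt : (c + d * omega m : ℂ) * conj (c + d * omega m) =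
      ((c ^ 2 + c * d * omegaTr m + d ^ 2 * omegaNm m : ℤ) : ℂ) := by
    simp
    linear_combination (c * d : ℂ) * omega_add_conj m + (d ^ 2 : ℂ) * omega_mul_conj m
  have hB := coordB_eq hm.ne_zero (c : ℝ) d
  have hC := coordC_eq hm.ne_zero (c : ℝ) d
  have ecast : ((c : ℝ) : ℂ) + ((d : ℝ) : ℂ) * omega m = c + d * omega m := by push_cast; rfl
  rw [ecast] at hB hC
  generalize (c + d * omega m : ℂ) = t at ht hnt hB hC
  obtain ⟨M, hM⟩ := exists_gam_trans (m := m) (isHermitian_of_entries a b t) (by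
    intro i j
    fin_cases i <;> fin_cases j
    exacts [int_mem_range m a, ht, conj_mem_range ht, int_mem_range m b])
  refine ⟨M, fun i => Int.cast_injective (α := ℝ) ?_, fun i => Int.cast_injective (α := ℝ) ?_⟩
  · refine (congrFun (congrFun (orthoHom_map hm M) i) 0).trans ?_
    rw [ortho_col_zero, hM]
    fin_cases i <;> simp [extSq, minor, fstIdx, sndIdx, trans, coordB, coordC]
    exact Int.cast_one.symm
  · refine (congrFun (congrFun (orthoHom_map hm M) i) 5).trans ?_
    have hW0 : extSq (trans !![(a : ℂ), t; conj t, b]) 0 5 = x := by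
      have h2 : x = -(a * b - (c ^ 2 + c * d * omegaTr m + d ^ 2 * omegaNm m)) := by linarith
      rw [h2]
      simp only [extSq, minor, fstIdx, sndIdx, trans]
      simp
      push_cast at hnt
      linear_combination hnt
    have hW1 : extSq (trans !![(a : ℂ), t; conj t, b]) 1 5 = a := by
      simp [extSq, minor, fstIdx, sndIdx, trans]
    have hW2 : extSq (trans !![(a : ℂ), t; conj t, b]) 2 5 = t := by
      simp [extSq, minor, fstIdx, sndIdx, trans]
    have hW4 : extSq (trans !![(a : ℂ), t; conj t, b]) 4 5 = b := by
      simp [extSq, minor, fstIdx, sndIdx, trans]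
    have hW5 : extSq (trans !![(a : ℂ), t; conj t, b]) 5 5 = 1 := by
      simp [extSq, minor, fstIdx, sndIdx, trans]
    rw [ortho_col_five, hM, hW0, hW1, hW2, hW4, hW5, hB, hC]
    fin_cases i
    · simp [hx]
    · simp [ha]
    · simp [hc]
    · simp [hd]
    · simp [hb]
    · simp [h05]

theorem inv_mul_col {T U : discriminantKernel (S₁ m)} {j : Fin 6}
    (h : ∀ i, T.1.1 i j = U.1.1 i j) (i : Fin 6) :
    (T⁻¹ * U).1.1 i j = (1 : Matrix (Fin 6) (Fin 6) ℤ) i j := by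
  have h1 : (T⁻¹).1.1 * T.1.1 = 1 := congrArg (fun V => V.1.1) (inv_mul_cancel T)
  change ((T⁻¹).1.1 * U.1.1) i j = _
  rw [← h1, Matrix.mul_apply, Matrix.mul_apply]
  simp only [h]

theorem mem_range_of_fix_two (U : discriminantKernel (S₁ m))
    (h0 : ∀ i, U.1.1 i 0 = (1 : Matrix (Fin 6) (Fin 6) ℤ) i 0)
    (h5 : ∀ i, U.1.1 i 5 = (1 : Matrix (Fin 6) (Fin 6) ℤ) i 5) : U ∈ (orthoHom hm).range := by
  have hV : (U.1.1.map (Int.cast : ℤ → ℝ))ᵀ * (S₁ m).map (Int.cast : ℤ → ℝ) *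
      U.1.1.map (Int.cast : ℤ → ℝ) = (S₁ m).map (Int.cast : ℤ → ℝ) := by
    have := congrArg (fun X => X.map (Int.cast : ℤ → ℝ)) (transpose_mul_S₁_mul U)
    beta_reduce at this
    rwa [map_intCast_mul, map_intCast_mul] at this
  have hd : (U.1.1.map (Int.cast : ℤ → ℝ)).det = 1 :=
    (SpecialLinearGroup.map (Int.castRingHom ℝ) U.1).2
  have hone (i j : Fin 6) : (((1 : Matrix (Fin 6) (Fin 6) ℤ) i j : ℤ) : ℝ) =
      (1 : Matrix (Fin 6) (Fin 6) ℝ) i j := by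
    by_cases h : i = j <;> simp [Matrix.one_apply, h]
  have hpos : 0 < (posGram m (U.1.1.map (Int.cast : ℤ → ℝ))).det :=
    det_posGram_pos (U := SpecialLinearGroup.map (Int.castRingHom ℝ) U.1) U.2.1
  obtain ⟨A, hA, hAV⟩ := exists_levi_of_fix_two hm.ne_zero hV hd hpos
    (fun i => by rw [← hone, ← h0 i, map_apply]) (fun i => by rw [← hone, ← h5 i, map_apply])
  have hsu : IsSU (levi A) := isSU_levi (by rw [hA]; exact one_ne_zero) (by rw [hA]; simp)
  obtain ⟨Y, hY⟩ := U.2.2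
  have hdef := defect_eq hm.ne_zero hsu (Y := Y) (by rw [← hY, hAV])
  have hc := (defect_dvd_iff hm (f := fun _ _ => 1) (fun _ => rfl) (fun _ => rfl) hsu).1
    (fun i j => ⟨Y i j, by rw [hdef]; simp⟩)
  have hmem := mem_range_of_defectCong_levi hm hA hc
  obtain ⟨M, hM⟩ := exists_cmat_eq (m := m) hsu (by
    rw [levi_eq_of_det_one hA]
    rintro (i | i) (j | j)
    · exact hmem i j
    · exact zero_mem _
    · exact zero_mem _
    · fin_cases i <;> fin_cases j
      exacts [conj_mem_range (hmem 1 1), neg_mem (conj_mem_range (hmem 1 0)),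
        neg_mem (conj_mem_range (hmem 0 1)), conj_mem_range (hmem 0 0)])
  refine ⟨M, Subtype.ext (Subtype.ext (map_intCast_injective ?_))⟩
  exact (orthoHom_map hm M).trans (by rw [hM, hAV])

theorem orthoHom_surjective : Function.Surjective (orthoHom hm) := by
  rw [← MonoidHom.range_eq_top, eq_top_iff]
  rintro U -
  obtain ⟨M₁, h1⟩ := exists_isUnit_bottom hm U
  obtain ⟨M₂, h2⟩ := exists_col_zero hm _ h1
  have h3 := inv_mul_col h2
  obtain ⟨M₃, h4, h5⟩ := exists_col_five hm _ h3
  have h6 := mem_range_of_fix_two hm ((orthoHom hm M₃)⁻¹ *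
    ((orthoHom hm M₂)⁻¹ * (orthoHom hm M₁ * U)))
    (inv_mul_col fun i => by rw [h4, h3]) (inv_mul_col h5)
  have hr (M : Gam m) : orthoHom hm M ∈ (orthoHom hm).range := ⟨M, rfl⟩
  exact (mul_mem_cancel_left (hr M₁)).1 ((mul_mem_cancel_left (inv_mem (hr M₂))).1
    ((mul_mem_cancel_left (inv_mem (hr M₃))).1 h6))

end Surjective

/-! ### The principal congruence subgroups -/

/-- For an element of `Γ₂(𝒪_K)`, `DefectCong` says that `M̃ ∈ I + Y S₁` with prescribed divisors of
the entries of `Y`. -/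
theorem defectCong_iff_exists {m : ℕ} (hm : Squarefree m) {f : Fin 6 → Fin 6 → ℕ}
    (hf : ∀ j, f 3 j = f 2 j) (hf' : ∀ i, f i 3 = f i 2) (M : Gam m) :
    DefectCong m f (cmat M) ↔ ∃ Y : Matrix (Fin 6) (Fin 6) ℤ,
      (orthoHom hm M).1.1 = 1 + Y * S₁ m ∧ ∀ i j, (f i j : ℤ) ∣ Y i j := by
  rw [← defect_dvd_iff hm hf hf' (isSU_cmat M)]
  have hdef {Y : Matrix (Fin 6) (Fin 6) ℤ} (hY : (orthoHom hm M).1.1 = 1 + Y * S₁ m) :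
      defect m (cmat M) = Y.map (Int.cast : ℤ → ℝ) :=
    defect_eq hm.ne_zero (isSU_cmat M) (by rw [← hY, orthoHom_map])
  obtain ⟨Y, hY⟩ := (orthoHom hm M).2.2
  constructor
  · refine fun h => ⟨Y, hY, fun i j => ?_⟩
    obtain ⟨k, hk⟩ := h i j
    rw [hdef hY, Matrix.map_apply] at hk
    exact ⟨k, by exact_mod_cast hk⟩
  · rintro ⟨Y', hY', h⟩ i j
    obtain ⟨k, hk⟩ := h i j
    exact ⟨k, by rw [hdef hY', Matrix.map_apply, hk]; push_cast; rfl⟩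

theorem extSq_congMod_one {m N : ℕ} (hm : m ≠ 0) {M : Gam m}
    (h : DefectCong m (fun _ _ => N) (cmat M))
    (i j : Fin 6) : CongMod m N (extSq (cmat M) i j) ((1 : Matrix (Fin 6) (Fin 6) ℂ) i j) := by
  obtain ⟨h1, h2, h3, h4⟩ := h
  have hW22 : CongMod m N (extSq (cmat M) 2 2) 1 := by
    have hδ : diffGen m ∈ (toC m).range :=
      sub_mem (omega_mem_range m) (conj_mem_range (omega_mem_range m))
    have h5 := ((h4.mul_left hδ).add h3)
    rw [mul_div_cancel₀ _ (diffGen_ne_zero hm), add_zero, sub_right_comm, sub_add_cancel] at h5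
    exact CongMod.sub_iff.1 h5
  have hrow (i : Fin 6) (hi : i ≠ 3) : ∀ j, CongMod m N (extSq (cmat M) i j)
      ((1 : Matrix (Fin 6) (Fin 6) ℂ) i j) := by
    have c2 : CongMod m N (extSq (cmat M) i 2) ((1 : Matrix (Fin 6) (Fin 6) ℂ) i 2) := by
      by_cases hi2 : i = 2
      · subst hi2; simpa using hW22
      · rw [Matrix.one_apply_ne hi2]; exact h2 i hi2 hi
    have c3 : CongMod m N (extSq (cmat M) i 3) ((1 : Matrix (Fin 6) (Fin 6) ℂ) i 3) := by
      rw [Matrix.one_apply_ne hi]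
      by_cases hi2 : i = 2
      · subst hi2; exact h3
      · have e : extSq (cmat M) i 3 = conj (extSq (cmat M) i 2) := by
          rw [conj_extSq (isSU_cmat M).1 (isSU_cmat M).2]
          congr 1
          exact (by decide : ∀ i : Fin 6, i ≠ 3 → i ≠ 2 → i = swapIdx i) i hi hi2
        rw [e]
        exact (h2 i hi2 hi).conj_zero
    intro j
    by_cases hj2 : j = 2
    · subst hj2; exact c2
    · by_cases hj3 : j = 3
      · subst hj3; exact c3
      · exact h1 i hi j hj2 hj3
  by_cases hi : i = 3
  · subst hi
    have e : extSq (cmat M) 3 j = conj (extSq (cmat M) 2 (swapIdx j)) := by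
      rw [conj_extSq (isSU_cmat M).1 (isSU_cmat M).2]
      congr 1
      revert j; decide
    have e' : (1 : Matrix (Fin 6) (Fin 6) ℂ) 3 j =
        conj ((1 : Matrix (Fin 6) (Fin 6) ℂ) 2 (swapIdx j)) := by
      fin_cases j <;> simp [swapIdx, Matrix.one_apply]
    rw [e, e']
    exact (hrow 2 (by decide) _).conj
  · exact hrow i hi j

theorem congMod_iff_mk {m N : ℕ} {x y : 𝓞 (K m)} : CongMod m N (toC m x) (toC m y) ↔
    Ideal.Quotient.mk (Ideal.span {(N : 𝓞 (K m))}) x = Ideal.Quotient.mk _ y := by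
  have hinj : Function.Injective (toC m) := fun x y h => Subtype.ext (Subtype.ext h)
  rw [Ideal.Quotient.eq, Ideal.mem_span_singleton]
  constructor
  · rintro ⟨z, hz⟩
    exact ⟨z, hinj (by simpa using hz)⟩
  · rintro ⟨z, hz⟩
    exact ⟨z, by rw [← map_sub, hz]; simp⟩

/-- If the exterior square of `M` is trivial modulo `N`, then `M` is scalar modulo `N`: the entries
are compared in the quotient ring `𝒪_K / N 𝒪_K`. -/
theorem congMod_scalar {m N : ℕ} {M : Gam m} (h : ∀ i j,
    CongMod m N (extSq (cmat M) i j) ((1 : Matrix (Fin 6) (Fin 6) ℂ) i j)) :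
    CongMod m N (blkD M 0 0 ^ 2) 1 ∧
    ∀ i j, CongMod m N (cmat M i j) (if i = j then blkD M 0 0 else 0) := by
  set q := Ideal.Quotient.mk (Ideal.span {(N : 𝓞 (K m))}) with hq
  have hX (I J : Fin 6) :
      (M.1.1.map q) (fstIdx I) (fstIdx J) * (M.1.1.map q) (sndIdx I) (sndIdx J) -
      (M.1.1.map q) (fstIdx I) (sndIdx J) * (M.1.1.map q) (sndIdx I) (fstIdx J) =
        (1 : Matrix (Fin 6) (Fin 6) _) I J := by
    have e : (1 : Matrix (Fin 6) (Fin 6) ℂ) I J =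
        toC m ((1 : Matrix (Fin 6) (Fin 6) (𝓞 (K m))) I J) := by
      by_cases hIJ : I = J <;> simp [Matrix.one_apply, hIJ]
    have e' : extSq (cmat M) I J = toC m (
        M.1.1 (fstIdx I) (fstIdx J) * M.1.1 (sndIdx I) (sndIdx J) -
        M.1.1 (fstIdx I) (sndIdx J) * M.1.1 (sndIdx I) (fstIdx J)) := by
      rw [map_sub, map_mul, map_mul]; rfl
    have h1 := h I J
    rw [e, e', congMod_iff_mk, ← hq] at h1
    simp only [map_sub, map_mul] at h1
    rw [Matrix.map_apply, Matrix.map_apply, Matrix.map_apply, Matrix.map_apply, h1]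
    by_cases hIJ : I = J <;> simp [Matrix.one_apply, hIJ]
  obtain ⟨hoff, hdiag⟩ := diagonal_of_minors hX
  obtain ⟨hsq, hall⟩ := diag_eq_of_mul_eq_one (x := fun i => M.1.1.map q i i) hdiag
  constructor
  · have e : blkD M 0 0 ^ 2 = toC m (M.1.1 (.inr 0) (.inr 0) ^ 2) := by rw [map_pow]; rfl
    rw [e, ← map_one (toC m), congMod_iff_mk, ← hq, map_pow, map_one, ← hsq]
    exact congrArg (· ^ 2) (hall (.inr 0))
  · intro i j
    have e : (if i = j then blkD M 0 0 else 0) =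
        toC m (if i = j then M.1.1 (.inr 0) (.inr 0) else 0) := by
      split_ifs
      · rfl
      · simp
    have e' : cmat M i j = toC m (M.1.1 i j) := rfl
    rw [e, e', congMod_iff_mk, ← hq]
    split_ifs with hij
    · subst hij
      exact (hall i).trans (hall (.inr 0)).symm
    · rw [map_zero]; exact hoff i j hij

theorem congMod_sub_conj_div_of_int {m N : ℕ} (hm : Squarefree m) {x : ℂ} {e : ℤ}
    (h : CongMod m N x e) : CongMod m N ((x - conj x) / diffGen m) 0 := by
  have := congMod_sub_conj_div hm (CongMod.sub_iff.2 h)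
  rwa [map_sub, map_intCast, sub_sub_sub_cancel_right] at this

/-- The last congruence in `DefectCong` follows from congruences between the entries of `M`. -/
theorem congMod_different {m N : ℕ} (hm : Squarefree m) {M : Gam m}
    (h : CongMod m N ((blkD M 0 0 - conj (blkD M 0 0)) / diffGen m) 0)
    (hD : CongMod m N (blkD M 0 1) 0) (hC : ∀ j, CongMod m N (blkC M 0 j) 0) :
    CongMod m N ((extSq (cmat M) 2 2 - extSq (cmat M) 2 3 - 1) / diffGen m) 0 := by
  have hb := blk_mem M
  rw [extSq_two_two_sub, sub_div, sub_div, add_div, mul_div_assoc, mul_div_assoc, mul_div_assoc,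
    mul_div_assoc]
  have h0 := ((h.mul_left (hb 0 0).1).add ((congMod_sub_conj_div hm hD).mul_left (hb 0 1).1)).sub
    ((congMod_sub_conj_div hm (hC 0)).mul_left (hb 0 0).2.1)
  simpa using h0.sub ((congMod_sub_conj_div hm (hC 1)).mul_left (hb 0 1).2.1)

/-- A scalar `α` with `M ≡ α I` modulo `N` satisfies `α² ≡ 1`; the last congruence of `DefectCong`
forces it to be congruent to a rational integer. -/
theorem mem_principalSubgroup_iff {m N : ℕ} (hm : Squarefree m) {M : Gam m} :
    M ∈ principalSubgroup m N ↔ DefectCong m (fun _ _ => N) (cmat M) := by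
  constructor
  · rintro ⟨ε, hε, h⟩
    have hε' : CongMod m N ((ε : ℂ) ^ 2) 1 := by
      obtain ⟨k, hk⟩ := hε.symm.dvd
      exact ⟨k, by rw [map_intCast]; exact_mod_cast hk⟩
    have hext (i j : Fin 6) : CongMod m N (extSq (cmat M) i j)
        ((1 : Matrix (Fin 6) (Fin 6) ℂ) i j) := by
      have he (x y : Fin 2 ⊕ Fin 2) : (if x = y then (ε : ℂ) else 0) ∈ (toC m).range := by
        split_ifs
        exacts [int_mem_range m ε, zero_mem _]
      have h1 := (CongMod.mul (cmat_mem M _ _) (he _ _) (h (fstIdx i) (fstIdx j))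
        (h (sndIdx i) (sndIdx j))).sub (CongMod.mul (cmat_mem M _ _) (he _ _)
        (h (fstIdx i) (sndIdx j)) (h (sndIdx i) (fstIdx j)))
      refine CongMod.trans (y := (ε : ℂ) ^ 2 * (1 : Matrix (Fin 6) (Fin 6) ℂ) i j) ?_ ?_
      · refine Eq.subst (motive := fun z => CongMod m N (extSq (cmat M) i j) z) ?_ h1
        have e := congrFun (congrFun extSq_one i) j
        rw [← e, extSq, of_apply, minor]
        simp only [Matrix.one_apply]
        split_ifs <;> ring
      · have h2 := CongMod.mul (x' := (1 : Matrix (Fin 6) (Fin 6) ℂ) i j)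
          (y' := (1 : Matrix (Fin 6) (Fin 6) ℂ) i j)
          (pow_mem (int_mem_range m ε) 2) (by
            rw [Matrix.one_apply]; split_ifs; exacts [one_mem _, zero_mem _]) hε' (CongMod.refl _)
        rwa [one_mul] at h2
    have hC (i j) : CongMod m N (blkC M i j) 0 := by simpa using! h (.inr i) (.inl j)
    refine ⟨fun i _ j _ _ => hext i j, fun i h2 _ => ?_, ?_, congMod_different hm ?_ ?_ (hC 0)⟩
    · have := hext i 2
      rwa [Matrix.one_apply_ne h2] at this
    · exact hext 2 3
    · exact congMod_sub_conj_div_of_int hm (e := ε) (by simpa using! h (.inr 0) (.inr 0))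
    · simpa using! h (.inr 0) (.inr 1)
  · intro h
    obtain ⟨hsq, hsc⟩ := congMod_scalar (extSq_congMod_one hm.ne_zero h)
    obtain ⟨-, -, -, h4⟩ := h
    have hA : CongMod m N (blkA M 0 0) (blkD M 0 0) := by simpa using! hsc (.inl 0) (.inl 0)
    have hC (j) : CongMod m N (blkC M 0 j) 0 := by simpa using! hsc (.inr 0) (.inl j)
    have hD : CongMod m N (blkD M 0 1) 0 := by simpa using! hsc (.inr 0) (.inr 1)
    have hb := blk_mem M
    obtain ⟨u, v, huv⟩ := (mem_range_iff hm).1 (hb 0 0).2.2.2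
    have hv : (blkD M 0 0 - conj (blkD M 0 0)) / diffGen m = v := by
      rw [div_eq_iff (diffGen_ne_zero hm.ne_zero), huv, diffGen]
      simp; ring
    have hv' : CongMod m N (v : ℂ) 0 := by
      -- `M ≡ α I` with `α = d₁₁`, so that `α (α - ᾱ)` is a multiple of the different
      rw [extSq_two_two_sub, sub_div, sub_div, add_div, mul_div_assoc, mul_div_assoc,
        mul_div_assoc, mul_div_assoc, hv] at h4
      have h5 := ((congMod_sub_conj_div hm hD).mul_left (hb 0 1).1)
      have h6 := ((congMod_sub_conj_div hm (hC 0)).mul_left (hb 0 0).2.1)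
      have h7 := ((congMod_sub_conj_div hm (hC 1)).mul_left (hb 0 1).2.1)
      have h8 := ((h4.add h7).add h6).sub h5
      have h9 : CongMod m N (blkA M 0 0 * v) 0 := by
        convert h8 using 1 <;> ring
      have h10 := CongMod.mul (int_mem_range m v) (hb 0 0).2.2.2 (CongMod.refl (v : ℂ)) hA
      have h11 := (h10.symm.trans (by rw [mul_comm]; exact h9)).mul_left (hb 0 0).2.2.2
      have h12 := CongMod.mul (int_mem_range m v) (one_mem _) (CongMod.refl (v : ℂ)) hsq
      refine CongMod.trans (y := v * blkD M 0 0 ^ 2) (by rw [mul_one] at h12; exact h12.symm) ?_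
      convert h11 using 1; ring
    have hu : CongMod m N (blkD M 0 0) u := by
      rw [← CongMod.sub_iff, huv, add_sub_cancel_left]
      exact hv'.mul_right (omega_mem_range m)
    refine ⟨u, ?_, fun i j => (hsc i j).trans ?_⟩
    · have h1 := (CongMod.mul (hb 0 0).2.2.2 (int_mem_range m u) hu hu).symm.trans
        (by rw [← pow_two]; exact hsq)
      rw [← CongMod.sub_iff] at h1
      have h2 := ((congMod_zero_iff_dvd hm (N := N) (a := u * u - 1) (b := 0)).1
        (by push_cast; simpa using! h1)).1
      rw [← pow_two] at h2
      exact (Int.modEq_iff_dvd.2 h2).symm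
    · split_ifs
      exacts [hu, CongMod.refl _]

/-! ### Transport of identity components -/

section Component

variable {ι : Type*} [Fintype ι] [DecidableEq ι]

theorem map_mem_specialOrthogonal₀ {T T' : Matrix ι ι ℤ}
    {g : SpecialLinearGroup ι ℝ → SpecialLinearGroup ι ℝ} (hg : Continuous g) (h1 : g 1 = 1)
    (hT : ∀ U ∈ specialOrthogonal T, g U ∈ specialOrthogonal T') {U : SpecialLinearGroup ι ℝ}
    (hU : U ∈ specialOrthogonal₀ T) : g U ∈ specialOrthogonal₀ T' := by
  obtain ⟨V, hV, rfl⟩ := hU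
  let g' : specialOrthogonal T → specialOrthogonal T' := fun V => ⟨g V.1, hT _ V.2⟩
  have hg' : Continuous g' := Continuous.subtype_mk (hg.comp continuous_subtype_val) _
  have h2 := hg'.image_connectedComponent_subset 1 (Set.mem_image_of_mem g' hV)
  have e : g' 1 = 1 := Subtype.ext h1
  rw [e] at h2
  exact ⟨g' V, h2, rfl⟩

theorem specialOrthogonal_smul {N : ℤ} (hN : N ≠ 0) (T : Matrix ι ι ℤ) :
    specialOrthogonal (N • T) = specialOrthogonal T := by
  have hN' : (N : ℝ) ≠ 0 := Int.cast_ne_zero.2 hN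
  have e : (N • T).map (Int.cast : ℤ → ℝ) = (N : ℝ) • T.map (Int.cast : ℤ → ℝ) := by
    ext i j
    rw [Matrix.map_apply, Matrix.smul_apply, Matrix.smul_apply, Matrix.map_apply, smul_eq_mul,
      smul_eq_mul, Int.cast_mul]
  ext U
  change _ * (N • T).map _ * _ = (N • T).map _ ↔ _ * T.map _ * _ = T.map _
  rw [e, Matrix.mul_smul, Matrix.smul_mul]
  exact (smul_right_injective _ hN').eq_iff

theorem specialOrthogonal₀_smul {N : ℤ} (hN : N ≠ 0) (T : Matrix ι ι ℤ) :
    specialOrthogonal₀ (N • T) = specialOrthogonal₀ T := by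
  have h := specialOrthogonal_smul hN T
  ext U
  constructor <;> refine map_mem_specialOrthogonal₀ (g := id) continuous_id rfl fun U hU => ?_
  · rwa [h] at hU
  · rwa [h]

/-- Conjugation by a real matrix transports the identity components of orthogonal groups. -/
theorem conj_mem_specialOrthogonal₀ {T T' : Matrix ι ι ℤ} {P Q : Matrix ι ι ℝ} (h : P * Q = 1)
    (hT : T'.map (Int.cast : ℤ → ℝ) = Qᵀ * T.map (Int.cast : ℤ → ℝ) * Q)
    {U U' : SpecialLinearGroup ι ℝ} (hU' : (U' : Matrix ι ι ℝ) = P * (U : Matrix ι ι ℝ) * Q)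
    (hU : U ∈ specialOrthogonal₀ T) : U' ∈ specialOrthogonal₀ T' := by
  have hdet : P.det * Q.det = 1 := by rw [← det_mul, h, det_one]
  let g : SpecialLinearGroup ι ℝ → SpecialLinearGroup ι ℝ := fun V =>
    ⟨P * (V : Matrix ι ι ℝ) * Q, by rw [det_mul, det_mul, V.2, mul_one, hdet]⟩
  have hg : Continuous g := Continuous.subtype_mk
    ((continuous_const.matrix_mul continuous_subtype_val).matrix_mul continuous_const) _
  have e : U' = g U := Subtype.ext hU'
  rw [e]
  refine map_mem_specialOrthogonal₀ hg (Subtype.ext ?_) (fun V hV => ?_) hU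
  · change P * 1 * Q = 1
    rw [Matrix.mul_one, h]
  · change (P * (V : Matrix ι ι ℝ) * Q)ᵀ * T'.map _ * (P * (V : Matrix ι ι ℝ) * Q) = T'.map _
    have hV' : (V : Matrix ι ι ℝ)ᵀ * T.map (Int.cast : ℤ → ℝ) * (V : Matrix ι ι ℝ) =
      T.map (Int.cast : ℤ → ℝ) := hV
    have h1 : Q * P = 1 := mul_eq_one_comm.1 h
    have h2 : Pᵀ * Qᵀ = 1 := by rw [← transpose_mul, h1, transpose_one]
    rw [hT, transpose_mul, transpose_mul]
    calc Qᵀ * ((V : Matrix ι ι ℝ)ᵀ * Pᵀ) * (Qᵀ * T.map (Int.cast : ℤ → ℝ) * Q) *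
          (P * (V : Matrix ι ι ℝ) * Q) = Qᵀ * (V : Matrix ι ι ℝ)ᵀ * (Pᵀ * Qᵀ) *
          T.map (Int.cast : ℤ → ℝ) * (Q * P) * (V : Matrix ι ι ℝ) * Q := by
          simp only [Matrix.mul_assoc]
      _ = Qᵀ * ((V : Matrix ι ι ℝ)ᵀ * T.map (Int.cast : ℤ → ℝ) * (V : Matrix ι ι ℝ)) * Q := by
          rw [h1, h2, Matrix.mul_one, Matrix.mul_one]
          simp only [Matrix.mul_assoc]
      _ = _ := by rw [hV']

end Component

/-! ### The isomorphism -/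

theorem discriminantKernel_smul_eq_map {m : ℕ} (hm : Squarefree m) {N : ℕ} (hN : N ≠ 0) :
    discriminantKernel ((N : ℤ) • S₁ m) =
      (principalSubgroup m N).map ((discriminantKernel (S₁ m)).subtype.comp (orthoHom hm)) := by
  have hN' : (N : ℤ) ≠ 0 := by exact_mod_cast hN
  ext U
  constructor
  · rintro ⟨hU, Y, hY⟩
    have hmem : U ∈ discriminantKernel (S₁ m) := by
      refine ⟨?_, (N : ℤ) • Y, by rw [hY, Matrix.mul_smul, Matrix.smul_mul]⟩
      change _ ∈ specialOrthogonal₀ (S₁ m)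
      rw [← specialOrthogonal₀_smul hN']
      exact hU
    obtain ⟨M, hM⟩ := orthoHom_surjective hm ⟨U, hmem⟩
    refine ⟨M, (mem_principalSubgroup_iff hm).2 ?_, congrArg Subtype.val hM⟩
    refine (defectCong_iff_exists hm (fun _ => rfl) (fun _ => rfl) M).2
      ⟨(N : ℤ) • Y, ?_, fun i j => Dvd.intro _ rfl⟩
    rw [hM, Matrix.smul_mul, ← Matrix.mul_smul, ← hY]
  · rintro ⟨M, hM, rfl⟩
    obtain ⟨Y, hY, hd⟩ := (defectCong_iff_exists hm (fun _ => rfl) (fun _ => rfl) M).1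
      ((mem_principalSubgroup_iff hm).1 hM)
    choose Z hZ using hd
    refine ⟨?_, of Z, ?_⟩
    · change _ ∈ specialOrthogonal₀ ((N : ℤ) • S₁ m)
      rw [specialOrthogonal₀_smul hN']
      exact (orthoHom hm M).2.1
    · refine hY.trans ?_
      have e : Y = (N : ℤ) • of Z := by ext i j; exact hZ i j
      rw [e, Matrix.smul_mul, Matrix.mul_smul]

theorem pmOne_le_principalSubgroup (m N : ℕ) : pmOne m ≤ principalSubgroup m N := by
  rintro M (h | h)
  · refine ⟨1, by simp, fun i j => ?_⟩
    rw [h, Matrix.one_apply]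
    simpa using CongMod.refl _
  · refine ⟨-1, by simp, fun i j => ?_⟩
    rw [h, Matrix.neg_apply, Matrix.one_apply]
    split_ifs <;> simpa using CongMod.refl _

theorem pmOne_le_mixedSubgroup (m : ℕ) {n N : ℕ} (hn : n ∣ N) :
    pmOne m ≤ mixedSubgroup m n N hn := by
  rintro M (h | h)
  · have : M = 1 := cmat_injective m (h.trans (cmat_one m).symm)
    rw [this]
    exact one_mem _
  · have hA : blkA M = -1 ∧ blkB M = 0 ∧ blkC M = 0 ∧ blkD M = -1 := by
      rw [cmat_eq, ← fromBlocks_one, fromBlocks_neg, fromBlocks_inj] at h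
      simpa using h
    obtain ⟨hA, hB, hC, hD⟩ := hA
    refine ⟨⟨-1, ?_⟩, ?_⟩ <;> simp [hA, hB, hC, hD, CongMod.refl, det_fin_two]

/-- The isomorphism `Γ₂(𝒪_K)/{±I} ≃ 𝒟(S₁; ℤ)`. -/
def orthoEquiv {m : ℕ} (hm : Squarefree m) : (Gam m ⧸ pmOne m) ≃* discriminantKernel (S₁ m) :=
  (QuotientGroup.quotientMulEquivOfEq (ker_orthoHom hm).symm).trans
    (QuotientGroup.quotientKerEquivOfSurjective _ (orthoHom_surjective hm))

theorem orthoEquiv_mk {m : ℕ} (hm : Squarefree m) (M : Gam m) :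
    orthoEquiv hm (QuotientGroup.mk M) = orthoHom hm M := rfl

/-- The image of `H/{±I}` under the isomorphism is the image of `H` under the homomorphism. -/
theorem map_modPm {m : ℕ} (hm : Squarefree m) (H : Subgroup (Gam m)) {G : Type*} [Group G]
    (g : discriminantKernel (S₁ m) →* G) :
    (modPm H).map (g.comp (orthoEquiv hm).toMonoidHom) = H.map (g.comp (orthoHom hm)) := by
  rw [modPm, Subgroup.map_map]
  rfl

/-! ### Conjugation by `diag(1, 1, 1, 1, n, N)` -/

/-- The diagonal entries of `F = diag(1, 1, 1, 1, n, N)`. -/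
def levelVec (n N : ℕ) : Fin 6 → ℕ := ![1, 1, 1, 1, n, N]

/-- The integral matrix `F = diag(1, 1, 1, 1, n, N)`. -/
def levelMat (n N : ℕ) : Matrix (Fin 6) (Fin 6) ℤ := diagonal fun i => (levelVec n N i : ℤ)

theorem hypSum_eq_levelMat_mul (m n N : ℕ) : hypSum₄ (N : ℤ) (hypSum₂ (n : ℤ) (-SK m)) =
    levelMat n N * S₁ m * levelMat n N := by
  rw [levelMat]
  ext i j
  rw [mul_diagonal, diagonal_mul]
  fin_cases i <;> fin_cases j <;> simp [S₁, S₀, hypSum₄, hypSum₂, levelVec]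

theorem det_levelMat_ne_zero {n N : ℕ} (hn : n ≠ 0) (hN : N ≠ 0) : (levelMat n N).det ≠ 0 := by
  rw [levelMat, det_diagonal, Fin.prod_univ_six]
  simp [levelVec, hn, hN]

theorem exists_real_inverse {L : Matrix (Fin 6) (Fin 6) ℤ} (hL : L.det ≠ 0) :
    ∃ Q : Matrix (Fin 6) (Fin 6) ℝ, L.map (Int.cast : ℤ → ℝ) * Q = 1 ∧
      Q * L.map (Int.cast : ℤ → ℝ) = 1 := by
  have h : IsUnit (L.map (Int.cast : ℤ → ℝ)).det := by
    have e := (Int.castRingHom ℝ).map_det L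
    rw [RingHom.mapMatrix_apply] at e
    refine isUnit_iff_ne_zero.2 fun h0 => hL ?_
    exact Int.cast_injective (α := ℝ) ((e.trans h0).trans Int.cast_zero.symm)
  exact ⟨_, mul_nonsing_inv _ h, nonsing_inv_mul _ h⟩

section Conj

variable {S L : Matrix (Fin 6) (Fin 6) ℤ}

theorem det_eq_one_of_mul_eq {U V : Matrix (Fin 6) (Fin 6) ℤ} (hL : L.det ≠ 0)
    (h : L * U = V * L) : U.det = V.det := by
  have := congrArg det h
  rw [det_mul, det_mul, mul_comm V.det] at this
  exact mul_left_cancel₀ hL this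

theorem exists_mem_kernel_of_conj (hL : L.det ≠ 0) (hLt : Lᵀ = L)
    {U : SpecialLinearGroup (Fin 6) ℤ} (hU : U ∈ discriminantKernel (L * S * L)) :
    ∃ V ∈ discriminantKernel S, (∃ X : Matrix (Fin 6) (Fin 6) ℤ, V.1 = 1 + L * X * L * S) ∧
      L * U.1 = V.1 * L := by
  obtain ⟨hU0, X, hX⟩ := hU
  have hLU : L * U.1 = (1 + L * X * L * S) * L := by
    rw [show U.1 = _ from hX]
    noncomm_ring
  have hdet : (1 + L * X * L * S).det = 1 := by rw [← det_eq_one_of_mul_eq hL hLU, U.2]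
  refine ⟨⟨_, hdet⟩, ⟨?_, L * X * L, rfl⟩, ⟨X, rfl⟩, hLU⟩
  obtain ⟨Q, h1, h2⟩ := exists_real_inverse hL
  have hQt : Qᵀ * L.map (Int.cast : ℤ → ℝ) = 1 := by
    have := congrArg transpose h1
    rwa [transpose_mul, transpose_one, ← transpose_map, hLt] at this
  refine conj_mem_specialOrthogonal₀ (T := L * S * L) (P := L.map (Int.cast : ℤ → ℝ)) (Q := Q) h1
    ?_ ?_ hU0
  · rw [map_intCast_mul, map_intCast_mul]
    calc S.map (Int.cast : ℤ → ℝ) = (Qᵀ * L.map (Int.cast : ℤ → ℝ)) * S.map (Int.cast : ℤ → ℝ) *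
          (L.map (Int.cast : ℤ → ℝ) * Q) := by rw [hQt, h1, Matrix.one_mul, Matrix.mul_one]
      _ = _ := by simp only [Matrix.mul_assoc]
  · change (1 + L * X * L * S).map (Int.cast : ℤ → ℝ) = L.map _ * U.1.map (Int.cast : ℤ → ℝ) * Q
    rw [← map_intCast_mul, hLU, map_intCast_mul,
      Matrix.mul_assoc _ (L.map (Int.cast : ℤ → ℝ)), h1, Matrix.mul_one]

theorem exists_mem_kernel_conj (hL : L.det ≠ 0) (hLt : Lᵀ = L)
    {V : SpecialLinearGroup (Fin 6) ℤ} (hV : V ∈ discriminantKernel S)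
    {X : Matrix (Fin 6) (Fin 6) ℤ} (hX : V.1 = 1 + L * X * L * S) :
    ∃ U ∈ discriminantKernel (L * S * L), L * U.1 = V.1 * L := by
  have hLU : L * (1 + X * (L * S * L)) = V.1 * L := by
    rw [hX]
    noncomm_ring
  have hdet : (1 + X * (L * S * L)).det = 1 := by rw [det_eq_one_of_mul_eq hL hLU, V.2]
  refine ⟨⟨_, hdet⟩, ⟨?_, X, rfl⟩, hLU⟩
  obtain ⟨Q, h1, h2⟩ := exists_real_inverse hL
  refine conj_mem_specialOrthogonal₀ (T := S) (P := Q) (Q := L.map (Int.cast : ℤ → ℝ)) h2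
    ?_ ?_ hV.1
  · rw [map_intCast_mul, map_intCast_mul, ← transpose_map, hLt]
  · change (1 + X * (L * S * L)).map (Int.cast : ℤ → ℝ) = Q * V.1.map (Int.cast : ℤ → ℝ) * L.map _
    rw [Matrix.mul_assoc Q, ← map_intCast_mul, ← hLU, map_intCast_mul,
      ← Matrix.mul_assoc Q, h2, Matrix.one_mul]

end Conj

theorem conj_toGLQ {n N : ℕ+} {U V : SpecialLinearGroup (Fin 6) ℤ}
    (h : levelMat n N * U.1 = V.1 * levelMat n N) :
    MulAut.conj (matF n N) (toGLQ U) = toGLQ V := by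
  rw [MulAut.conj_apply, mul_inv_eq_iff_eq_mul]
  apply Units.ext
  have hmap (A B : Matrix (Fin 6) (Fin 6) ℤ) : (A * B).map (Int.cast : ℤ → ℚ) =
      A.map (Int.cast : ℤ → ℚ) * B.map (Int.cast : ℤ → ℚ) :=
    Matrix.map_mul (f := Int.castRingHom ℚ)
  have hF : ((matF n N : GL (Fin 6) ℚ) : Matrix (Fin 6) (Fin 6) ℚ) =
      (levelMat n N).map (Int.cast : ℤ → ℚ) := by
    change diagonal _ = _
    rw [levelMat, diagonal_map Int.cast_zero]
    congr 1
    ext i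
    fin_cases i <;> simp [levelVec]
  have hG (U : SpecialLinearGroup (Fin 6) ℤ) : ((toGLQ U : GL (Fin 6) ℚ) :
      Matrix (Fin 6) (Fin 6) ℚ) = U.1.map (Int.cast : ℤ → ℚ) := by
    ext i j
    simp [toGLQ]
  rw [Units.val_mul, Units.val_mul, hF, hG, hG, ← hmap, ← hmap, h]

/-! ### The congruence subgroups attached to `n ∣ N` -/

theorem congMod_neg_iff {m N : ℕ} {x : ℂ} : CongMod m N (-x) 0 ↔ CongMod m N x 0 :=
  ⟨fun h => by simpa using h.neg, fun h => by simpa using h.neg⟩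

/-- The congruences of `DefectCong` for the divisors `fᵢ fⱼ`, `f = (1, 1, 1, 1, n, N)`, in terms of
the blocks of `M`. -/
theorem defectCong_level_iff {m n N : ℕ} (hm : Squarefree m) (M : Gam m) :
    DefectCong m (fun i j => levelVec n N i * levelVec n N j) (cmat M) ↔
      (CongMod m N (blkA M).det 1 ∧ CongMod m N (blkD M).det 1 ∧
        CongMod m (N * N) (blkC M).det 0) ∧
      (CongMod m N ((blkA M * sharp (blkC M)) 0 0) 0 ∧
        CongMod m N ((blkA M * sharp (blkC M)) 0 1) 0 ∧
        CongMod m (N * n) ((blkA M * sharp (blkC M)) 1 1) 0) ∧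
      (CongMod m N ((sharp (blkC M) * blkD M) 0 0) 0 ∧
        CongMod m N ((sharp (blkC M) * blkD M) 1 0) 0 ∧
        CongMod m (N * n) ((sharp (blkC M) * blkD M) 1 1) 0) ∧
      (CongMod m n ((sharp (blkA M) * blkB M) 1 1) 0 ∧
        CongMod m n ((blkB M * sharp (blkD M)) 1 1) 0) ∧
      (CongMod m n (blkA M 0 0 * blkD M 1 1 - blkB M 0 1 * blkC M 1 0) 1 ∧
        CongMod m n (blkD M 0 0 * blkA M 1 1 - blkC M 0 1 * blkB M 1 0) 1 ∧
        CongMod m n (blkC M 0 0 * blkB M 0 1 - blkD M 0 1 * blkA M 0 0) 0 ∧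
        CongMod m n (blkD M 0 0 * blkA M 1 0 - blkC M 0 0 * blkB M 1 0) 0 ∧
        CongMod m (n * n) (blkC M 0 0 * blkB M 1 1 - blkD M 0 1 * blkA M 1 0) 0) := by
  obtain ⟨c1, c2, c3, c4⟩ := extSq_corners M
  obtain ⟨r1, r2, r3, r4⟩ := extSq_row_zero M
  obtain ⟨s1, s2, s3, s4⟩ := extSq_row_five M
  obtain ⟨t1, t2, t3, t4⟩ := extSq_col_zero M
  obtain ⟨u1, u2, u3, u4⟩ := extSq_col_five M
  have k11 : extSq (cmat M) 1 1 = blkA M 0 0 * blkD M 1 1 - blkB M 0 1 * blkC M 1 0 := rfl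
  have k44 : extSq (cmat M) 4 4 = blkD M 0 0 * blkA M 1 1 - blkC M 0 1 * blkB M 1 0 := rfl
  have k21 : extSq (cmat M) 2 1 = blkC M 0 0 * blkB M 0 1 - blkD M 0 1 * blkA M 0 0 := rfl
  have k42 : extSq (cmat M) 4 2 = blkD M 0 0 * blkA M 1 0 - blkC M 0 0 * blkB M 1 0 := rfl
  have k41 : extSq (cmat M) 4 1 = blkC M 0 0 * blkB M 1 1 - blkD M 0 1 * blkA M 1 0 := rfl
  obtain ⟨o1, o2, o3, o4⟩ := defectCong_one hm M
  constructor
  · rintro ⟨h1, h2, -, -⟩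
    have g (i j : Fin 6) (hi : i ≠ 3) (h2 : j ≠ 2) (h3 : j ≠ 3) := h1 i hi j h2 h3
    refine ⟨⟨?_, ?_, ?_⟩, ⟨?_, ?_, ?_⟩, ⟨?_, ?_, ?_⟩, ⟨?_, ?_⟩, ?_, ?_, ?_, ?_, ?_⟩
    · simpa [levelVec, c1] using! g 0 0 (by decide) (by decide) (by decide)
    · simpa [levelVec, c4] using! g 5 5 (by decide) (by decide) (by decide)
    · simpa [levelVec, c3, congMod_neg_iff] using! g 5 0 (by decide) (by decide) (by decide)
    · simpa [levelVec, t1, congMod_neg_iff] using! g 1 0 (by decide) (by decide) (by decide)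
    · simpa [levelVec, t2, congMod_neg_iff] using! g 2 0 (by decide) (by decide) (by decide)
    · simpa [levelVec, t4, congMod_neg_iff, mul_comm N] using!
        g 4 0 (by decide) (by decide) (by decide)
    · simpa [levelVec, s4] using! g 5 4 (by decide) (by decide) (by decide)
    · simpa [levelVec, s2, congMod_neg_iff] using! h2 5 (by decide) (by decide)
    · simpa [levelVec, s1] using! g 5 1 (by decide) (by decide) (by decide)
    · simpa [levelVec, r1, congMod_neg_iff] using! g 0 1 (by decide) (by decide) (by decide)
    · simpa [levelVec, u4] using! g 4 5 (by decide) (by decide) (by decide)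
    · simpa [levelVec, k11] using! g 1 1 (by decide) (by decide) (by decide)
    · simpa [levelVec, k44] using! g 4 4 (by decide) (by decide) (by decide)
    · simpa [levelVec, k21] using! g 2 1 (by decide) (by decide) (by decide)
    · simpa [levelVec, k42] using! h2 4 (by decide) (by decide)
    · simpa [levelVec, k41] using! g 4 1 (by decide) (by decide) (by decide)
  · rintro ⟨⟨a1, a2, a3⟩, ⟨b1, b2, b3⟩, ⟨d1, d2, d3⟩, ⟨e1, e2⟩, f1, f2, f3, f4, f5⟩
    refine ⟨fun i hi j h2 h3 => ?_, fun i h2 h3 => ?_, by simpa [levelVec] using! o3,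
      by simpa [levelVec] using! o4⟩
    · have o := o1 i hi j h2 h3
      fin_cases i <;> fin_cases j
      all_goals first
        | exact absurd rfl hi | exact absurd rfl h2 | exact absurd rfl h3
        | exact o | skip
      · simpa [levelVec, c1] using! a1
      · simpa [levelVec, r1, congMod_neg_iff] using! e1
      · simpa [levelVec, t1, congMod_neg_iff] using! b1
      · simpa [levelVec, k11] using! f1
      · simpa [levelVec, t2, congMod_neg_iff] using! b2
      · simpa [levelVec, k21] using! f3
      · simpa [levelVec, t4, congMod_neg_iff, mul_comm N] using! b3
      · simpa [levelVec, k41] using! f5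
      · simpa [levelVec, k44] using! f2
      · simpa [levelVec, u4] using! e2
      · simpa [levelVec, c3, congMod_neg_iff] using! a3
      · simpa [levelVec, s1] using! d3
      · simpa [levelVec, s4] using! d1
      · simpa [levelVec, c4] using! a2
    · have o := o2 i h2 h3
      fin_cases i
      all_goals first | exact absurd rfl h2 | exact absurd rfl h3 | exact o | skip
      · simpa [levelVec, k42] using! f4
      · simpa [levelVec, s2, congMod_neg_iff] using! d2

/-- Elements with a common inverse are congruent. -/
theorem CongMod.of_mul_one {m N : ℕ} {x y z : ℂ} (hx : x ∈ (toC m).range)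
    (hz : z ∈ (toC m).range) (hxy : CongMod m N (x * y) 1) (hzy : CongMod m N (z * y) 1) :
    CongMod m N x z := by
  have h1 := CongMod.mul hx (one_mem _) (CongMod.refl x) hzy
  have h2 := CongMod.mul hz (one_mem _) (CongMod.refl z) hxy
  rw [mul_one] at h1 h2
  exact h1.symm.trans (by convert h2 using 1; ring)

/-- A unit modulo `N` can be cancelled. -/
theorem CongMod.of_mul_zero {m N : ℕ} {x y z : ℂ} (hx : x ∈ (toC m).range)
    (hz : z ∈ (toC m).range) (hzy : CongMod m N (z * y) 1) (hyx : CongMod m N (y * x) 0) :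
    CongMod m N x 0 := by
  have h1 := CongMod.mul hx (one_mem _) (CongMod.refl x) hzy
  rw [mul_one] at h1
  refine h1.symm.trans ?_
  convert hyx.mul_left hz using 1
  ring

theorem CongMod.zero_of_eq {m N : ℕ} {x y : ℂ} (h : CongMod m N x 0) (e : y = x) :
    CongMod m N y 0 := e ▸ h

theorem CongMod.add_zero' {m N : ℕ} {x y w : ℂ} (h : CongMod m N x w) (h' : CongMod m N y 0) :
    CongMod m N (x + y) w := by simpa using h.add h'

theorem CongMod.sub_zero' {m N : ℕ} {x y w : ℂ} (h : CongMod m N x w) (h' : CongMod m N y 0) :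
    CongMod m N (x - y) w := by simpa using h.sub h'

theorem sharp_mul_eq (X Y : Matrix (Fin 2) (Fin 2) ℂ) : sharp X * Y =
    !![X 1 1 * Y 0 0 - X 0 1 * Y 1 0, X 1 1 * Y 0 1 - X 0 1 * Y 1 1;
       X 0 0 * Y 1 0 - X 1 0 * Y 0 0, X 0 0 * Y 1 1 - X 1 0 * Y 0 1] := by
  ext i j
  fin_cases i <;> fin_cases j <;> simp [sharp, Matrix.mul_apply, Fin.sum_univ_two] <;> ring

theorem mul_sharp_eq (X Y : Matrix (Fin 2) (Fin 2) ℂ) : X * sharp Y =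
    !![X 0 0 * Y 1 1 - X 0 1 * Y 1 0, X 0 1 * Y 0 0 - X 0 0 * Y 0 1;
       X 1 0 * Y 1 1 - X 1 1 * Y 1 0, X 1 1 * Y 0 0 - X 1 0 * Y 0 1] := by
  ext i j
  fin_cases i <;> fin_cases j <;> simp [sharp, Matrix.mul_apply, Fin.sum_univ_two] <;> ring

/-- The entries of the exterior square inherit their congruences from the entries of `M`. -/
theorem defectCong_of_mixedCond {m n N : ℕ} (hm : Squarefree m) (hn : n ∣ N) {M : Gam m}
    (h : mixedCond n N M) : DefectCong m (fun i j => levelVec n N i * levelVec n N j) (cmat M) := by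
  rw [defectCong_level_iff hm]
  obtain ⟨⟨ε, h0, h1, h2, h3, h4⟩, hdA, hdD, ha, hb, hd, hc1, hc2, hc3, hc4⟩ := h
  have mA := fun i j => (blk_mem M i j).1
  have mB := fun i j => (blk_mem M i j).2.1
  have mC := fun i j => (blk_mem M i j).2.2.1
  have mD := fun i j => (blk_mem M i j).2.2.2
  have hc0 := hc1.of_dvd (dvd_mul_right N n)
  have mε : toC m ε ∈ (toC m).range := ⟨ε, rfl⟩
  have h3' : CongMod m n (blkA M 1 1) (conj (toC m ε)) := by simpa using h3.conj
  have h4' : CongMod m n (blkD M 1 1) (conj (toC m ε)) := by simpa using h4.conj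
  have hcn := hc0.of_dvd hn
  have hcn2 := hc2.of_dvd hn
  have hcn3 := hc3.of_dvd hn
  simp only [sharp_mul_eq, mul_sharp_eq, det_fin_two (blkC M)]
  refine ⟨⟨hdA, hdD, ?_⟩, ⟨?_, ?_, ?_⟩, ⟨?_, ?_, ?_⟩, ⟨?_, ?_⟩, ?_, ?_, ?_, ?_, ?_⟩
  · exact (hc0.mul_zero hc4).sub_zero' (hc2.mul_zero hc3)
  · exact (hc4.mul_left (mA 0 0)).sub_zero' (hc3.mul_left (mA 0 1))
  · exact (hc0.mul_left (mA 0 1)).sub_zero' (hc2.mul_left (mA 0 0))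
  · exact (hc1.mul_left (mA 1 1)).sub_zero' ((hc2.mul_zero ha).zero_of_eq (mul_comm _ _))
  · exact (hc4.mul_right (mD 0 0)).sub_zero' (hc2.mul_right (mD 1 0))
  · exact (hc0.mul_right (mD 1 0)).sub_zero' (hc3.mul_right (mD 0 0))
  · exact (hc1.mul_right (mD 1 1)).sub_zero' (hc3.mul_zero hd)
  · exact (hb.mul_left (mA 0 0)).sub_zero' (ha.mul_right (mB 0 1))
  · exact (hb.mul_right (mD 0 0)).sub_zero' (hd.mul_left (mB 1 0))
  · exact ((CongMod.mul (mA 0 0) (conj_mem_range mε) h1 h4').trans h0).sub_zero'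
      (hcn3.mul_left (mB 0 1))
  · exact ((CongMod.mul (mD 0 0) (conj_mem_range mε) h2 h3').trans h0).sub_zero'
      (hcn2.mul_right (mB 1 0))
  · exact (hcn.mul_right (mB 0 1)).sub_zero' (hd.mul_right (mA 0 0))
  · exact (ha.mul_left (mD 0 0)).sub_zero' (hcn.mul_right (mB 1 0))
  · exact (hcn.mul_zero hb).sub_zero' (hd.mul_zero ha)

/-- The entries of `M` are recovered one at a time, by cancelling factors that are units modulo `N`
or `n`; the relation `A Dᴴ - B Cᴴ = I` brings in the complex conjugates. -/
theorem mixedCond_of_defectCong {m n N : ℕ} (hm : Squarefree m) (hn : n ∣ N) {M : Gam m}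
    (h : DefectCong m (fun i j => levelVec n N i * levelVec n N j) (cmat M)) :
    mixedCond n N M := by
  rw [defectCong_level_iff hm] at h
  have hherm := (tildeWellDefined M).2.2.2.2.2.2.2.1
  have h01 : (sharp (blkC M) * blkD M) 0 1 = conj ((sharp (blkC M) * blkD M) 1 0) :=
    (hherm.apply 0 1).symm
  simp only [sharp_mul_eq, mul_sharp_eq] at h h01
  obtain ⟨⟨hdA, hdD, -⟩, -, ⟨d1, d2, d3⟩, ⟨e1, -⟩, f1, f2, f3, f4, -⟩ := h
  have d4 := d2.conj_zero
  rw [← h01] at d4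
  have mA := fun i j => (blk_mem M i j).1
  have mB := fun i j => (blk_mem M i j).2.1
  have mC := fun i j => (blk_mem M i j).2.2.1
  have mD := fun i j => (blk_mem M i j).2.2.2
  have d3' := d3.of_dvd (dvd_mul_right N n)
  change CongMod m N (blkC M 1 1 * blkD M 0 0 - blkC M 0 1 * blkD M 1 0) 0 at d1
  change CongMod m N (blkC M 0 0 * blkD M 1 0 - blkC M 1 0 * blkD M 0 0) 0 at d2
  change CongMod m (N * n) (blkC M 0 0 * blkD M 1 1 - blkC M 1 0 * blkD M 0 1) 0 at d3
  change CongMod m N (blkC M 0 0 * blkD M 1 1 - blkC M 1 0 * blkD M 0 1) 0 at d3'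
  change CongMod m N (blkC M 1 1 * blkD M 0 1 - blkC M 0 1 * blkD M 1 1) 0 at d4
  change CongMod m n (blkA M 0 0 * blkB M 1 1 - blkA M 1 0 * blkB M 0 1) 0 at e1
  have hdD' : CongMod m N (1 * (blkD M).det) 1 := by rwa [one_mul]
  -- `C♯ D ≡ 0` and `det D ≡ 1` imply `C ≡ 0`, as `D D♯ = det D`
  have hC {x : ℂ} (hx : x ∈ (toC m).range) (h : CongMod m N ((blkD M).det * x) 0) :
      CongMod m N x 0 := CongMod.of_mul_zero hx (one_mem _) hdD' h
  have hc00 : CongMod m N (blkC M 0 0) 0 := hC (mC 0 0) <|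
    ((d3'.mul_right (mD 0 0)).sub_zero' (d2.mul_right (mD 0 1))).zero_of_eq
      (by rw [det_fin_two]; ring)
  have hc01 : CongMod m N (blkC M 0 1) 0 := hC (mC 0 1) <|
    ((d1.mul_right (mD 0 1)).sub_zero' (d4.mul_right (mD 0 0))).zero_of_eq
      (by rw [det_fin_two]; ring)
  have hc10 : CongMod m N (blkC M 1 0) 0 := hC (mC 1 0) <|
    ((d3'.mul_right (mD 1 0)).sub_zero' (d2.mul_right (mD 1 1))).zero_of_eq
      (by rw [det_fin_two]; ring)
  have hc11 : CongMod m N (blkC M 1 1) 0 := hC (mC 1 1) <|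
    ((d1.mul_right (mD 1 1)).sub_zero' (d4.mul_right (mD 1 0))).zero_of_eq
      (by rw [det_fin_two]; ring)
  have hn00 := hc00.of_dvd hn
  have hn01 := hc01.of_dvd hn
  have hn10 := hc10.of_dvd hn
  have g1 : CongMod m n (blkA M 0 0 * blkD M 1 1) 1 := by
    simpa using f1.add_zero' (hn10.mul_left (mB 0 1))
  have g2 : CongMod m n (blkD M 0 0 * blkA M 1 1) 1 := by
    simpa using f2.add_zero' (hn01.mul_right (mB 1 0))
  have hd01 : CongMod m n (blkD M 0 1) 0 :=
    CongMod.of_mul_zero (mD 0 1) (mD 1 1) (by rwa [mul_comm])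
      (((hn00.mul_right (mB 0 1)).sub_zero' f3).zero_of_eq (by ring))
  have ha10 : CongMod m n (blkA M 1 0) 0 :=
    CongMod.of_mul_zero (mA 1 0) (mA 1 1) (by rwa [mul_comm])
      ((f4.add_zero' (hn00.mul_right (mB 1 0))).zero_of_eq (by ring))
  have hb11 : CongMod m n (blkB M 1 1) 0 :=
    CongMod.of_mul_zero (mB 1 1) (mD 1 1) (by rwa [mul_comm])
      ((e1.add_zero' (ha10.mul_right (mB 0 1))).zero_of_eq (by ring))
  have g3 : CongMod m n (blkA M 0 0 * blkA M 1 1) 1 := by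
    have := (hdA.of_dvd hn).add_zero' (ha10.mul_left (mA 0 1))
    rwa [det_fin_two, sub_add_cancel] at this
  have hr := (blk_mul_inv M).1
  have hr0 := congrFun (congrFun hr 0) 0
  have hr1 := congrFun (congrFun hr 1) 1
  simp [Matrix.mul_apply, Fin.sum_univ_two] at hr0 hr1
  have g4 : CongMod m n (blkA M 0 0 * conj (blkD M 0 0)) 1 := by
    have h1 := ((hn00.conj_zero.mul_left (mB 0 0)).add_zero'
      (hn01.conj_zero.mul_left (mB 0 1))).sub_zero' (hd01.conj_zero.mul_left (mA 0 1))
    have h2 := (CongMod.refl (m := m) (N := n) 1).add_zero' h1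
    convert h2 using 1
    rw [← hr0]; ring
  have g1' : CongMod m n (blkD M 1 1 * blkA M 0 0) 1 := by rwa [mul_comm]
  have g3' : CongMod m n (blkA M 1 1 * blkA M 0 0) 1 := by rwa [mul_comm]
  have g4' : CongMod m n (conj (blkD M 0 0) * blkA M 0 0) 1 := by rwa [mul_comm]
  have e1 : CongMod m n (blkA M 0 0) (blkD M 0 0) := CongMod.of_mul_one (mA 0 0) (mD 0 0) g3 g2
  have e2 : CongMod m n (conj (blkA M 1 1)) (blkA M 0 0) := by
    have := (CongMod.of_mul_one (mA 1 1) (conj_mem_range (mD 0 0)) g3' g4').conj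
    rw [Complex.conj_conj] at this
    exact this.trans e1.symm
  have e3 : CongMod m n (conj (blkD M 1 1)) (blkA M 0 0) := by
    have := (CongMod.of_mul_one (mD 1 1) (conj_mem_range (mD 0 0)) g1' g4').conj
    rw [Complex.conj_conj] at this
    exact this.trans e1.symm
  have e4 : CongMod m n (blkA M 0 0 * conj (blkA M 0 0)) 1 :=
    (CongMod.mul (mA 0 0) (conj_mem_range (mD 0 0)) (CongMod.refl _) e1.conj).trans g4
  have hc : CongMod m (N * n) (blkC M 0 0) 0 := by
    -- `c₁₁ = c₁₁ d₂₂ d₁₁ - c₁₁ d₁₂ d₂₁ - c₁₁ (det D - 1)`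
    have h1 := (d3.add_zero' (hc10.mul_zero hd01)).mul_right (mD 0 0)
    have h2 := (hc00.mul_zero hd01).mul_right (mD 1 0)
    have h3 := (hc00.mul_zero (CongMod.sub_iff.2 hdD)).of_dvd (mul_dvd_mul_left N hn)
    exact ((h1.sub_zero' h2).sub_zero' h3).zero_of_eq (by rw [det_fin_two]; ring)
  obtain ⟨ε, hε⟩ := mA 0 0
  rw [← hε] at e2 e3 e4
  exact ⟨⟨ε, e4, by rw [hε]; exact CongMod.refl _, by rw [hε]; exact e1.symm, e2, e3⟩, hdA, hdD,
    ha10, hb11, hd01, hc, hc01, hc10, hc11⟩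

/-- With `F = diag(1, 1, 1, 1, n, N)`, the form `U(N) ⊕ U(n) ⊕ (-S_K)` is `F S₁ F`, and
`F (I + X F S₁ F) F⁻¹ = I + (F X F) S₁`. Hence the conjugated kernel consists of the isometries
whose defect is divisible by `fᵢ fⱼ` at position `(i, j)`. -/
theorem conjKernel_eq_map {m : ℕ} (hm : Squarefree m) {n N : ℕ+} (hn : (n : ℕ) ∣ (N : ℕ)) :
    conjKernel m n N = (mixedSubgroup m n N hn).map
      (toGLQ.comp ((discriminantKernel (S₁ m)).subtype.comp (orthoHom hm))) := by
  have hL := det_levelMat_ne_zero n.ne_zero N.ne_zero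
  have hLt : (levelMat n N)ᵀ = levelMat n N := diagonal_transpose _
  have hLX (X : Matrix (Fin 6) (Fin 6) ℤ) (i j : Fin 6) : (levelMat n N * X * levelMat n N) i j =
      levelVec n N i * X i j * levelVec n N j := by
    rw [levelMat, mul_diagonal, diagonal_mul]
  rw [conjKernel, hypSum_eq_levelMat_mul]
  ext g
  constructor
  · rintro ⟨_, ⟨U, hU, rfl⟩, rfl⟩
    obtain ⟨V, hV, ⟨X, hX⟩, hUV⟩ := exists_mem_kernel_of_conj hL hLt hU
    obtain ⟨M, hM⟩ := orthoHom_surjective hm ⟨V, hV⟩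
    refine ⟨M, mixedCond_of_defectCong hm hn ?_, ?_⟩
    · refine (defectCong_iff_exists hm (fun _ => rfl) (fun _ => rfl) M).2
        ⟨levelMat n N * X * levelMat n N, by rw [hM]; exact hX, fun i j => ⟨X i j, ?_⟩⟩
      rw [hLX]
      push_cast
      ring
    · refine Eq.trans ?_ (conj_toGLQ hUV).symm
      exact congrArg toGLQ (congrArg Subtype.val hM)
  · rintro ⟨M, hM, rfl⟩
    obtain ⟨Y, hY, hd⟩ := (defectCong_iff_exists hm (fun _ => rfl) (fun _ => rfl) M).1
      (defectCong_of_mixedCond hm hn hM)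
    choose X hX using hd
    have e : Y = levelMat n N * of X * levelMat n N := by
      ext i j
      rw [hLX, hX]
      push_cast
      rw [of_apply]
      ring
    rw [e] at hY
    obtain ⟨U, hU, hUV⟩ := exists_mem_kernel_conj hL hLt (orthoHom hm M).2 hY
    exact ⟨_, ⟨U, hU, rfl⟩, conj_toGLQ hUV⟩

end

end HermMod

theorem theorem2 (m : ℕ) (hm : Squarefree m) :
    (∀ M : Gam m, TildeWellDefined M) ∧
    ∃ Φ : (Gam m ⧸ pmOne m) ≃* discriminantKernel (S₁ m),
      (∀ M : Gam m,
        ((Φ (QuotientGroup.mk M) : Matrix.SpecialLinearGroup (Fin 6) ℤ) :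
          Matrix (Fin 6) (Fin 6) ℤ).map (Int.cast : ℤ → ℝ) = tilde M) ∧
      (∀ N : ℕ+,
        pmOne m ≤ principalSubgroup m N ∧
        (modPm (principalSubgroup m N)).map
            ((discriminantKernel (S₁ m)).subtype.comp Φ.toMonoidHom) =
          discriminantKernel ((N : ℤ) • S₁ m)) ∧
      (∀ (n N : ℕ+) (hn : (n : ℕ) ∣ (N : ℕ)),
        pmOne m ≤ mixedSubgroup m n N hn ∧
        conjKernel m n N ≤ (discriminantKernel (S₁ m)).map toGLQ ∧
        (modPm (mixedSubgroup m n N hn)).map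
            (toGLQ.comp ((discriminantKernel (S₁ m)).subtype.comp Φ.toMonoidHom)) =
          conjKernel m n N) := by
  refine ⟨tildeWellDefined, orthoEquiv hm, fun M => ?_, fun N => ⟨pmOne_le_principalSubgroup m N, ?_⟩,
    fun n N hn => ⟨pmOne_le_mixedSubgroup m hn, ?_, ?_⟩⟩
  · rw [orthoEquiv_mk, orthoHom_map, tilde_eq hm.ne_zero]
  · rw [map_modPm]
    exact (discriminantKernel_smul_eq_map hm N.ne_zero).symm
  · rw [conjKernel_eq_map hm hn]
    rintro _ ⟨M, -, rfl⟩
    exact ⟨_, (orthoHom hm M).2, rfl⟩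
  · rw [conjKernel_eq_map hm hn]
    exact map_modPm hm _ (toGLQ.comp (discriminantKernel (S₁ m)).subtype)
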